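/- Burling graphs. The Burling sequence $B_1,B_2,\ldots$ of graphs, together with families $\mathcal S_1,\mathcal S_2,\ldots$ of vertex sets, is defined as follows. $B_1$ has a single vertex, and $\mathcal S_1=\{V(B_1)\}$. The graph $B_{k+1}$ consists of a main copy of $B_k$ and, for every $S\in\mathcal S_k$ (viewed in the main copy), a further copy $H_S$ of $B_k$ and, for every $Q\in\mathcal S_k$ (viewed in $H_S$), a new vertex $v_{S,Q}$ whose neighbors are exactly the vertices of $Q$ in $H_S$. The family $\mathcal S_{k+1}$ comprises the sets $S\cup Q$ and $S\cup\{v_{S,Q}\}$ for all such $S$ and $Q$. A graph is a Burling graph if it is isomorphic to an induced subgraph of $B_k$ for some $k\geq 1$. Burling sets. A triple $(V,\prec,\rightsquigarrow)$ is a Burling set if $V$ is a non-empty finite set, $\prec$ is a strict partial order on $V$, $\rightsquigarrow$ is an acyclic relation on $V$, and for all $x,y,z\in V$: (1) if $x\prec y$, $x\prec z$ and $y\neq z$, then $y\prec z$ or $z\prec y$; (2) if $x\rightsquigarrow y$, $x\rightsquigarrow z$ and $y\neq z$, then $y\prec z$ or $z\prec y$; (3) if $x\rightsquigarrow y$ and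 $x\prec z$, then $y\prec z$; (4) if $x\rightsquigarrow y$ and $y\prec z$, then $x\rightsquigarrow z$ or $x\prec z$. Let $E(\rightsquigarrow)=\{xy : x\rightsquigarrow y\}$. Theorem. There is a polynomial-time algorithm which, given a non-empty finite simple graph $G$ with vertex set $V$, either declares $G$ a Burling graph and produces a Burling set $(V,\prec,\rightsquigarrow)$ such that $G=(V,E(\rightsquigarrow))$, or reports that $G$ is not a Burling graph; in the latter case there is also no Burling set $(V,\prec,\rightsquigarrow)$ such that $G=(V,E(\rightsquigarrow))$. Here the algorithm is a deterministic program for a random access machine with unit-cost addition, truncated subtraction, indirect memory access and tests for zero; the input $G$ on $V=\{0,\ldots,n-1\}$ is given by $n$ and its adjacency matrix, the relations $\prec$ and $\rightsquigarrow$ are output as their matrices, and the running time is bounded by a polynomial in $n$. -/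

import Mathlib

/-! ### Burling graphs -/

/-- A graph together with a distinguished family of sets of vertices. -/
structure ProbedGraph where
  V : Type
  graph : SimpleGraph V
  probes : Set (Set V)

namespace ProbedGraph

/-- Vertices of the next graph of the Burling sequence: a main copy of `P` and, for every
distinguished set `S` of the main copy, a further copy of `P` and one new vertex for every
distinguished set `Q` of that further copy. -/
abbrev NextV (P : ProbedGraph) : Type := P.V ⊕ (Σ _ : P.probes, P.V ⊕ P.probes)

/-- The vertex `v` of the main copy. -/
abbrev mainV (P : ProbedGraph) (v : P.V) : P.NextV := Sum.inl v

/-- The vertex `v` of the copy of `P` that belongs to the distinguished set `S`. -/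
abbrev copyV (P : ProbedGraph) (S : P.probes) (v : P.V) : P.NextV := Sum.inr ⟨S, Sum.inl v⟩

/-- The new vertex attached to the set `Q` of the copy of `P` that belongs to `S`. -/
abbrev newV (P : ProbedGraph) (S Q : P.probes) : P.NextV := Sum.inr ⟨S, Sum.inr Q⟩

/-- The edges of the next graph, each in one orientation. -/
inductive NextRel (P : ProbedGraph) : P.NextV → P.NextV → Prop
  | inMain {u v : P.V} (h : P.graph.Adj u v) : NextRel P (P.mainV u) (P.mainV v)
  | inCopy (S : P.probes) {u v : P.V} (h : P.graph.Adj u v) :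
      NextRel P (P.copyV S u) (P.copyV S v)
  | attach (S Q : P.probes) {u : P.V} (h : u ∈ Q.1) : NextRel P (P.newV S Q) (P.copyV S u)

/-- One step of Burling's construction. -/
def next (P : ProbedGraph) : ProbedGraph where
  V := P.NextV
  graph := SimpleGraph.fromRel P.NextRel
  probes := {T | ∃ S Q : P.probes,
    T = P.mainV '' S.1 ∪ P.copyV S '' Q.1 ∨ T = P.mainV '' S.1 ∪ {P.newV S Q}}

end ProbedGraph

/-- The Burling sequence: `burlingSeq k` is the `(k + 1)`-st graph `B_{k+1}` of the sequence
`B_1, B_2, …` (so `burlingSeq 0` is the one-vertex graph `B_1`), with its stable sets. -/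
def burlingSeq : ℕ → ProbedGraph
  | 0 => { V := Unit, graph := ⊥, probes := {Set.univ} }
  | k + 1 => (burlingSeq k).next

/-- A Burling graph is an induced subgraph of some graph of the Burling sequence. -/
def IsBurlingGraph {V : Type*} (G : SimpleGraph V) : Prop :=
  ∃ k : ℕ, Nonempty (G ↪g (burlingSeq k).graph)

/-! ### Burling sets -/

/-- `(S, prec, adj)` is a Burling set. Acyclicity of `adj` says that no element can be reached
from itself in one or more steps of `adj`. -/
structure IsBurlingSet {S : Type*} (prec adj : S → S → Prop) : Prop where
  finite : Finite S
  nonempty : Nonempty S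
  prec_irrefl : ∀ x, ¬ prec x x
  prec_trans : ∀ x y z, prec x y → prec y z → prec x z
  adj_acyclic : ∀ x, ¬ Relation.TransGen adj x x
  axiom1 : ∀ x y z, prec x y → prec x z → y ≠ z → prec y z ∨ prec z y
  axiom2 : ∀ x y z, adj x y → adj x z → y ≠ z → prec y z ∨ prec z y
  axiom3 : ∀ x y z, adj x y → prec x z → prec y z
  axiom4 : ∀ x y z, adj x y → prec y z → adj x z ∨ prec x z

/-! ### Random access machines

Programs for a random access machine whose memory consists of registers and of arrays, all
holding natural numbers, and whose arithmetic is addition and truncated subtraction. A program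
mentions finitely many registers and arrays by fixed names; only positions inside an array can be
computed at run time. Every operation costs one unit of time. Without multiplication the bit
length of the stored numbers grows by a constant amount per step, so polynomial time on this
machine is polynomial time on a Turing machine. -/

namespace RAM

/-- A memory: the contents of the registers, and of every position of every array. -/
@[ext]
structure State where
  reg : ℕ → ℕ
  arr : ℕ → ℕ → ℕ

/-- Arithmetic expressions. -/
inductive Expr
  /-- a constant -/
  | const (k : ℕ)
  /-- the content of register `x` -/
  | var (x : ℕ)
  /-- the content of array `a` at the position given by `e` -/
  | read (a : ℕ) (e : Expr)
  | add (e f : Expr)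
  /-- truncated subtraction -/
  | sub (e f : Expr)

/-- The value of an expression. -/
def Expr.eval (s : State) : Expr → ℕ
  | const k => k
  | var x => s.reg x
  | read a e => s.arr a (e.eval s)
  | add e f => e.eval s + f.eval s
  | sub e f => e.eval s - f.eval s

/-- The time to evaluate an expression: the number of its constants, registers and operations. -/
def Expr.cost : Expr → ℕ
  | const _ => 1
  | var _ => 1
  | read _ e => e.cost + 1
  | add e f => e.cost + f.cost + 1
  | sub e f => e.cost + f.cost + 1

/-- Programs. -/
inductive Cmd
  | skip
  /-- put the value of `e` into register `x` -/
  | assign (x : ℕ) (e : Expr)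
  /-- put the value of `e` into array `a` at the position given by `i` -/
  | write (a : ℕ) (i e : Expr)
  /-- run `c`, then `d` -/
  | seq (c d : Cmd)
  /-- run `c` if the value of `e` is non-zero, and `d` otherwise -/
  | ite (e : Expr) (c d : Cmd)
  /-- run `c` as long as the value of `e` is non-zero -/
  | loop (e : Expr) (c : Cmd)

/-- The memory after putting `v` into register `x`. -/
def State.setReg (s : State) (x v : ℕ) : State :=
  { s with reg := Function.update s.reg x v }

/-- The memory after putting `v` into array `a` at position `i`. -/
def State.setArr (s : State) (a i v : ℕ) : State :=
  { s with arr := Function.update s.arr a (Function.update (s.arr a) i v) }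

/-- `Exec c s s' t`: the program `c`, started with memory `s`, halts with memory `s'` after
exactly `t` units of time. -/
inductive Exec : Cmd → State → State → ℕ → Prop
  | skip (s : State) : Exec .skip s s 1
  | assign (x : ℕ) (e : Expr) (s : State) :
      Exec (.assign x e) s (s.setReg x (e.eval s)) (e.cost + 1)
  | write (a : ℕ) (i e : Expr) (s : State) :
      Exec (.write a i e) s (s.setArr a (i.eval s) (e.eval s)) (i.cost + e.cost + 1)
  | seq {c d : Cmd} {s s' s'' : State} {t u : ℕ} (hc : Exec c s s' t) (hd : Exec d s' s'' u) :
      Exec (.seq c d) s s'' (t + u)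
  | iteTrue {e : Expr} {c d : Cmd} {s s' : State} {t : ℕ} (he : e.eval s ≠ 0)
      (hc : Exec c s s' t) : Exec (.ite e c d) s s' (e.cost + 1 + t)
  | iteFalse {e : Expr} {c d : Cmd} {s s' : State} {t : ℕ} (he : e.eval s = 0)
      (hd : Exec d s s' t) : Exec (.ite e c d) s s' (e.cost + 1 + t)
  | loopTrue {e : Expr} {c : Cmd} {s s' s'' : State} {t u : ℕ} (he : e.eval s ≠ 0)
      (hc : Exec c s s' t) (hl : Exec (.loop e c) s' s'' u) :
      Exec (.loop e c) s s'' (e.cost + 1 + t + u)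
  | loopFalse {e : Expr} {c : Cmd} {s : State} (he : e.eval s = 0) :
      Exec (.loop e c) s s (e.cost + 1)

/-- The machine is deterministic: the final memory and the running time are unique. -/
theorem Exec.unique {c : Cmd} {s s₁ s₂ : State} {t₁ t₂ : ℕ} (h₁ : Exec c s s₁ t₁)
    (h₂ : Exec c s s₂ t₂) : s₁ = s₂ ∧ t₁ = t₂ := by
  induction h₁ generalizing s₂ t₂ with
  | skip s => cases h₂; exact ⟨rfl, rfl⟩
  | assign x e s => cases h₂; exact ⟨rfl, rfl⟩
  | write a i e s => cases h₂; exact ⟨rfl, rfl⟩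
  | seq hc hd ihc ihd =>
    cases h₂ with
    | seq hc' hd' =>
      obtain ⟨rfl, rfl⟩ := ihc hc'
      obtain ⟨rfl, rfl⟩ := ihd hd'
      exact ⟨rfl, rfl⟩
  | iteTrue he hc ih =>
    cases h₂ with
    | iteTrue he' hc' => obtain ⟨rfl, rfl⟩ := ih hc'; exact ⟨rfl, rfl⟩
    | iteFalse he' hd' => exact absurd he' he
  | iteFalse he hd ih =>
    cases h₂ with
    | iteTrue he' hc' => exact absurd he he'
    | iteFalse he' hd' => obtain ⟨rfl, rfl⟩ := ih hd'; exact ⟨rfl, rfl⟩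
  | loopTrue he hc hl ihc ihl =>
    cases h₂ with
    | loopTrue he' hc' hl' =>
      obtain ⟨rfl, rfl⟩ := ihc hc'
      obtain ⟨rfl, rfl⟩ := ihl hl'
      exact ⟨rfl, rfl⟩
    | loopFalse he' => exact absurd he' he
  | loopFalse he =>
    cases h₂ with
    | loopTrue he' hc' hl' => exact absurd he he'
    | loopFalse he' => exact ⟨rfl, rfl⟩

open Classical in
/-- The initial memory for an input graph with vertices `0, …, n - 1`: register `0` holds `n`,
array `0` holds the adjacency matrix row by row, and everything else is `0`. -/
noncomputable def graphInput {n : ℕ} (G : SimpleGraph (Fin n)) : State where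
  reg x := if x = 0 then n else 0
  arr a k := if a = 0 ∧ ∃ i j : Fin n, k = i * n + j ∧ G.Adj i j then 1 else 0

/-- The relation on `0, …, n - 1` whose matrix is stored row by row in array `a`. -/
def State.rel (s : State) (n a : ℕ) : Fin n → Fin n → Prop :=
  fun i j => s.arr a (i * n + j) = 1

end RAM

/-! Two facts are combined: Burling graphs are exactly the graphs of Burling sets, and a Burling set
for a given graph can be found by dynamic programming over polynomially many induced subgraphs.

Equivalence. Along the Burling sequence one carries an order and an orientation for which the
distinguished sets are upward closed chains (`ProbedGraph.Oriented.next`), and the axioms pass to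
induced subgraphs. Conversely, a part of a Burling set is embedded, by induction on its size, so
that all its upward closed chains are traces of distinguished sets: a maximal element without
in-neighbours becomes a new vertex (`ProbedEmbedding.attach`), and the elements below it move to a
further copy (`ProbedEmbedding.hang`).

Search. The elements below `x` form a union of components of `G - N[x]` (`IsRep.prec_of_conn`), so
only the components of `G` and of the graphs `G - N[x]` matter. The notion of representation for
such a component `C` (`IsRep`) also asks that every vertex outside `C` sees an upward closed chain
of `C`. A maximal element has at most one maximal out-neighbour, its parent, so the maximal elements
form a forest. For a guessed root `r` a tree is grown greedily (`Mk`): a neighbour `z` of a child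
`y` of `x` becomes a child of `y`, unless its component of `G - N[x]` fits below `x`, in which case
it is put there. The greedy tree may differ from the tree of a given representation, but it still
passes the test `Valid` when `r` is a maximal sink (`IsRep.valid`). Conversely, a tree passing the
test yields a representation (`Valid.isRep`), where the components below one vertex are ordered by
`isRep_nest`. Since these components are smaller than `C`, tables correct up to size `k` can be
improved to size `k + 1` (`Correct.succ`), and `n` rounds suffice.

Program. Each round consists of first-order definitions and of least fixed points reached within `n
* n` iterations. Such queries are compiled to the machine once and for all (`Query.exists_cmd`), so
no running time of the algorithm itself has to be analysed. -/

/-! ### Timed execution -/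

namespace RAM

/-- `c`, started with memory `s`, halts within time `T` with a memory satisfying `Q`. -/
def Runs (c : Cmd) (s : State) (T : ℕ) (Q : State → Prop) : Prop :=
  ∃ s' t, Exec c s s' t ∧ t ≤ T ∧ Q s'

theorem Runs.mono {c : Cmd} {s : State} {T U : ℕ} {P Q : State → Prop} (h : Runs c s T P)
    (hT : T ≤ U) (hQ : ∀ s', P s' → Q s') : Runs c s U Q := by
  obtain ⟨s', t, h1, h2, h3⟩ := h
  exact ⟨s', t, h1, h2.trans hT, hQ _ h3⟩

theorem Runs.skip {s : State} {Q : State → Prop} (h : Q s) : Runs .skip s 1 Q :=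
  ⟨s, 1, .skip s, le_rfl, h⟩

theorem Runs.assign {x : ℕ} {e : Expr} {s : State} {Q : State → Prop}
    (h : Q (s.setReg x (e.eval s))) : Runs (.assign x e) s (e.cost + 1) Q :=
  ⟨_, _, .assign x e s, le_rfl, h⟩

theorem Runs.write {a : ℕ} {i e : Expr} {s : State} {Q : State → Prop}
    (h : Q (s.setArr a (i.eval s) (e.eval s))) :
    Runs (.write a i e) s (i.cost + e.cost + 1) Q :=
  ⟨_, _, .write a i e s, le_rfl, h⟩

theorem Runs.seq {c d : Cmd} {s : State} {T U : ℕ} {P Q : State → Prop} (h : Runs c s T P)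
    (h' : ∀ s', P s' → Runs d s' U Q) : Runs (.seq c d) s (T + U) Q := by
  obtain ⟨s', t, h1, h2, h3⟩ := h
  obtain ⟨s'', u, h4, h5, h6⟩ := h' s' h3
  exact ⟨s'', t + u, .seq h1 h4, add_le_add h2 h5, h6⟩

theorem Runs.ite {e : Expr} {c d : Cmd} {s : State} {T : ℕ} {Q : State → Prop}
    (h : e.eval s ≠ 0 → Runs c s T Q) (h' : e.eval s = 0 → Runs d s T Q) :
    Runs (.ite e c d) s (e.cost + 1 + T) Q := by
  by_cases he : e.eval s = 0
  · obtain ⟨s', t, h1, h2, h3⟩ := h' he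
    exact ⟨s', _, .iteFalse he h1, by omega, h3⟩
  · obtain ⟨s', t, h1, h2, h3⟩ := h he
    exact ⟨s', _, .iteTrue he h1, by omega, h3⟩

/-- A loop that runs its body exactly `k` times, with an indexed invariant. -/
theorem Runs.loop {e : Expr} {c : Cmd} {T : ℕ} (I : ℕ → State → Prop) (k : ℕ)
    (h : ∀ i < k, ∀ s, I i s → e.eval s ≠ 0 ∧ Runs c s T (I (i + 1)))
    (hk : ∀ s, I k s → e.eval s = 0) {s : State} (h0 : I 0 s) :
    Runs (.loop e c) s (k * (e.cost + 1 + T) + (e.cost + 1)) (I k) := by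
  -- Induction on the number `j` of rounds still to run, so that the index of the invariant is `k -
  -- j`.
  suffices H : ∀ j ≤ k, ∀ s, I (k - j) s →
      Runs (.loop e c) s (j * (e.cost + 1 + T) + (e.cost + 1)) (I k) from
    H k le_rfl s (by simpa using h0)
  intro j
  induction j with
  | zero =>
    intro _ s hs
    exact ⟨s, _, .loopFalse (hk s (by simpa using hs)), by simp, by simpa using hs⟩
  | succ j ih =>
    intro hj s hs
    obtain ⟨he, s', t, h1, h2, h3⟩ := h (k - (j + 1)) (by omega) s hs
    have hkj : k - (j + 1) + 1 = k - j := by omega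
    rw [hkj] at h3
    obtain ⟨s'', u, h4, h5, h6⟩ := ih (by omega) s' h3
    refine ⟨s'', _, .loopTrue he h1 h4, ?_, h6⟩
    rw [Nat.succ_mul]
    omega

theorem State.setReg_reg (s : State) (x v y : ℕ) :
    (s.setReg x v).reg y = if y = x then v else s.reg y := by
  simp [State.setReg, Function.update_apply]

theorem State.setReg_arr (s : State) (x v : ℕ) : (s.setReg x v).arr = s.arr := rfl

theorem State.setArr_reg (s : State) (a i v : ℕ) : (s.setArr a i v).reg = s.reg := rfl

theorem State.setArr_arr (s : State) (a i v b j : ℕ) :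
    (s.setArr a i v).arr b j = if b = a ∧ j = i then v else s.arr b j := by
  by_cases hb : b = a
  · subst hb
    simp [State.setArr, Function.update_apply]
  · simp [State.setArr, hb]

end RAM

/-! ### First-order queries with iteration -/

namespace Query

open RAM

/-- The number with the digits `l` in base `n`. -/
def idx {n : ℕ} (l : List (Fin n)) : ℕ := l.foldl (fun acc (x : Fin n) => acc * n + (x : ℕ)) 0

theorem idx_concat {n : ℕ} (l : List (Fin n)) (x : Fin n) :
    idx (l ++ [x]) = idx l * n + x := by
  simp [idx]

theorem idx_injective {n : ℕ} : ∀ l l' : List (Fin n), l.length = l'.length → idx l = idx l' →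
    l = l' := by
  intro l
  induction l using List.reverseRecOn with
  | nil => intro l' h _; simpa using h.symm
  | append_singleton l x ih =>
    intro l' h h'
    rcases List.eq_nil_or_concat l' with rfl | ⟨l'', y, rfl⟩
    · simp at h
    · rw [List.concat_eq_append] at *
      rw [idx_concat, idx_concat] at h'
      have hx := x.2
      have hy := y.2
      have h1 : (x : ℕ) = y := by
        have := congrArg (· % n) h'
        simpa [Nat.add_mod, Nat.mod_eq_of_lt hx, Nat.mod_eq_of_lt hy] using this
      have h2 : idx l = idx l'' := by
        rw [h1] at h'
        exact Nat.eq_of_mul_eq_mul_right (by omega) (Nat.add_right_cancel h')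
      rw [ih l'' (by simpa using h) h2, Fin.ext h1]

/-- First-order formulas over a finite ordered domain; `rel a vs` is the relation symbol `a`
applied to the variables `vs`. -/
inductive Fml
  | rel (a : ℕ) (vs : List ℕ)
  | eq (x y : ℕ)
  | lt (x y : ℕ)
  | neg (φ : Fml)
  | and (φ ψ : Fml)
  | ex (x : ℕ) (φ : Fml)

/-- An interpretation of all relation symbols on `Fin n`. -/
abbrev Store (n : ℕ) := ℕ → List (Fin n) → Prop

namespace Fml

/-- The truth value of a formula. -/
def eval {n : ℕ} (σ : Store n) : Fml → (ℕ → Fin n) → Prop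
  | rel a vs, e => σ a (vs.map e)
  | eq x y, e => e x = e y
  | lt x y, e => e x < e y
  | neg φ, e => ¬ φ.eval σ e
  | and φ ψ, e => φ.eval σ e ∧ ψ.eval σ e
  | ex x φ, e => ∃ z, φ.eval σ (Function.update e x z)

/-- All relation symbols are below `50`, different from `b`, and used with their arity. -/
def WF (ar : ℕ → ℕ) (b : ℕ) : Fml → Prop
  | rel a vs => vs.length = ar a ∧ a ≠ b ∧ a < 50
  | eq _ _ => True
  | lt _ _ => True
  | neg φ => φ.WF ar b
  | and φ ψ => φ.WF ar b ∧ ψ.WF ar b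
  | ex _ φ => φ.WF ar b

/-- Multiply register `2` by `n` and add the value of the variable `v`. -/
def digitCode (v : ℕ) : Cmd :=
  .seq (.assign 3 (.const 0)) <| .seq (.assign 4 (.var 0)) <|
  .seq (.loop (.var 4) (.seq (.assign 3 (.add (.var 3) (.var 2)))
    (.assign 4 (.sub (.var 4) (.const 1))))) <|
  .assign 2 (.add (.var 3) (.var (5 + 3 * v)))

/-- Append the digits `vs` to the number in register `2`. -/
def digitsCode : List ℕ → Cmd
  | [] => .skip
  | v :: vs => .seq (digitCode v) (digitsCode vs)

/-- The program that puts the truth value of a formula into register `1`. Register `0` holds the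
size of the domain, register `5 + 3 * v` the value of the variable `v`. -/
def compile : Fml → ℕ → Cmd
  | rel a vs, _ => .seq (.assign 2 (.const 0)) <| .seq (digitsCode vs) <|
      .assign 1 (.sub (.const 1) (.add (.sub (.read a (.var 2)) (.const 1))
        (.sub (.const 1) (.read a (.var 2)))))
  | eq x y, _ => .assign 1 (.sub (.const 1) (.add (.sub (.var (5 + 3 * x)) (.var (5 + 3 * y)))
        (.sub (.var (5 + 3 * y)) (.var (5 + 3 * x)))))
  | lt x y, _ => .assign 1 (.sub (.const 1) (.sub (.const 1)
        (.sub (.var (5 + 3 * y)) (.var (5 + 3 * x)))))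
  | neg φ, d => .seq (φ.compile d) (.assign 1 (.sub (.const 1) (.var 1)))
  | and φ ψ, d => .seq (φ.compile d) (.ite (.var 1) (ψ.compile d) .skip)
  | ex x φ, d =>
      .seq (.assign (6 + 3 * d) (.var (5 + 3 * x))) <|
      .seq (.assign (7 + 3 * d) (.const 0)) <|
      .seq (.assign (5 + 3 * x) (.const 0)) <|
      .seq (.loop (.sub (.var 0) (.var (5 + 3 * x))) <|
        .seq (φ.compile (d + 1)) <|
        .seq (.ite (.var 1) (.assign (7 + 3 * d) (.const 1)) .skip)
          (.assign (5 + 3 * x) (.add (.var (5 + 3 * x)) (.const 1)))) <|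
      .seq (.assign (5 + 3 * x) (.var (6 + 3 * d)))
        (.assign 1 (.var (7 + 3 * d)))

/-- The registers that evaluating a formula at depth `d` leaves unchanged. -/
def Kept (d r : ℕ) : Prop := r = 0 ∨ ∃ v, r = 5 + 3 * v ∨ (v < d ∧ (r = 6 + 3 * v ∨ r = 7 + 3 * v))

/-- The machine cannot multiply, so the product with `n` is a repeated addition; this costs the
linear term of the bound. -/
theorem digitCode_runs (v : ℕ) (s : State) :
    Runs (digitCode v) s (s.reg 0 * 12 + 12) fun s' => s'.arr = s.arr ∧
      s'.reg 2 = s.reg 2 * s.reg 0 + s.reg (5 + 3 * v) ∧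
      ∀ r, r ≠ 2 → r ≠ 3 → r ≠ 4 → s'.reg r = s.reg r := by
  refine Runs.mono (T := (1 + 1) + ((1 + 1) + ((s.reg 0 * (1 + 1 + ((3 + 1) + (3 + 1))) + (1 + 1))
    + (3 + 1)))) ?_ (by omega) (fun _ h => h)
  refine Runs.seq (Runs.assign (Q := fun s' => s' = s.setReg 3 0) rfl) ?_
  rintro _ rfl
  refine Runs.seq (Runs.assign (Q := fun s' => s' = (s.setReg 3 0).setReg 4 (s.reg 0)) rfl) ?_
  rintro _ rfl
  refine Runs.seq (P := fun s' => s'.arr = s.arr ∧ s'.reg 3 = s.reg 0 * s.reg 2 ∧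
      ∀ r, r ≠ 3 → r ≠ 4 → s'.reg r = s.reg r) ?_ ?_
  · refine Runs.mono (Runs.loop (T := (3 + 1) + (3 + 1)) (fun i s' => s'.arr = s.arr ∧
      s'.reg 3 = i * s.reg 2 ∧ s'.reg 4 = s.reg 0 - i ∧
      ∀ r, r ≠ 3 → r ≠ 4 → s'.reg r = s.reg r) (s.reg 0) ?_ ?_ ?_) le_rfl ?_
    · rintro i hi s' ⟨h1, h2, h3, h4⟩
      refine ⟨by simp only [Expr.eval]; omega, ?_⟩
      refine Runs.seq (Runs.assign (Q := fun s'' => s'' = s'.setReg 3 (s'.reg 3 + s'.reg 2)) rfl) ?_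
      rintro _ rfl
      refine Runs.assign ?_
      refine ⟨h1, ?_, ?_, ?_⟩
      · simp [State.setReg_reg, h2, h4, Nat.succ_mul]
      · simp [State.setReg_reg, Expr.eval, h3]; omega
      · intro r hr hr'
        simp [State.setReg_reg, hr, hr', h4]
    · rintro s' ⟨h1, h2, h3, h4⟩
      simp [Expr.eval, h3]
    · refine ⟨rfl, by simp [State.setReg_reg], by simp [State.setReg_reg], ?_⟩
      intro r hr hr'
      simp [State.setReg_reg, hr, hr']
    · rintro s' ⟨h1, h2, h3, h4⟩
      exact ⟨h1, h2, h4⟩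
  · rintro s' ⟨h1, h2, h3⟩
    refine Runs.assign ⟨h1, ?_, ?_⟩
    · simp only [State.setReg_reg, Expr.eval, h2, if_true]
      rw [h3 _ (by omega) (by omega), Nat.mul_comm]
    · intro r hr hr' hr''
      simp [State.setReg_reg, hr, h3 r hr' hr'']

theorem digitsCode_runs (vs : List ℕ) : ∀ s : State,
    Runs (digitsCode vs) s (vs.length * (s.reg 0 * 12 + 12) + 1) fun s' => s'.arr = s.arr ∧
      s'.reg 2 = vs.foldl (fun acc v => acc * s.reg 0 + s.reg (5 + 3 * v)) (s.reg 2) ∧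
      ∀ r, r ≠ 2 → r ≠ 3 → r ≠ 4 → s'.reg r = s.reg r := by
  induction vs with
  | nil => exact fun s => Runs.mono (Runs.skip ⟨rfl, rfl, fun _ _ _ _ => rfl⟩) (by simp) fun _ h => h
  | cons v vs ih =>
    intro s
    refine Runs.mono (Runs.seq (digitCode_runs v s)
      (U := vs.length * (s.reg 0 * 12 + 12) + 1)
      (Q := fun s' => s'.arr = s.arr ∧
      s'.reg 2 = (v :: vs).foldl (fun acc v => acc * s.reg 0 + s.reg (5 + 3 * v)) (s.reg 2) ∧
      ∀ r, r ≠ 2 → r ≠ 3 → r ≠ 4 → s'.reg r = s.reg r) ?_)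
      (by rw [List.length_cons, Nat.succ_mul]; omega) fun _ h => h
    rintro s' ⟨h1, h2, h3⟩
    have h0 : s'.reg 0 = s.reg 0 := h3 0 (by omega) (by omega) (by omega)
    refine Runs.mono (ih s') (by rw [h0]) ?_
    rintro s'' ⟨h4, h5, h6⟩
    refine ⟨h4.trans h1, ?_, fun r hr hr' hr'' => (h6 r hr hr' hr'').trans (h3 r hr hr' hr'')⟩
    have h7 : ∀ v, s'.reg (5 + 3 * v) = s.reg (5 + 3 * v) := fun v =>
      h3 _ (by omega) (by omega) (by omega)
    simp only [h5, h0, h7, h2, List.foldl_cons]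

/-- The arrays of `s` other than `b` hold the relations of `σ`. -/
def Agree {n : ℕ} (ar : ℕ → ℕ) (b : ℕ) (s : State) (σ : Store n) : Prop :=
  ∀ a, a ≠ b → a < 50 → ∀ l : List (Fin n), l.length = ar a → (s.arr a (idx l) = 1 ↔ σ a l)

open Classical in
-- The formula is fixed and each quantifier multiplies the time by about `n`, so the bound is a
-- polynomial chosen before `n`. The depth `d` keeps nested quantifiers apart: the body of a
-- quantifier at depth `d` is compiled at depth `d + 1` and therefore preserves the two registers
-- reserved for depth `d`.
theorem compile_runs (ar : ℕ → ℕ) (b : ℕ) (φ : Fml) (hφ : φ.WF ar b) : ∀ d : ℕ,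
    ∃ T : Polynomial ℕ, ∀ (n : ℕ) (σ : Store n) (e : ℕ → Fin n) (s : State),
      s.reg 0 = n → (∀ v, s.reg (5 + 3 * v) = e v) → Agree ar b s σ →
      Runs (φ.compile d) s (T.eval n) fun s' => s'.arr = s.arr ∧
        s'.reg 1 = (if φ.eval σ e then 1 else 0) ∧ ∀ r, Kept d r → s'.reg r = s.reg r := by
  induction φ with
  | rel a vs =>
    intro d
    refine ⟨Polynomial.C vs.length * (Polynomial.X * 12 + 12) + 16, ?_⟩
    intro n σ e s h0 he hs
    refine Runs.mono (T := (1 + 1) + ((vs.length * (n * 12 + 12) + 1) + (11 + 1))) ?_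
      (by simp; omega) fun _ h => h
    refine Runs.seq (Runs.assign (Q := fun s' => s' = s.setReg 2 0) rfl) ?_
    rintro _ rfl
    have h0' : (s.setReg 2 0).reg 0 = n := by simp [State.setReg_reg, h0]
    refine Runs.seq (P := fun s' => _) (by simpa only [h0'] using digitsCode_runs vs (s.setReg 2 0)) ?_
    rintro s' ⟨h1, h2, h3⟩
    have h4 : s'.reg 2 = idx (vs.map e) := by
      rw [h2, idx, List.foldl_map]
      have : ∀ v, (s.setReg 2 0).reg (5 + 3 * v) = e v := by
        intro v
        rw [State.setReg_reg, if_neg (by omega), he]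
      simp only [this]
      simp [State.setReg_reg]
    have h5 := hs a hφ.2.1 hφ.2.2 (vs.map e) (by simpa using hφ.1)
    refine Runs.assign ⟨h1, ?_, ?_⟩
    · simp only [State.setReg_reg, if_true, Expr.eval, h4]
      rw [h1, State.setReg_arr]
      -- The expression tests for the value `1` exactly; every other content of the cell counts as
      -- false.
      by_cases h6 : s.arr a (idx (vs.map e)) = 1
      · rw [if_pos (show Fml.eval σ (rel a vs) e from h5.1 h6), h6]
      · rw [if_neg (show ¬ Fml.eval σ (rel a vs) e from fun h => h6 (h5.2 h))]
        omega
    · intro r hr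
      have : r ≠ 1 ∧ r ≠ 2 ∧ r ≠ 3 ∧ r ≠ 4 := by
        rcases hr with rfl | ⟨v, hr⟩ <;> omega
      rw [State.setReg_reg, if_neg this.1, h3 r this.2.1 this.2.2.1 this.2.2.2, State.setReg_reg,
        if_neg this.2.1]
  | eq x y =>
    intro d
    refine ⟨10, ?_⟩
    intro n σ e s h0 he hs
    refine Runs.mono (T := 9 + 1) (Runs.assign ?_) (by simp) fun _ h => h
    refine ⟨rfl, ?_, ?_⟩
    · simp only [State.setReg_reg, if_true, Expr.eval, he]
      by_cases h : e x = e y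
      · rw [if_pos (show Fml.eval σ (eq x y) e from h), h]; omega
      · rw [if_neg (show ¬ Fml.eval σ (eq x y) e from h)]
        have : (e x : ℕ) ≠ e y := fun h' => h (Fin.ext h')
        omega
    · intro r hr
      rw [State.setReg_reg, if_neg (by rcases hr with rfl | ⟨v, hr⟩ <;> omega)]
  | lt x y =>
    intro d
    refine ⟨8, ?_⟩
    intro n σ e s h0 he hs
    refine Runs.mono (T := 7 + 1) (Runs.assign ?_) (by simp) fun _ h => h
    refine ⟨rfl, ?_, ?_⟩
    · simp only [State.setReg_reg, if_true, Expr.eval, he]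
      by_cases h : e x < e y
      · rw [if_pos (show Fml.eval σ (lt x y) e from h)]
        have : (e x : ℕ) < e y := h
        omega
      · rw [if_neg (show ¬ Fml.eval σ (lt x y) e from h)]
        have : ¬ (e x : ℕ) < e y := h
        omega
    · intro r hr
      rw [State.setReg_reg, if_neg (by rcases hr with rfl | ⟨v, hr⟩ <;> omega)]
  | neg φ ih =>
    intro d
    obtain ⟨T, hT⟩ := ih hφ d
    refine ⟨T + 4, ?_⟩
    intro n σ e s h0 he hs
    refine Runs.mono (Runs.seq (hT n σ e s h0 he hs) (U := 3 + 1) ?_) (by simp) fun _ h => h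
    rintro s' ⟨h1, h2, h3⟩
    refine Runs.assign ⟨h1, ?_, ?_⟩
    · simp only [State.setReg_reg, if_true, Expr.eval, h2, Fml.eval]
      split_ifs <;> simp_all
    · intro r hr
      rw [State.setReg_reg, if_neg (by rcases hr with rfl | ⟨v, hr⟩ <;> omega), h3 r hr]
  | and φ ψ ih1 ih2 =>
    intro d
    obtain ⟨T, hT⟩ := ih1 hφ.1 d
    obtain ⟨U, hU⟩ := ih2 hφ.2 d
    refine ⟨T + U + 3, ?_⟩
    intro n σ e s h0 he hs
    refine Runs.mono (Runs.seq (hT n σ e s h0 he hs) (U := 1 + 1 + (U.eval n + 1)) ?_)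
      (by simp; omega) fun _ h => h
    rintro s' ⟨h1, h2, h3⟩
    refine Runs.ite ?_ ?_
    · intro h
      have hφ' : φ.eval σ e := by
        by_contra h'
        exact h (by simp [Expr.eval, h2, h'])
      have hk : ∀ v, s'.reg (5 + 3 * v) = s.reg (5 + 3 * v) := fun v =>
        h3 _ (Or.inr ⟨v, Or.inl rfl⟩)
      refine Runs.mono (hU n σ e s' ((h3 0 (Or.inl rfl)).trans h0) (fun v => (hk v).trans (he v)) ?_)
        (by omega) ?_
      · intro a ha ha' l hl
        rw [h1]
        exact hs a ha ha' l hl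
      · rintro s'' ⟨h4, h5, h6⟩
        refine ⟨h4.trans h1, ?_, fun r hr => (h6 r hr).trans (h3 r hr)⟩
        rw [h5]
        simp [Fml.eval, hφ']
    · intro h
      have hφ' : ¬ φ.eval σ e := by
        intro h'
        simp [Expr.eval, h2, h'] at h
      refine Runs.mono (Runs.skip ⟨h1, ?_, h3⟩) (by omega) fun _ h => h
      rw [h2]
      simp [Fml.eval, hφ']
  | ex x φ ih =>
    intro d
    obtain ⟨T, hT⟩ := ih hφ (d + 1)
    refine ⟨Polynomial.X * (T + 13) + 20, ?_⟩
    intro n σ e s h0 he hs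
    have hn : 0 < n := Fin.pos (e 0)
    refine Runs.mono (T := (1 + 1) + ((1 + 1) + ((1 + 1) +
      ((n * (3 + 1 + (T.eval n + ((1 + 1 + 2) + (3 + 1)))) + (3 + 1)) + ((1 + 1) + (1 + 1)))))) ?_
      (by simp [Nat.mul_add]; omega) fun _ h => h
    refine Runs.seq (Runs.assign
      (Q := fun s' => s' = s.setReg (6 + 3 * d) (e x)) (by simp [Expr.eval, he])) ?_
    rintro _ rfl
    refine Runs.seq (Runs.assign
      (Q := fun s' => s' = (s.setReg (6 + 3 * d) (e x)).setReg (7 + 3 * d) 0) rfl) ?_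
    rintro _ rfl
    refine Runs.seq (Runs.assign
      (Q := fun s' => s' = ((s.setReg (6 + 3 * d) (e x)).setReg (7 + 3 * d) 0).setReg
        (5 + 3 * x) 0) rfl) ?_
    rintro _ rfl
    -- Register `6 + 3 * d` saves the old value of the bound variable, and `7 + 3 * d` records
    -- whether a witness below `i` has been seen. The register of the variable is exempt from
    -- preservation until it is restored after the loop.
    refine Runs.seq (Runs.loop (fun i s' => s'.arr = s.arr ∧ s'.reg (6 + 3 * d) = e x ∧
      s'.reg (7 + 3 * d) = (if ∃ z : Fin n, z < i ∧ φ.eval σ (Function.update e x z) then 1 else 0) ∧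
      s'.reg (5 + 3 * x) = i ∧ ∀ r, r ≠ 5 + 3 * x → Kept d r → s'.reg r = s.reg r) n ?_ ?_ ?_) ?_
    · rintro i hi s' ⟨h1, h2, h3, h4, h5⟩
      have h0' : s'.reg 0 = n := by rw [h5 0 (by omega) (Or.inl rfl), h0]
      refine ⟨by simp only [Expr.eval, h4, h0']; omega, ?_⟩
      refine Runs.seq (hT n σ (Function.update e x ⟨i, hi⟩) s' h0' ?_ ?_) ?_
      · intro v
        by_cases hv : v = x
        · subst hv; simp [h4]
        · rw [Function.update_of_ne hv, h5 _ (by omega) (Or.inr ⟨v, Or.inl rfl⟩), he]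
      · intro a ha ha' l hl
        rw [h1]
        exact hs a ha ha' l hl
      · rintro s'' ⟨h6, h7, h8⟩
        have h8' : ∀ v, s''.reg (5 + 3 * v) = s'.reg (5 + 3 * v) := fun v =>
          h8 _ (Or.inr ⟨v, Or.inl rfl⟩)
        have h82 : s''.reg (6 + 3 * d) = s'.reg (6 + 3 * d) :=
          h8 _ (Or.inr ⟨d, Or.inr ⟨by omega, Or.inl rfl⟩⟩)
        have h83 : s''.reg (7 + 3 * d) = s'.reg (7 + 3 * d) :=
          h8 _ (Or.inr ⟨d, Or.inr ⟨by omega, Or.inr rfl⟩⟩)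
        have h84 : ∀ r, Kept d r → s''.reg r = s'.reg r := by
          intro r hr
          refine h8 r ?_
          rcases hr with rfl | ⟨v, hr⟩
          · exact Or.inl rfl
          · exact Or.inr ⟨v, by omega⟩
        refine Runs.seq (P := fun t => t.arr = s.arr ∧ t.reg (6 + 3 * d) = e x ∧
          t.reg (7 + 3 * d) = (if ∃ z : Fin n, z < i + 1 ∧ φ.eval σ (Function.update e x z)
            then 1 else 0) ∧
          t.reg (5 + 3 * x) = i ∧ ∀ r, r ≠ 5 + 3 * x → Kept d r → t.reg r = s.reg r) ?_ ?_
        · by_cases hev : φ.eval σ (Function.update e x ⟨i, hi⟩)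
          · have h9 : ∃ z : Fin n, (z : ℕ) < i + 1 ∧ φ.eval σ (Function.update e x z) :=
              ⟨⟨i, hi⟩, by simp, hev⟩
            refine Runs.ite (fun _ => Runs.assign ⟨h6.trans h1, ?_, ?_, ?_, ?_⟩) ?_
            · rw [State.setReg_reg, if_neg (by omega), h82, h2]
            · rw [State.setReg_reg, if_pos rfl, if_pos h9]; rfl
            · rw [State.setReg_reg, if_neg (by omega), h8', h4]
            · intro r hr hr'
              rw [State.setReg_reg, if_neg, h84 r hr', h5 r hr hr']
              rcases hr' with rfl | ⟨v, hr'⟩ <;> omega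
            · intro h
              simp [Expr.eval, h7, hev] at h
          · have h9 : (∃ z : Fin n, (z : ℕ) < i + 1 ∧ φ.eval σ (Function.update e x z)) ↔
                ∃ z : Fin n, (z : ℕ) < i ∧ φ.eval σ (Function.update e x z) := by
              refine ⟨?_, fun ⟨z, hz, hz'⟩ => ⟨z, by omega, hz'⟩⟩
              rintro ⟨z, hz, hz'⟩
              refine ⟨z, ?_, hz'⟩
              rcases Nat.lt_succ_iff_lt_or_eq.1 hz with h | h
              · exact h
              · exact absurd (by rwa [show z = ⟨i, hi⟩ from Fin.ext h] at hz') hev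
            refine Runs.ite (fun h => absurd ?_ h) (fun _ => Runs.mono (Runs.skip
              ⟨h6.trans h1, h82.trans h2, ?_, (h8' x).trans h4,
                fun r hr hr' => (h84 r hr').trans (h5 r hr hr')⟩) (by omega) fun _ h => h)
            · simp [Expr.eval, h7, hev]
            · rw [h83, h3]
              simp only [h9]
        · rintro t ⟨g1, g2, g3, g4, g5⟩
          refine Runs.assign ⟨g1, ?_, ?_, ?_, ?_⟩
          · rw [State.setReg_reg, if_neg (by omega), g2]
          · rw [State.setReg_reg, if_neg (by omega), g3]
          · rw [State.setReg_reg, if_pos rfl]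
            simp [Expr.eval, g4]
          · intro r hr hr'
            rw [State.setReg_reg, if_neg hr, g5 r hr hr']
    · rintro s' ⟨h1, h2, h3, h4, h5⟩
      have h0' : s'.reg 0 = n := by rw [h5 0 (by omega) (Or.inl rfl), h0]
      simp [Expr.eval, h4, h0']
    · refine ⟨rfl, ?_, ?_, ?_, ?_⟩
      · rw [State.setReg_reg, if_neg (by omega), State.setReg_reg, if_neg (by omega),
          State.setReg_reg, if_pos rfl]
      · rw [State.setReg_reg, if_neg (by omega), State.setReg_reg, if_pos rfl]
        simp
      · rw [State.setReg_reg, if_pos rfl]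
      · intro r hr hr'
        rw [State.setReg_reg, if_neg hr, State.setReg_reg, if_neg, State.setReg_reg, if_neg] <;>
        rcases hr' with rfl | ⟨v, hr'⟩ <;> omega
    · rintro s' ⟨h1, h2, h3, h4, h5⟩
      refine Runs.seq (Runs.assign (Q := fun t => t = s'.setReg (5 + 3 * x) (e x))
        (by simp [Expr.eval, h2])) ?_
      rintro _ rfl
      refine Runs.assign ⟨h1, ?_, ?_⟩
      · rw [State.setReg_reg, if_pos rfl]
        simp only [Expr.eval]
        rw [State.setReg_reg, if_neg (by omega), h3]
        have : (∃ z : Fin n, (z : ℕ) < n ∧ φ.eval σ (Function.update e x z)) ↔ (ex x φ).eval σ e := by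
          simp [Fml.eval]
        simp only [this]
      · intro r hr
        have hr1 : r ≠ 1 := by rcases hr with rfl | ⟨v, hr⟩ <;> omega
        rw [State.setReg_reg, if_neg hr1, State.setReg_reg]
        split_ifs with h
        · rw [h, he]
        · exact h5 r h hr

end Fml
end Query

/-! ### Programs on relations and their compilation. -/

namespace Query

open RAM

/-- Programs on relations: simultaneous first-order redefinition of a relation, composition, and
`n`-fold repetition, where `n` is the size of the domain. -/
inductive Prog
  | set (a : ℕ) (φ : Fml)
  | seq (p q : Prog)
  | rep (p : Prog)

/-- The assignment of the entries of `l` to the first variables. -/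
def env {n : ℕ} [NeZero n] (l : List (Fin n)) (v : ℕ) : Fin n := l.getD v 0

namespace Prog

open Classical in
/-- The effect of a program. -/
noncomputable def sem {n : ℕ} [NeZero n] : Prog → Store n → Store n
  | set a φ, σ => Function.update σ a fun l => φ.eval σ (env l)
  | seq p q, σ => q.sem (p.sem σ)
  | rep p, σ => p.sem^[n] σ

/-- All formulas are well-formed and do not use the relation that they redefine. -/
def WF (ar : ℕ → ℕ) : Prog → Prop
  | set a φ => φ.WF ar a ∧ a < 50
  | seq p q => p.WF ar ∧ q.WF ar
  | rep p => p.WF ar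

/-- The nested loops that write the truth values of a formula into array `a` of arity `k`, for all
values of the last `j` of the first `k` variables. -/
def setCode (a k : ℕ) (φ : Fml) : ℕ → Cmd
  | 0 => .seq (φ.compile 0) <| .seq (.assign 2 (.const 0)) <|
      .seq (Fml.digitsCode (List.range k)) (.write a (.var 2) (.var 1))
  | j + 1 => .seq (.assign (5 + 3 * (k - (j + 1))) (.const 0)) <|
      .seq (.loop (.sub (.var 0) (.var (5 + 3 * (k - (j + 1))))) <|
        .seq (setCode a k φ j)
          (.assign (5 + 3 * (k - (j + 1))) (.add (.var (5 + 3 * (k - (j + 1)))) (.const 1)))) <|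
      .assign (5 + 3 * (k - (j + 1))) (.const 0)

/-- The RAM program; repetitions are counted in the arrays from `50` on. -/
def compile (ar : ℕ → ℕ) : Prog → ℕ → Cmd
  | set a φ, _ => setCode a (ar a) φ (ar a)
  | seq p q, d => .seq (p.compile ar d) (q.compile ar d)
  | rep p, d => .seq (.write (50 + d) (.const 0) (.var 0)) <|
      .loop (.read (50 + d) (.const 0)) <| .seq (p.compile ar (d + 1)) <|
        .write (50 + d) (.const 0) (.sub (.read (50 + d) (.const 0)) (.const 1))

theorem foldl_range_env {n : ℕ} [NeZero n] (l : List (Fin n)) :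
    (List.range l.length).foldl (fun acc v => acc * n + (env l v : ℕ)) 0 = idx l := by
  have h : l = (List.range l.length).map (env l) := by
    apply List.ext_getElem (by simp)
    intro i hi hi'
    simp [env, hi]
  conv_rhs => rw [h, idx, List.foldl_map]

theorem env_concat {n : ℕ} [NeZero n] (p : List (Fin n)) (z : Fin n) (v : ℕ) :
    env (p ++ [z]) v = if v = p.length then z else env p v := by
  unfold env
  rcases lt_trichotomy v p.length with h | h | h
  · rw [List.getD_append _ _ _ _ h, if_neg h.ne]
  · subst h; simp
  · rw [if_neg h.ne', List.getD_eq_default _ _ (by simp; omega),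
      List.getD_eq_default _ _ (by omega)]

/-- Array `a` is overwritten in place, which is harmless because `φ` does not read it. The last
clause protects the cells of other prefixes: by `idx_injective`, later rounds of an outer loop do
not disturb what earlier rounds wrote. -/
theorem setCode_runs (ar : ℕ → ℕ) (a k : ℕ) (φ : Fml) (hφ : φ.WF ar a) :
    ∀ j ≤ k, ∃ T : Polynomial ℕ, ∀ (n : ℕ) [NeZero n] (σ : Store n) (p : List (Fin n)) (s : State),
      p.length + j = k → s.reg 0 = n → (∀ v, s.reg (5 + 3 * v) = env p v) → Fml.Agree ar a s σ →
      Runs (setCode a k φ j) s (T.eval n) fun s' => s'.reg 0 = n ∧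
        (∀ v, s'.reg (5 + 3 * v) = env p v) ∧ (∀ b, b ≠ a → s'.arr b = s.arr b) ∧
        (∀ q : List (Fin n), q.length = j →
          (s'.arr a (idx (p ++ q)) = 1 ↔ φ.eval σ (env (p ++ q)))) ∧
        ∀ i, (∀ q : List (Fin n), q.length = j → i ≠ idx (p ++ q)) →
          s'.arr a i = s.arr a i := by
  intro j
  induction j with
  | zero =>
    intro _
    obtain ⟨T, hT⟩ := Fml.compile_runs ar a φ hφ 0
    refine ⟨T + Polynomial.C k * (Polynomial.X * 12 + 12) + 10, ?_⟩
    intro n _ σ p s hp h0 he hs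
    refine Runs.mono (Runs.seq (hT n σ (env p) s h0 he hs)
      (U := (1 + 1) + ((k * (n * 12 + 12) + 1) + (1 + 1 + 1))) ?_) (by simp; omega) fun _ h => h
    rintro s1 ⟨h1, h2, h3⟩
    refine Runs.seq (Runs.assign (Q := fun s' => s' = s1.setReg 2 0) rfl) ?_
    rintro _ rfl
    have h31 : (s1.setReg 2 0).reg 0 = n := by
      rw [State.setReg_reg, if_neg (by omega), h3 0 (Or.inl rfl), h0]
    have h32 : ∀ v, (s1.setReg 2 0).reg (5 + 3 * v) = env p v := by
      intro v
      rw [State.setReg_reg, if_neg (by omega), h3 _ (Or.inr ⟨v, Or.inl rfl⟩), he]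
    refine Runs.seq (P := fun s' => _) (by
      simpa only [h31, List.length_range] using Fml.digitsCode_runs (List.range k)
        (s1.setReg 2 0)) ?_
    rintro s2 ⟨h4, h5, h6⟩
    have h7 : s2.reg 2 = idx p := by
      rw [h5, ← foldl_range_env]
      simp only [h32]
      rw [State.setReg_reg, if_pos rfl, show p.length = k from hp]
    have h8 : s2.reg 1 = s1.reg 1 := by
      rw [h6 1 (by omega) (by omega) (by omega), State.setReg_reg, if_neg (by omega)]
    have h9 : s2.arr = s.arr := h4.trans h1
    refine Runs.write ⟨?_, ?_, ?_, ?_, ?_⟩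
    · rw [State.setArr_reg, h6 0 (by omega) (by omega) (by omega), h31]
    · intro v
      rw [State.setArr_reg, h6 _ (by omega) (by omega) (by omega), h32]
    · intro b hb
      funext i
      rw [State.setArr_arr, if_neg (by tauto), h9]
    · intro q hq
      obtain rfl : q = [] := by simpa using hq
      rw [List.append_nil, State.setArr_arr, if_pos ⟨rfl, h7.symm⟩]
      simp only [Expr.eval]
      rw [h8, h2]
      split_ifs with h <;> simp [h]
    · intro i hi
      have := hi [] rfl
      rw [List.append_nil] at this
      rw [State.setArr_arr, if_neg (by simp only [Expr.eval, h7]; tauto), h9]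
  | succ j ih =>
    intro hj
    obtain ⟨T, hT⟩ := ih (by omega)
    refine ⟨Polynomial.X * (T + 8) + 10, ?_⟩
    intro n _ σ p s hp h0 he hs
    have hx : k - (j + 1) = p.length := by omega
    unfold setCode
    rw [hx]
    refine Runs.mono (T := (1 + 1) + ((n * (3 + 1 + (T.eval n + (3 + 1))) + (3 + 1)) + (1 + 1))) ?_
      (by simp [Nat.mul_add]; omega) fun _ h => h
    refine Runs.seq (Runs.assign (Q := fun s' => s' = s.setReg (5 + 3 * p.length) 0) rfl) ?_
    rintro _ rfl
    refine Runs.seq (Runs.loop (fun i s' => s'.reg 0 = n ∧ s'.reg (5 + 3 * p.length) = i ∧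
      (∀ v, v ≠ p.length → s'.reg (5 + 3 * v) = env p v) ∧ (∀ b, b ≠ a → s'.arr b = s.arr b) ∧
      (∀ q : List (Fin n), q.length = j → ∀ z : Fin n, z < i →
          (s'.arr a (idx (p ++ (z :: q))) = 1 ↔ φ.eval σ (env (p ++ (z :: q))))) ∧
        ∀ i, (∀ q : List (Fin n), q.length = j + 1 → i ≠ idx (p ++ q)) →
          s'.arr a i = s.arr a i) n ?_ ?_ ?_) ?_
    · rintro i hi s1 ⟨h1, h2, h3, h4, h5, h6⟩
      refine ⟨by simp only [Expr.eval, h1, h2]; omega, ?_⟩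
      refine Runs.seq (hT n σ (p ++ [⟨i, hi⟩]) s1 (by simp; omega) h1 ?_ ?_) ?_
      · intro v
        rw [env_concat]
        split_ifs with hv
        · rw [hv, h2]
        · exact h3 v hv
      · intro b hb hb' l hl
        rw [h4 b hb]
        exact hs b hb hb' l hl
      · rintro s2 ⟨g1, g2, g3, g4, g5⟩
        refine Runs.assign ⟨?_, ?_, ?_, ?_, ?_, ?_⟩
        · rw [State.setReg_reg, if_neg (by omega), g1]
        · rw [State.setReg_reg, if_pos rfl]
          simp only [Expr.eval, g2, env_concat, if_true]
        · intro v hv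
          rw [State.setReg_reg, if_neg (by omega), g2, env_concat, if_neg hv]
        · intro b hb
          rw [State.setReg_arr, g3 b hb, h4 b hb]
        · intro q hq z hz
          rw [State.setReg_arr]
          rcases Nat.lt_succ_iff_lt_or_eq.1 hz with hz' | hz'
          · rw [g5, h5 q hq z hz']
            intro q' hq' h
            have := idx_injective _ _ (by simp; omega) h
            simp only [List.append_assoc, List.append_cancel_left_eq, List.cons_append,
              List.nil_append, List.cons.injEq] at this
            rw [this.1] at hz'
            exact lt_irrefl _ hz'
          · obtain rfl : z = ⟨i, hi⟩ := Fin.ext hz'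
            simpa using g4 q hq
        · intro i' hi'
          rw [State.setReg_arr, g5, h6 i' hi']
          intro q hq
          simpa using hi' (⟨i, hi⟩ :: q) (by simpa using hq)
    · rintro s1 ⟨h1, h2, -⟩
      simp [Expr.eval, h1, h2]
    · refine ⟨?_, ?_, ?_, ?_, ?_, ?_⟩
      · rw [State.setReg_reg, if_neg (by omega), h0]
      · rw [State.setReg_reg, if_pos rfl]
      · intro v hv
        rw [State.setReg_reg, if_neg (by omega), he]
      · intro b hb
        rfl
      · intro q hq z hz
        omega
      · intro i hi
        rfl
    · rintro s1 ⟨h1, h2, h3, h4, h5, h6⟩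
      refine Runs.assign ⟨?_, ?_, ?_, ?_, ?_⟩
      · rw [State.setReg_reg, if_neg (by omega), h1]
      · intro v
        rw [State.setReg_reg]
        split_ifs with hv
        -- Resetting the register to `0` restores the default that `env p` takes beyond the length
        -- of `p`.
        · obtain rfl : v = p.length := by omega
          simp [Expr.eval, env]
        · exact h3 v (by rintro rfl; exact hv rfl)
      · exact h4
      · intro q hq
        cases q with
        | nil => simp at hq
        | cons z q => exact h5 q (by simpa using hq) z z.2
      · exact h6

/-- Formulas may use any register, so loop counters live in arrays from `50` on, one for each
nesting depth. With `50` as the excluded array, `Agree` covers all relation symbols; the last clause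
says that the counters of the enclosing loops survive. -/
theorem compile_runs (ar : ℕ → ℕ) (p : Prog) (hp : p.WF ar) : ∀ d : ℕ,
    ∃ T : Polynomial ℕ, ∀ (n : ℕ) [NeZero n] (σ : Store n) (s : State),
      s.reg 0 = n → (∀ v, s.reg (5 + 3 * v) = 0) → Fml.Agree ar 50 s σ →
      Runs (p.compile ar d) s (T.eval n) fun s' => s'.reg 0 = n ∧ (∀ v, s'.reg (5 + 3 * v) = 0) ∧
        Fml.Agree ar 50 s' (p.sem σ) ∧ ∀ i < d, s'.arr (50 + i) = s.arr (50 + i) := by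
  induction p with
  | set a φ =>
    intro d
    obtain ⟨T, hT⟩ := setCode_runs ar a (ar a) φ hp.1 (ar a) le_rfl
    refine ⟨T, ?_⟩
    intro n _ σ s h0 hv hs
    refine Runs.mono (hT n σ [] s (by simp) h0 (by simpa [env] using hv)
      fun b _ hb l hl => hs b (by omega) hb l hl) le_rfl ?_
    rintro s' ⟨h1, h2, h3, h4, h5⟩
    refine ⟨h1, by simpa [env] using h2, ?_, fun i hi => h3 _ (by have := hp.2; omega)⟩
    intro b _ hb l hl
    unfold sem
    by_cases hba : b = a
    · subst hba
      rw [Function.update_self]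
      exact h4 l hl
    · rw [Function.update_of_ne hba, h3 b hba]
      exact hs b (by omega) hb l hl
  | seq p q ihp ihq =>
    intro d
    obtain ⟨T, hT⟩ := ihp hp.1 d
    obtain ⟨U, hU⟩ := ihq hp.2 d
    refine ⟨T + U, ?_⟩
    intro n _ σ s h0 hv hs
    refine Runs.mono (Runs.seq (hT n σ s h0 hv hs) (U := U.eval n) ?_) (by simp) fun _ h => h
    rintro s1 ⟨h1, h2, h3, h4⟩
    refine Runs.mono (hU n _ s1 h1 h2 h3) le_rfl ?_
    rintro s2 ⟨g1, g2, g3, g4⟩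
    exact ⟨g1, g2, g3, fun i hi => (g4 i hi).trans (h4 i hi)⟩
  | rep p ih =>
    intro d
    obtain ⟨T, hT⟩ := ih hp (d + 1)
    refine ⟨Polynomial.X * (T + 10) + 10, ?_⟩
    intro n _ σ s h0 hv hs
    refine Runs.mono (T := (1 + 1 + 1) + (n * (2 + 1 + (T.eval n + (1 + 4 + 1))) + (2 + 1))) ?_
      (by simp [Nat.mul_add]; omega) fun _ h => h
    refine Runs.seq (Runs.write (Q := fun s' => s' = s.setArr (50 + d) 0 n)
      (by simp [Expr.eval, h0])) ?_
    rintro _ rfl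
    refine Runs.mono (Runs.loop (fun i s' => s'.reg 0 = n ∧ (∀ v, s'.reg (5 + 3 * v) = 0) ∧
        Fml.Agree ar 50 s' (p.sem^[i] σ) ∧ (∀ i < d, s'.arr (50 + i) = s.arr (50 + i)) ∧
        s'.arr (50 + d) 0 = n - i) n ?_ ?_ ?_) le_rfl ?_
    · rintro i hi s1 ⟨h1, h2, h3, h4, h5⟩
      refine ⟨by simp only [Expr.eval, h5]; omega, ?_⟩
      refine Runs.seq (hT n _ s1 h1 h2 h3) ?_
      rintro s2 ⟨g1, g2, g3, g4⟩
      refine Runs.write ⟨g1, g2, ?_, ?_, ?_⟩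
      · intro b hb hb' l hl
        rw [State.setArr_arr, if_neg (by omega), Function.iterate_succ_apply']
        exact g3 b hb hb' l hl
      · intro j hj
        funext m
        rw [State.setArr_arr, if_neg (by omega), g4 j (by omega), h4 j hj]
      · rw [State.setArr_arr, if_pos ⟨rfl, rfl⟩]
        simp only [Expr.eval]
        rw [g4 d (by omega), h5]
        omega
    · rintro s1 ⟨-, -, -, -, h5⟩
      simp [Expr.eval, h5]
    · refine ⟨h0, hv, ?_, ?_, ?_⟩
      · intro b hb hb' l hl
        rw [State.setArr_arr, if_neg (by omega)]
        exact hs b hb hb' l hl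
      · intro j hj
        funext m
        rw [State.setArr_arr, if_neg (by omega)]
      · rw [State.setArr_arr, if_pos ⟨rfl, rfl⟩]; simp
    · rintro s1 ⟨h1, h2, h3, h4, h5⟩
      exact ⟨h1, h2, h3, h4⟩

end Prog

/-- The relations stored in the initial memory: the adjacency relation as relation `0`. -/
def inputStore {n : ℕ} (G : SimpleGraph (Fin n)) : Store n :=
  fun a l => (graphInput G).arr a (idx l) = 1

theorem inputStore_adj {n : ℕ} (G : SimpleGraph (Fin n)) (i j : Fin n) :
    inputStore G 0 [i, j] ↔ G.Adj i j := by
  have h : (∃ i' j' : Fin n, idx [i, j] = i' * n + j' ∧ G.Adj i' j') ↔ G.Adj i j := by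
    constructor
    · rintro ⟨i', j', h, h'⟩
      have := idx_injective [i, j] [i', j'] rfl (h.trans (by simp [idx]))
      simp only [List.cons.injEq, and_true] at this
      rwa [this.1, this.2]
    · exact fun h => ⟨i, j, by simp [idx], h⟩
  simp [inputStore, graphInput, h]

open Classical in
/-- Queries run in polynomial time on the random access machine. -/
theorem exists_cmd (ar : ℕ → ℕ) (h1 : ar 1 = 2) (h2 : ar 2 = 2) (p : Prog) (hp : p.WF ar)
    (φ : Fml) (hφ : φ.WF ar 50) :
    ∃ (c : Cmd) (T : Polynomial ℕ), ∀ (n : ℕ) [NeZero n] (G : SimpleGraph (Fin n)),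
      Runs c (graphInput G) (T.eval n) fun s =>
        s.reg 0 = (if φ.eval (p.sem (inputStore G)) (env []) then 1 else 0) ∧
        (s.rel n 1 = fun i j => p.sem (inputStore G) 1 [i, j]) ∧
        (s.rel n 2 = fun i j => p.sem (inputStore G) 2 [i, j]) := by
  obtain ⟨T, hT⟩ := Prog.compile_runs ar p hp 0
  obtain ⟨U, hU⟩ := Fml.compile_runs ar 50 φ hφ 0
  -- Register `0` must hold `n` throughout, so the answer is moved there only at the very end.
  refine ⟨.seq (p.compile ar 0) (.seq (φ.compile 0) (.assign 0 (.var 1))), T + U + 2, ?_⟩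
  intro n _ G
  refine Runs.mono (Runs.seq (hT n (inputStore G) (graphInput G) (by simp [graphInput])
    (by simp [graphInput]) (fun _ _ _ _ _ => Iff.rfl)) (U := U.eval n + (1 + 1)) ?_)
    (by simp; omega) fun _ h => h
  rintro s1 ⟨g1, g2, g3, -⟩
  refine Runs.seq (hU n _ (env []) s1 g1 (by simpa [env] using g2) g3) ?_
  rintro s2 ⟨k1, k2, -⟩
  refine Runs.assign ⟨?_, ?_, ?_⟩
  · simp only [State.setReg_reg, if_true, Expr.eval, k2]
  · funext i j
    have := g3 1 (by omega) (by omega) [i, j] h1.symm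
    simpa [State.rel, State.setReg_arr, k1, idx] using this
  · funext i j
    have := g3 2 (by omega) (by omega) [i, j] h2.symm
    simpa [State.rel, State.setReg_arr, k1, idx] using this

end Query

/-! ### Burling graphs and Burling sets -/

namespace ProbedGraph

/-- The orders and orientations of a graph of the Burling sequence for which its distinguished
sets are upward closed chains. -/
structure Oriented {V : Type} (G : SimpleGraph V) (probes : Set (Set V)) (m : ℕ)
    (prec adj : V → V → Prop) (rank : V → ℕ) : Prop where
  irrefl : ∀ x, ¬ prec x x
  trans : ∀ x y z, prec x y → prec y z → prec x z
  rank_lt : ∀ x y, adj x y → rank y < rank x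
  rank_le : ∀ x, rank x ≤ m
  ax1 : ∀ x y z, prec x y → prec x z → y ≠ z → prec y z ∨ prec z y
  ax2 : ∀ x y z, adj x y → adj x z → y ≠ z → prec y z ∨ prec z y
  ax3 : ∀ x y z, adj x y → prec x z → prec y z
  ax4 : ∀ x y z, adj x y → prec y z → adj x z ∨ prec x z
  graph : ∀ x y, G.Adj x y ↔ adj x y ∨ adj y x
  probe_chain : ∀ S ∈ probes, ∀ x ∈ S, ∀ y ∈ S, x ≠ y → prec x y ∨ prec y x
  probe_up : ∀ S ∈ probes, ∀ x ∈ S, ∀ y, prec x y → y ∈ S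

variable {P : ProbedGraph}

/-- The order on the next graph: everything that belongs to `S` goes below `S`. -/
def nextPrec (prec : P.V → P.V → Prop) : P.NextV → P.NextV → Prop
  | Sum.inl u, Sum.inl v => prec u v
  | Sum.inr ⟨S, _⟩, Sum.inl v => v ∈ S.1
  | Sum.inr ⟨S, Sum.inl u⟩, Sum.inr ⟨S', Sum.inl v⟩ => S = S' ∧ prec u v
  | _, _ => False

/-- The orientation of the next graph. -/
def nextAdj (adj : P.V → P.V → Prop) : P.NextV → P.NextV → Prop
  | Sum.inl u, Sum.inl v => adj u v
  | Sum.inr ⟨S, Sum.inl u⟩, Sum.inr ⟨S', Sum.inl v⟩ => S = S' ∧ adj u v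
  | Sum.inr ⟨S, Sum.inr Q⟩, Sum.inr ⟨S', Sum.inl v⟩ => S = S' ∧ v ∈ Q.1
  | _, _ => False

/-- The rank on the next graph. -/
def nextRank (m : ℕ) (rank : P.V → ℕ) : P.NextV → ℕ
  | Sum.inl u => rank u
  | Sum.inr ⟨_, Sum.inl u⟩ => rank u
  | Sum.inr ⟨_, Sum.inr _⟩ => m + 1

variable (P) in
/-- The graph of `P.next`, on the type `P.NextV`. -/
abbrev nextGraph : SimpleGraph P.NextV := SimpleGraph.fromRel P.NextRel

variable (P) in
/-- The distinguished sets of `P.next`, on the type `P.NextV`. -/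
abbrev nextProbes : Set (Set P.NextV) :=
  {T | ∃ S Q : P.probes,
    T = P.mainV '' S.1 ∪ P.copyV S '' Q.1 ∨ T = P.mainV '' S.1 ∪ {P.newV S Q}}

/-- Adjacency in the next graph. -/
theorem next_adj_iff (x y : P.NextV) :
    P.nextGraph.Adj x y ↔ nextAdj P.graph.Adj x y ∨ nextAdj P.graph.Adj y x := by
  have key : ∀ x y : P.NextV, P.NextRel x y → nextAdj P.graph.Adj x y := by
    rintro x y (h | ⟨S, h⟩ | ⟨S, Q, h⟩)
    · exact h
    · exact ⟨rfl, h⟩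
    · exact ⟨rfl, h⟩
  have key' : ∀ x y : P.NextV, nextAdj P.graph.Adj x y → P.NextRel x y ∧ x ≠ y := by
    rintro (x | ⟨S, x | Q⟩) (y | ⟨S', y | Q'⟩) h <;> simp only [nextAdj] at h
    · exact ⟨.inMain h, by simpa using h.ne⟩
    · obtain ⟨rfl, h⟩ := h
      exact ⟨.inCopy S h, by simpa using h.ne⟩
    · obtain ⟨rfl, h⟩ := h
      exact ⟨.attach S Q h, by simp⟩
  rw [SimpleGraph.fromRel_adj]
  constructor
  · rintro ⟨-, h | h⟩
    · exact Or.inl (key _ _ h)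
    · exact Or.inr (key _ _ h)
  · rintro (h | h)
    · exact ⟨(key' _ _ h).2, Or.inl (key' _ _ h).1⟩
    · exact ⟨(key' _ _ h).2.symm, Or.inr (key' _ _ h).1⟩

/-- The copy belonging to `S`, with its new vertices, lies below `S`, and the new vertex for `Q`
points to `Q`. Transitivity and axiom 1 for the new pairs need `S` to be an upward closed chain;
axioms 2 and 4 need the same of `Q`. New vertices get the largest rank, so their edges descend too.
-/
theorem Oriented.next {m : ℕ} {prec adj : P.V → P.V → Prop} {rank : P.V → ℕ}
    (h : Oriented P.graph P.probes m prec adj rank) :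
    Oriented P.nextGraph P.nextProbes (m + 1) (nextPrec prec) (nextAdj adj) (nextRank m rank) where
  irrefl := by
    rintro (x | ⟨S, x | Q⟩) <;> simp [nextPrec, h.irrefl]
  trans := by
    rintro (x | ⟨S, x | Q⟩) (y | ⟨S', y | Q'⟩) (z | ⟨S'', z | Q''⟩) h1 h2 <;>
      simp only [nextPrec] at h1 h2 ⊢
    · exact h.trans _ _ _ h1 h2
    · exact h.probe_up _ S.2 _ h1 _ h2
    · exact h1.1 ▸ h2
    · exact ⟨h1.1.trans h2.1, h.trans _ _ _ h1.2 h2.2⟩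
    · exact h.probe_up _ S.2 _ h1 _ h2
  rank_lt := by
    rintro (x | ⟨S, x | Q⟩) (y | ⟨S', y | Q'⟩) h1 <;> simp only [nextAdj] at h1 <;>
      simp only [nextRank]
    · exact h.rank_lt _ _ h1
    · exact h.rank_lt _ _ h1.2
    · exact Nat.lt_succ_of_le (h.rank_le _)
  rank_le := by
    rintro (x | ⟨S, x | Q⟩) <;> simp only [nextRank]
    · exact (h.rank_le _).trans (Nat.le_succ m)
    · exact (h.rank_le _).trans (Nat.le_succ m)
    · exact le_rfl
  ax1 := by
    rintro (x | ⟨S, x | Q⟩) (y | ⟨S', y | Q'⟩) (z | ⟨S'', z | Q''⟩) h1 h2 hne <;>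
      simp only [nextPrec] at h1 h2 ⊢
    · exact h.ax1 _ _ _ h1 h2 (by rintro rfl; exact hne rfl)
    · exact h.probe_chain _ S.2 _ h1 _ h2 (by rintro rfl; exact hne rfl)
    · exact Or.inr (h2.1 ▸ h1)
    · exact Or.inl (h1.1 ▸ h2)
    · obtain ⟨rfl, h1⟩ := h1
      obtain ⟨rfl, h2⟩ := h2
      simpa using h.ax1 _ _ _ h1 h2 (by rintro rfl; exact hne rfl)
    · exact h.probe_chain _ S.2 _ h1 _ h2 (by rintro rfl; exact hne rfl)
  ax2 := by
    rintro (x | ⟨S, x | Q⟩) (y | ⟨S', y | Q'⟩) (z | ⟨S'', z | Q''⟩) h1 h2 hne <;>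
      simp only [nextAdj] at h1 h2 <;> simp only [nextPrec]
    · exact h.ax2 _ _ _ h1 h2 (by rintro rfl; exact hne rfl)
    · obtain ⟨rfl, h1⟩ := h1
      obtain ⟨rfl, h2⟩ := h2
      simpa using h.ax2 _ _ _ h1 h2 (by rintro rfl; exact hne rfl)
    · obtain ⟨rfl, h1⟩ := h1
      obtain ⟨rfl, h2⟩ := h2
      simpa using h.probe_chain _ Q.2 _ h1 _ h2 (by rintro rfl; exact hne rfl)
  ax3 := by
    rintro (x | ⟨S, x | Q⟩) (y | ⟨S', y | Q'⟩) (z | ⟨S'', z | Q''⟩) h1 h2 <;>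
      simp only [nextAdj] at h1 <;> simp only [nextPrec] at h2 ⊢
    · exact h.ax3 _ _ _ h1 h2
    · exact h1.1 ▸ h2
    · exact ⟨h1.1.symm.trans h2.1, h.ax3 _ _ _ h1.2 h2.2⟩
    · exact h1.1 ▸ h2
  ax4 := by
    rintro (x | ⟨S, x | Q⟩) (y | ⟨S', y | Q'⟩) (z | ⟨S'', z | Q''⟩) h1 h2 <;>
      simp only [nextAdj] at h1 <;> simp only [nextPrec] at h2 <;> simp only [nextAdj, nextPrec]
    · exact h.ax4 _ _ _ h1 h2
    · exact Or.inr (h1.1 ▸ h2)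
    · obtain ⟨rfl, h1⟩ := h1
      obtain ⟨rfl, h2⟩ := h2
      simpa using h.ax4 _ _ _ h1 h2
    · exact Or.inr (h1.1 ▸ h2)
    · exact Or.inl ⟨h1.1.trans h2.1, h.probe_up _ Q.2 _ h1.2 _ h2.2⟩
  graph := by
    intro x y
    rw [next_adj_iff]
    rcases x with x | ⟨S, x | Q⟩ <;> rcases y with y | ⟨S', y | Q'⟩ <;> simp only [nextAdj]
    · simp only [h.graph]; tauto
    · simp only [h.graph, eq_comm (a := S') (b := S)]; tauto
  probe_chain := by
    rintro _ ⟨S, Q, rfl | rfl⟩ (x | ⟨S', x | Q'⟩) hx (y | ⟨S'', y | Q''⟩) hy hne <;>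
      simp [mainV, copyV, newV] at hx hy <;> simp only [nextPrec]
    · exact h.probe_chain _ S.2 _ hx _ hy (by rintro rfl; exact hne rfl)
    · rcases hy with ⟨-, rfl⟩; exact Or.inr hx
    · rcases hx with ⟨-, rfl⟩; exact Or.inl hy
    · obtain ⟨hx, rfl⟩ := hx
      obtain ⟨hy, rfl⟩ := hy
      simpa using h.probe_chain _ Q.2 _ hx _ hy (by rintro rfl; exact hne rfl)
    · exact h.probe_chain _ S.2 _ hx _ hy (by rintro rfl; exact hne rfl)
    · rcases hy with ⟨rfl, -⟩; exact Or.inr hx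
    · rcases hx with ⟨rfl, -⟩; exact Or.inl hy
    · obtain ⟨rfl, hx⟩ := hx
      obtain ⟨rfl, hy⟩ := hy
      simp_all
  probe_up := by
    rintro _ ⟨S, Q, rfl | rfl⟩ (x | ⟨S', x | Q'⟩) hx (y | ⟨S'', y | Q''⟩) hxy <;>
      simp [mainV, copyV, newV] at hx ⊢ <;> simp only [nextPrec] at hxy
    · exact h.probe_up _ S.2 _ hx _ hxy
    · rcases hx with ⟨-, rfl⟩; exact hxy
    · obtain ⟨hx, rfl⟩ := hx
      obtain ⟨rfl, hxy⟩ := hxy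
      exact ⟨h.probe_up _ Q.2 _ hx _ hxy, rfl⟩
    · exact h.probe_up _ S.2 _ hx _ hxy
    · rcases hx with ⟨rfl, -⟩; exact hxy

end ProbedGraph

theorem burlingSeq_oriented (k : ℕ) :
    ∃ prec adj rank, ProbedGraph.Oriented (burlingSeq k).graph (burlingSeq k).probes k prec adj rank := by
  induction k with
  | zero =>
    refine ⟨fun _ _ => False, fun _ _ => False, fun _ => 0, ?_⟩
    constructor <;> simp [burlingSeq]
  | succ k ih =>
    obtain ⟨prec, adj, rank, h⟩ := ih
    exact ⟨_, _, _, ProbedGraph.Oriented.next h⟩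

/-- Burling graphs come from Burling sets. -/
theorem IsBurlingGraph.exists_isBurlingSet {V : Type*} [Finite V] [Nonempty V]
    {G : SimpleGraph V} (hG : IsBurlingGraph G) :
    ∃ prec adj : V → V → Prop, IsBurlingSet prec adj ∧ G = SimpleGraph.fromRel adj := by
  obtain ⟨k, ⟨f⟩⟩ := hG
  obtain ⟨prec, adj, rank, h⟩ := burlingSeq_oriented k
  have hr : ∀ x y, Relation.TransGen (fun a b => adj (f a) (f b)) x y →
      rank (f y) < rank (f x) := by
    intro x y hxy
    induction hxy with
    | single h' => exact h.rank_lt _ _ h'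
    | tail _ h' ih => exact (h.rank_lt _ _ h').trans ih
  refine ⟨fun a b => prec (f a) (f b), fun a b => adj (f a) (f b), ?_, ?_⟩
  · exact
      { finite := inferInstance
        nonempty := inferInstance
        prec_irrefl := fun _ => h.irrefl _
        prec_trans := fun _ _ _ => h.trans _ _ _
        adj_acyclic := fun x hx => lt_irrefl _ (hr x x hx)
        axiom1 := fun _ _ _ h1 h2 hne => h.ax1 _ _ _ h1 h2 (f.injective.ne hne)
        axiom2 := fun _ _ _ h1 h2 hne => h.ax2 _ _ _ h1 h2 (f.injective.ne hne)
        axiom3 := fun _ _ _ => h.ax3 _ _ _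
        axiom4 := fun _ _ _ => h.ax4 _ _ _ }
  · ext a b
    rw [SimpleGraph.fromRel_adj, ← f.map_adj_iff, h.graph]
    refine ⟨fun h' => ⟨?_, h'⟩, fun h' => h'.2⟩
    rintro rfl
    rcases h' with h' | h' <;> exact lt_irrefl _ (h.rank_lt _ _ h')

/-! ### Embedding Burling sets into the Burling sequence. -/

theorem burlingSeq_probes_nonempty (k : ℕ) : (burlingSeq k).probes.Nonempty := by
  induction k with
  | zero => exact ⟨Set.univ, rfl⟩
  | succ k ih => obtain ⟨S, hS⟩ := ih; exact ⟨_, ⟨S, hS⟩, ⟨S, hS⟩, Or.inl rfl⟩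

/-- `f` embeds the part `A` of a Burling set into a graph with distinguished sets such that the
upward closed chains of `A` are traces of distinguished sets. -/
structure ProbedEmbedding {V W : Type*} (prec adj : V → V → Prop) (A : Set V)
    (H : SimpleGraph W) (probes : Set (Set W)) (f : V → W) : Prop where
  inj : Set.InjOn f A
  graph : ∀ a ∈ A, ∀ b ∈ A, H.Adj (f a) (f b) ↔ adj a b ∨ adj b a
  probe : ∀ X ⊆ A, (∀ a ∈ X, ∀ b ∈ X, a ≠ b → prec a b ∨ prec b a) →
    (∀ a ∈ X, ∀ b ∈ A, prec a b → b ∈ X) → ∃ T ∈ probes, ∀ a ∈ A, f a ∈ T ↔ a ∈ X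

namespace ProbedEmbedding

variable {V : Type*} {prec adj : V → V → Prop} {A : Set V} {P : ProbedGraph} {f : V → P.V}

/-- An embedding stays valid in the main copy, since the new vertex added to a distinguished set is
not in the image. This brings two embeddings to a common stage of the sequence. -/
theorem next (h : ProbedEmbedding prec adj A P.graph P.probes f) :
    ProbedEmbedding prec adj A P.nextGraph P.nextProbes fun a => P.mainV (f a) where
  inj := fun a ha b hb hab => h.inj ha hb (Sum.inl_injective hab)
  graph := fun a ha b hb => by
    rw [← h.graph a ha b hb, P.next_adj_iff]
    simp only [ProbedGraph.nextAdj]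
    rw [P.graph.adj_comm (f b) (f a), or_self]
  probe := fun X hX h1 h2 => by
    obtain ⟨T, hT, hT'⟩ := h.probe X hX h1 h2
    refine ⟨_, ⟨⟨T, hT⟩, ⟨T, hT⟩, Or.inr rfl⟩, fun a ha => ?_⟩
    rw [← hT' a ha]
    simp

theorem exists_of_le {k m : ℕ} (hm : k ≤ m)
    (h : ∃ f, ProbedEmbedding prec adj A (burlingSeq k).graph (burlingSeq k).probes f) :
    ∃ f, ProbedEmbedding prec adj A (burlingSeq m).graph (burlingSeq m).probes f := by
  induction m, hm using Nat.le_induction with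
  | base => exact h
  | succ m _ ih => obtain ⟨g, hg⟩ := ih; exact ⟨_, hg.next⟩

open Classical in
/-- Adding an element `x` that is maximal, minimal, and has no in-neighbours. -/
theorem attach (hs : IsBurlingSet prec adj) {x : V} (hx : x ∈ A)
    (hroot : ∀ a ∈ A, ¬ prec x a) (hsrc : ∀ a ∈ A, ¬ adj a x) (hmin : ∀ a ∈ A, ¬ prec a x)
    (hf : ProbedEmbedding prec adj (A \ {x}) P.graph P.probes f) (hP : P.probes.Nonempty) :
    ∃ F, ProbedEmbedding prec adj A P.nextGraph P.nextProbes F := by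
  obtain ⟨S, hS⟩ := hP
  -- The out-neighbourhood of `x` is a chain by axiom 2, and upward closed by axiom 4 because `x` is
  -- maximal.
  obtain ⟨Q, hQ, hQ'⟩ := hf.probe {a ∈ A \ {x} | adj x a} (fun a ha => ha.1)
    (fun a ha b hb hab => hs.axiom2 _ _ _ ha.2 hb.2 hab)
    (fun a ha b hb hab => ⟨hb, (hs.axiom4 _ _ _ ha.2 hab).resolve_right (hroot b hb.1)⟩)
  have hxx : ¬ adj x x := fun h => hs.adj_acyclic _ (.single h)
  let S0 : P.probes := ⟨S, hS⟩
  let Q0 : P.probes := ⟨Q, hQ⟩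
  -- Everything goes into the copy of one arbitrary `S`; the main copy is not used, so `S`
  -- contributes nothing to the traces.
  let F : V → P.NextV := fun a => if a = x then P.newV S0 Q0 else P.copyV S0 (f a)
  have hFx : F x = P.newV S0 Q0 := if_pos rfl
  have hFD : ∀ a, a ≠ x → F a = P.copyV S0 (f a) := fun a ha => if_neg ha
  have hxd : ∀ d ∈ A, d ≠ x → (P.nextGraph.Adj (F x) (F d) ↔ adj x d ∨ adj d x) := by
    intro d hd hd'
    rw [hFx, hFD d hd', P.next_adj_iff]
    have := hQ' d ⟨hd, hd'⟩
    simp only [ProbedGraph.nextAdj]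
    simp only [Set.mem_ofPred_eq, Set.mem_sdiff, Set.mem_singleton_iff, hd, hd', hsrc d hd] at this ⊢
    simpa [Q0] using this
  refine ⟨F, ?_, ?_, ?_⟩
  · intro a ha b hb hab
    by_cases ha' : a = x <;> by_cases hb' : b = x
    · rw [ha', hb']
    · rw [ha', hFx, hFD b hb'] at hab; simp at hab
    · rw [hb', hFx, hFD a ha'] at hab; simp at hab
    · rw [hFD a ha', hFD b hb'] at hab
      exact hf.inj ⟨ha, ha'⟩ ⟨hb, hb'⟩ (by simpa using hab)
  · intro a ha b hb
    by_cases ha' : a = x <;> by_cases hb' : b = x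
    · subst ha'; subst hb'; simp [hxx]
    · subst ha'; exact hxd b hb hb'
    · subst hb'; rw [SimpleGraph.adj_comm, or_comm]; exact hxd a ha ha'
    · rw [hFD a ha', hFD b hb', P.next_adj_iff, ← hf.graph a ⟨ha, ha'⟩ b ⟨hb, hb'⟩]
      simp only [ProbedGraph.nextAdj, true_and]
      rw [P.graph.adj_comm (f b) (f a), or_self]
  · intro X hX h1 h2
    -- In `A`, `x` is comparable to no other element, so a chain through `x` is just `{x}`.
    by_cases hxX : x ∈ X
    · refine ⟨_, ⟨S0, Q0, Or.inr rfl⟩, fun a ha => ?_⟩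
      by_cases ha' : a = x
      · subst ha'; rw [hFx]; simp [hxX]
      · have : a ∉ X := fun h => (h1 a h x hxX ha').elim (hmin a ha) (hroot a ha)
        rw [hFD a ha']; simp [this]
    · obtain ⟨T, hT, hT'⟩ := hf.probe X
        (fun a ha => ⟨hX ha, by rintro rfl; exact hxX ha⟩) h1 (fun a ha b hb => h2 a ha b hb.1)
      refine ⟨_, ⟨S0, ⟨T, hT⟩, Or.inl rfl⟩, fun a ha => ?_⟩
      by_cases ha' : a = x
      · subst ha'; rw [hFx]; simp [hxX]
      · rw [hFD a ha', ← hT' a ⟨ha, ha'⟩]; simp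

open Classical in
/-- Adding the elements below a maximal element `x` without in-neighbours. -/
theorem hang (hs : IsBurlingSet prec adj) {x : V} (hx : x ∈ A)
    (hroot : ∀ a ∈ A, ¬ prec x a) (hsrc : ∀ a ∈ A, ¬ adj a x) {g : V → P.V}
    (hf : ProbedEmbedding prec adj {a ∈ A | ¬ prec a x} P.graph P.probes f)
    (hg : ProbedEmbedding prec adj {a ∈ A | prec a x} P.graph P.probes g) :
    ∃ F, ProbedEmbedding prec adj A P.nextGraph P.nextProbes F := by
  have hxx := hs.prec_irrefl x
  -- By maximality `{x}` is an upward closed chain, so some distinguished set has trace `{x}`; its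
  -- copy receives the elements below `x`.
  obtain ⟨S, hS, hS'⟩ := hf.probe {x} (by simpa using ⟨hx, hxx⟩) (by simp) (by
    rintro a rfl b hb hab
    exact absurd hab (hroot b hb.1))
  -- An edge leaving the elements below `x` contradicts axiom 3; an edge entering them contradicts
  -- axiom 4, as `x` has no in-neighbour.
  have hTD : ∀ a ∈ A, ∀ d ∈ A, prec a x → ¬ prec d x → ¬ adj a d ∧ ¬ adj d a :=
    fun a _ d hd hax hdx => ⟨fun h => hdx (hs.axiom3 _ _ _ h hax),
      fun h => (hs.axiom4 _ _ _ h hax).elim (hsrc d hd) hdx⟩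
  let S0 : P.probes := ⟨S, hS⟩
  let F : V → P.NextV := fun a => if prec a x then P.copyV S0 (g a) else P.mainV (f a)
  have hFT : ∀ a, prec a x → F a = P.copyV S0 (g a) := fun a ha => if_pos ha
  have hFD : ∀ a, ¬ prec a x → F a = P.mainV (f a) := fun a ha => if_neg ha
  have htd : ∀ t ∈ A, prec t x → ∀ d ∈ A, ¬ prec d x →
      (P.nextGraph.Adj (F t) (F d) ↔ adj t d ∨ adj d t) := by
    intro t ht ht' d hd hd'
    rw [hFT t ht', hFD d hd', P.next_adj_iff]
    simp [ProbedGraph.nextAdj, hTD t ht d hd ht' hd']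
  refine ⟨F, ?_, ?_, ?_⟩
  · intro a ha b hb hab
    by_cases ha' : prec a x <;> by_cases hb' : prec b x
    · rw [hFT a ha', hFT b hb'] at hab
      exact hg.inj ⟨ha, ha'⟩ ⟨hb, hb'⟩ (by simpa using hab)
    · rw [hFT a ha', hFD b hb'] at hab; simp at hab
    · rw [hFT b hb', hFD a ha'] at hab; simp at hab
    · rw [hFD a ha', hFD b hb'] at hab
      exact hf.inj ⟨ha, ha'⟩ ⟨hb, hb'⟩ (by simpa using hab)
  · intro a ha b hb
    by_cases ha' : prec a x <;> by_cases hb' : prec b x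
    · rw [hFT a ha', hFT b hb', P.next_adj_iff, ← hg.graph a ⟨ha, ha'⟩ b ⟨hb, hb'⟩]
      simp only [ProbedGraph.nextAdj, true_and]
      rw [P.graph.adj_comm (g b) (g a), or_self]
    · exact htd a ha ha' b hb hb'
    · rw [SimpleGraph.adj_comm, or_comm]; exact htd b hb hb' a ha ha'
    · rw [hFD a ha', hFD b hb', P.next_adj_iff, ← hf.graph a ⟨ha, ha'⟩ b ⟨hb, hb'⟩]
      simp only [ProbedGraph.nextAdj]
      rw [P.graph.adj_comm (f b) (f a), or_self]
  · intro X hX h1 h2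
    -- A chain through the maximal `x` is `x` plus a chain below it, matching a set `S ∪ Q`. An
    -- upward closed chain avoiding `x` contains nothing below `x`, and a set with a new vertex
    -- outside the image serves.
    by_cases hxX : x ∈ X
    · obtain ⟨T, hT, hT'⟩ := hg.probe {a ∈ X | prec a x} (fun a ha => ⟨hX ha.1, ha.2⟩)
        (fun a ha b hb => h1 a ha.1 b hb.1) (fun a ha b hb hab => ⟨h2 a ha.1 b hb.1 hab, hb.2⟩)
      refine ⟨_, ⟨S0, ⟨T, hT⟩, Or.inl rfl⟩, fun a ha => ?_⟩
      by_cases ha' : prec a x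
      · rw [hFT a ha']
        have := hT' a ⟨ha, ha'⟩
        simp only [Set.mem_ofPred_eq, ha', and_true] at this
        rw [← this]; simp
      · have h3 : a ∈ X ↔ a = x := by
          refine ⟨fun h => ?_, fun h => h ▸ hxX⟩
          by_contra hne
          exact (h1 a h x hxX hne).elim ha' (hroot a ha)
        rw [hFD a ha', h3, ← Set.mem_singleton_iff, ← hS' a ⟨ha, ha'⟩]; simp [S0]
    · have hXT : ∀ a ∈ X, ¬ prec a x := fun a ha ha' => hxX (h2 a ha x hx ha')
      obtain ⟨T, hT, hT'⟩ := hf.probe X (fun a ha => ⟨hX ha, hXT a ha⟩) h1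
        (fun a ha b hb => h2 a ha b hb.1)
      refine ⟨_, ⟨⟨T, hT⟩, ⟨T, hT⟩, Or.inr rfl⟩, fun a ha => ?_⟩
      by_cases ha' : prec a x
      · have : a ∉ X := fun h => hXT a h ha'
        rw [hFT a ha']; simp [this]
      · rw [hFD a ha', ← hT' a ⟨ha, ha'⟩]; simp

end ProbedEmbedding

namespace IsBurlingSet

variable {V : Type*} {prec adj : V → V → Prop}

/-- By axiom 3 an in-neighbour of a maximal element is maximal, so a source among the maximal
elements is a source of all of `A`. -/
theorem exists_maximal_source (hs : IsBurlingSet prec adj) {A : Set V} (hA : A.Nonempty) :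
    ∃ x ∈ A, (∀ a ∈ A, ¬ prec x a) ∧ ∀ a ∈ A, ¬ adj a x := by
  have := hs.finite
  have w1 : WellFounded fun a b => prec b a := by
    have : IsTrans V fun a b => prec b a := ⟨fun a b c h1 h2 => hs.prec_trans _ _ _ h2 h1⟩
    have : Std.Irrefl fun a b => prec b a := ⟨hs.prec_irrefl⟩
    exact Finite.wellFounded_of_trans_of_irrefl _
  have w2 : WellFounded (Relation.TransGen adj) := by
    have : Std.Irrefl (Relation.TransGen adj) := ⟨hs.adj_acyclic⟩
    exact Finite.wellFounded_of_trans_of_irrefl _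
  have hR : {a ∈ A | ∀ b ∈ A, ¬ prec a b}.Nonempty := by
    obtain ⟨m, hm, hm'⟩ := w1.has_min A hA
    exact ⟨m, hm, hm'⟩
  obtain ⟨x, hx, hx'⟩ := w2.has_min _ hR
  refine ⟨x, hx.1, hx.2, fun a ha hax => hx' a ⟨ha, fun b hb hab => ?_⟩ (.single hax)⟩
  exact hx.2 b hb (hs.axiom3 _ _ _ hax hab)

/-- Induction on the size: for a maximal source `x`, the elements below `x` and the other elements
apart from `x` are embedded separately. One stage is spent on attaching `x` and one on hanging the
elements below it. -/
theorem exists_probedEmbedding (hs : IsBurlingSet prec adj) :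
    ∀ (m : ℕ) (A : Set V), A.ncard ≤ m → ∃ k f,
      ProbedEmbedding prec adj A (burlingSeq k).graph (burlingSeq k).probes f := by
  have := hs.finite
  intro m
  induction m with
  | zero =>
    intro A hA
    have hA' : A = ∅ := (Set.ncard_eq_zero A.toFinite).1 (Nat.le_zero.1 hA)
    have he : ∀ a, a ∉ A := fun a ha => by rw [hA'] at ha; exact ha
    exact ⟨0, fun _ => (), fun a ha => (he a ha).elim, fun a ha => (he a ha).elim,
      fun X _ _ _ => ⟨Set.univ, rfl, fun a ha => (he a ha).elim⟩⟩
  | succ m ih =>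
    intro A hA
    rcases A.eq_empty_or_nonempty with rfl | hne
    · exact ih ∅ (by simp)
    obtain ⟨x, hx, hroot, hsrc⟩ := hs.exists_maximal_source hne
    have hxx := hs.prec_irrefl x
    have hlt : ∀ B : Set V, B ⊆ A → x ∉ B → B.ncard ≤ m := fun B hB hxB => by
      have := Set.ncard_lt_ncard (Set.ssubset_iff_of_subset hB |>.2 ⟨x, hx, hxB⟩) A.toFinite
      omega
    obtain ⟨k1, hf⟩ := ih ({a ∈ A | ¬ prec a x} \ {x}) (hlt _ (fun a ha => ha.1.1) (by simp))
    obtain ⟨k2, hg⟩ := ih {a ∈ A | prec a x} (hlt _ (fun a ha => ha.1) (by simp [hxx]))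
    obtain ⟨f, hf⟩ := ProbedEmbedding.exists_of_le (le_max_left k1 k2) hf
    obtain ⟨f', hf'⟩ := ProbedEmbedding.attach hs (A := {a ∈ A | ¬ prec a x}) ⟨hx, hxx⟩
      (fun a ha => hroot a ha.1) (fun a ha => hsrc a ha.1) (fun a ha => ha.2) hf
      (burlingSeq_probes_nonempty _)
    obtain ⟨g, hg⟩ := ProbedEmbedding.exists_of_le (m := max k1 k2 + 1) (by omega) hg
    obtain ⟨F, hF⟩ := ProbedEmbedding.hang (P := burlingSeq (max k1 k2 + 1)) hs hx hroot hsrc hf' hg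
    exact ⟨max k1 k2 + 2, F, hF⟩

/-- The graph of a Burling set is a Burling graph. -/
theorem isBurlingGraph (hs : IsBurlingSet prec adj) :
    IsBurlingGraph (SimpleGraph.fromRel adj) := by
  obtain ⟨k, f, hf⟩ := hs.exists_probedEmbedding _ Set.univ le_rfl
  refine ⟨k, ⟨⟨⟨f, fun a b h => hf.inj (Set.mem_univ a) (Set.mem_univ b) h⟩, ?_⟩⟩⟩
  intro a b
  refine (hf.graph a (Set.mem_univ a) b (Set.mem_univ b)).trans ?_
  rw [SimpleGraph.fromRel_adj]
  refine ⟨fun h => ⟨?_, h⟩, fun h => h.2⟩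
  rintro rfl
  exact hs.adj_acyclic a (.single (by tauto))

end IsBurlingSet

/-! ### Representations of parts of a graph -/

namespace Recognition

variable {V : Type*} {G : SimpleGraph V}

/-- `u` and `v` are connected in `G - B`. -/
def Conn (G : SimpleGraph V) (B : Set V) (u v : V) : Prop :=
  u ∉ B ∧ Relation.ReflTransGen (fun a b => G.Adj a b ∧ b ∉ B) u v

namespace Conn

variable {B : Set V} {u v w : V}

theorem refl (h : u ∉ B) : Conn G B u u := ⟨h, .refl⟩

theorem left (h : Conn G B u v) : u ∉ B := h.1

theorem right (h : Conn G B u v) : v ∉ B := by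
  obtain ⟨h, h'⟩ := h
  cases h' with
  | refl => exact h
  | tail _ h'' => exact h''.2

theorem trans (h : Conn G B u v) (h' : Conn G B v w) : Conn G B u w := ⟨h.1, h.2.trans h'.2⟩

theorem adj (h : G.Adj u v) (hu : u ∉ B) (hv : v ∉ B) : Conn G B u v := ⟨hu, .single ⟨h, hv⟩⟩

theorem tail (h : Conn G B u v) (h' : G.Adj v w) (hw : w ∉ B) : Conn G B u w :=
  h.trans (adj h' h.right hw)

theorem symm (h : Conn G B u v) : Conn G B v u := by
  obtain ⟨hu, h⟩ := h
  induction h with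
  | refl => exact refl hu
  | tail _ h' ih => exact (adj h'.1.symm h'.2 ih.left).trans ih

/-- A property that is preserved by the edges of `G - B` holds on a whole component. -/
theorem induct {p : V → Prop} (h : Conn G B u v) (hu : p u)
    (hs : ∀ a b, Conn G B u a → Conn G B u b → p a → G.Adj a b → p b) : p v := by
  obtain ⟨huB, h⟩ := h
  induction h with
  | refl => exact hu
  | tail h1 h2 ih => exact hs _ _ ⟨huB, h1⟩ ⟨huB, h1.tail h2⟩ ih h2.1

end Conn

/-- `prec` and `adj` form a Burling set on `C` with the graph `G[C]`, for which the neighbourhood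
in `C` of every vertex outside `C` is an upward closed chain. -/
structure IsRep (G : SimpleGraph V) (C : Set V) (prec adj : V → V → Prop) : Prop where
  prec_mem : ∀ {x y}, prec x y → x ∈ C ∧ y ∈ C
  adj_mem : ∀ {x y}, adj x y → x ∈ C ∧ y ∈ C
  irrefl : ∀ x, ¬ prec x x
  trans : ∀ {x y z}, prec x y → prec y z → prec x z
  wf : WellFounded fun y x => adj x y
  ax1 : ∀ {x y z}, prec x y → prec x z → y ≠ z → prec y z ∨ prec z y
  ax2 : ∀ {x y z}, adj x y → adj x z → y ≠ z → prec y z ∨ prec z y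
  ax3 : ∀ {x y z}, adj x y → prec x z → prec y z
  ax4 : ∀ {x y z}, adj x y → prec y z → adj x z ∨ prec x z
  graph : ∀ {x y}, x ∈ C → y ∈ C → (G.Adj x y ↔ adj x y ∨ adj y x)
  probe_chain : ∀ {w x y}, w ∉ C → x ∈ C → y ∈ C → G.Adj w x → G.Adj w y → x ≠ y →
    prec x y ∨ prec y x
  probe_up : ∀ {w x y}, w ∉ C → G.Adj w x → prec x y → G.Adj w y

theorem IsRep.congr {C : Set V} {p a p' a' : V → V → Prop} (h : IsRep G C p a)
    (hp : ∀ x y, p' x y ↔ p x y) (ha : ∀ x y, a' x y ↔ a x y) : IsRep G C p' a' := by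
  have h1 : p' = p := by funext x y; exact propext (hp x y)
  have h2 : a' = a := by funext x y; exact propext (ha x y)
  rwa [h1, h2]

/-- The restriction of a relation to a set. -/
def restr (K : Set V) (p : V → V → Prop) (x y : V) : Prop := x ∈ K ∧ y ∈ K ∧ p x y

/-- The component of `u` in `G - B`. -/
def comp (G : SimpleGraph V) (B : Set V) (u : V) : Set V := {v | Conn G B u v}

theorem comp_eq {B : Set V} {u v : V} (h : Conn G B u v) : comp G B u = comp G B v := by
  ext w
  exact ⟨fun h' => h.symm.trans h', fun h' => h.trans h'⟩

/-! ### Nesting components -/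

section Nest

variable (G) in
/-- `w` is a vertex of `B` with a neighbour in the component of `u`. -/
def Nbr (B : Set V) (u w : V) : Prop := w ∈ B ∧ ∃ k, Conn G B u k ∧ G.Adj w k

variable (G) in
/-- All neighbours of the component of `u` have the same trace on the component of `v`. -/
def Cst (B : Set V) (u v : V) : Prop :=
  ∀ w w' k, Nbr G B u w → Nbr G B u w' → Conn G B v k → G.Adj w k → G.Adj w' k

variable [LinearOrder V]

variable (G) in
/-- The component of `u` has an element that is smaller than the component of `v`. -/
def MinLt (B : Set V) (u v : V) : Prop := ∃ m, Conn G B u m ∧ ∀ m', Conn G B v m' → m < m'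

variable (G) in
/-- `v` belongs to the chain of another component below which the component of `u` is put. -/
def Below (B : Set V) (u v : V) : Prop :=
  Cst G B u v ∧ (¬ Cst G B v u ∨ MinLt G B u v) ∧ (∃ w, Nbr G B u w) ∧
    ∀ w, Nbr G B u w → G.Adj w v

variable {B : Set V} {u v u' v' w : V}

omit [LinearOrder V] in
theorem Nbr.congr (h : Conn G B u u') (hw : Nbr G B u w) : Nbr G B u' w :=
  ⟨hw.1, hw.2.imp fun _ hk => ⟨h.symm.trans hk.1, hk.2⟩⟩

omit [LinearOrder V] in
theorem Cst.congr (hu : Conn G B u u') (hv : Conn G B v v') (h : Cst G B u v) : Cst G B u' v' :=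
  fun w w' k h1 h2 h3 => h w w' k (h1.congr hu.symm) (h2.congr hu.symm) (hv.trans h3)

theorem MinLt.congr (hu : Conn G B u u') (hv : Conn G B v v') (h : MinLt G B u v) :
    MinLt G B u' v' := by
  obtain ⟨m, h1, h2⟩ := h
  exact ⟨m, hu.symm.trans h1, fun m' h3 => h2 m' (hv.trans h3)⟩

theorem MinLt.trans {q : V} (h : MinLt G B u v) (h' : MinLt G B v q) : MinLt G B u q := by
  obtain ⟨m, h1, h2⟩ := h
  obtain ⟨m', h3, h4⟩ := h'
  exact ⟨m, h1, fun k hk => (h2 m' h3).trans (h4 k hk)⟩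

theorem MinLt.asymm (h : MinLt G B u v) (h' : MinLt G B v u) : False := by
  obtain ⟨m, h1, h2⟩ := h
  obtain ⟨m', h3, h4⟩ := h'
  exact lt_asymm (h2 m' h3) (h4 m h1)

theorem minLt_total [Finite V] (hu : u ∉ B) (hv : v ∉ B) (huv : ¬ Conn G B u v) :
    MinLt G B u v ∨ MinLt G B v u := by
  have hmin : ∀ u, u ∉ B → ∃ m, Conn G B u m ∧ ∀ m', Conn G B u m' → m ≤ m' := fun u hu => by
    obtain ⟨m, hm, hm'⟩ := Set.exists_min_image (comp G B u) id (Set.toFinite _) ⟨u, .refl hu⟩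
    exact ⟨m, hm, hm'⟩
  obtain ⟨m, h1, h2⟩ := hmin u hu
  obtain ⟨m', h3, h4⟩ := hmin v hv
  rcases lt_trichotomy m m' with h | h | h
  · exact Or.inl ⟨m, h1, fun k hk => h.trans_le (h4 k hk)⟩
  · exact absurd (h1.trans (h ▸ h3.symm)) huv
  · exact Or.inr ⟨m', h3, fun k hk => h.trans_le (h2 k hk)⟩

theorem Below.congr_left (h : Conn G B u u') (hv : v ∉ B) (hb : Below G B u v) :
    Below G B u' v := by
  obtain ⟨h1, h2, ⟨w, h3⟩, h4⟩ := hb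
  refine ⟨h1.congr h (.refl hv), h2.imp (fun h' h'' => h' (h''.congr (.refl hv) h.symm))
    (fun h' => h'.congr h (.refl hv)), ⟨w, h3.congr h⟩, fun w hw => h4 w (hw.congr h.symm)⟩

theorem Below.congr_right (hu : u ∉ B) (h : Conn G B v v')
    (hadj : ∀ w ∈ B, G.Adj w v → G.Adj w v') (hb : Below G B u v) : Below G B u v' := by
  obtain ⟨h1, h2, h3, h4⟩ := hb
  exact ⟨h1.congr (.refl hu) h, h2.imp (fun h' h'' => h' (h''.congr h.symm (.refl hu)))
    (fun h' => h'.congr (.refl hu) h), h3, fun w hw => hadj w hw.1 (h4 w hw)⟩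

/-- Neighbour sets of components grow upwards, so constancy of traces passes from `v` to `u`. If the
tie between `u` and `q` is symmetric, all three components have the same neighbours, hence all
comparisons are ties, settled by the smallest vertices. -/
theorem Below.trans {q : V} (hvB : v ∉ B) (hqB : q ∉ B) (h : Below G B u v)
    (h' : Below G B v q) : Below G B u q := by
  obtain ⟨h1, h2, ⟨w, h3⟩, h4⟩ := h
  obtain ⟨k1, k2, -, k4⟩ := h'
  have huv : ∀ w, Nbr G B u w → Nbr G B v w := fun w hw =>
    ⟨hw.1, v, .refl hvB, h4 w hw⟩
  have hvq : ∀ w, Nbr G B v w → Nbr G B q w := fun w hw =>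
    ⟨hw.1, q, .refl hqB, k4 w hw⟩
  refine ⟨fun w w' k hw hw' => k1 w w' k (huv w hw) (huv w' hw'), ?_, ⟨w, h3⟩,
    fun w hw => k4 w (huv w hw)⟩
  by_cases hqu : Cst G B q u
  · right
    have hback : ∀ w', Nbr G B q w' → Nbr G B u w' := by
      intro w' hw'
      obtain ⟨hwB, k, hk, hk'⟩ := h3
      exact ⟨hw'.1, k, hk, hqu w w' k (hvq w (huv w ⟨hwB, k, hk, hk'⟩)) hw' hk hk'⟩
    have hvu : Cst G B v u := fun w w' k hw hw' => hqu w w' k (hvq w hw) (hvq w' hw')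
    have hqv : Cst G B q v := fun w w' k hw hw' => h1 w w' k (hback w hw) (hback w' hw')
    exact (h2.resolve_left (not_not.2 hvu)).trans (k2.resolve_left (not_not.2 hqv))
  · exact Or.inl hqu

/-- Two components that have a common neighbour are nested. -/
theorem below_or_below [Finite V] (hu : u ∉ B) (hv : v ∉ B) (huv : ¬ Conn G B u v)
    (hc : Cst G B u v ∨ Cst G B v u) (hw : w ∈ B) (hwu : G.Adj w u) (hwv : G.Adj w v) :
    Below G B u v ∨ Below G B v u := by
  have hnu : Nbr G B u w := ⟨hw, u, .refl hu, hwu⟩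
  have hnv : Nbr G B v w := ⟨hw, v, .refl hv, hwv⟩
  have h1 : Cst G B u v → (¬ Cst G B v u ∨ MinLt G B u v) → Below G B u v := fun h h' =>
    ⟨h, h', ⟨w, hnu⟩, fun w' hw' => h w w' v hnu hw' (.refl hv) hwv⟩
  have h2 : Cst G B v u → (¬ Cst G B u v ∨ MinLt G B v u) → Below G B v u := fun h h' =>
    ⟨h, h', ⟨w, hnv⟩, fun w' hw' => h w w' u hnv hw' (.refl hu) hwu⟩
  have h3 := minLt_total hu hv huv
  tauto

/-- The order on a union `H` of components of `G - B` obtained from orders of the components by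
nesting. -/
def nestPrec (G : SimpleGraph V) (B H : Set V) (p : V → V → Prop) (u v : V) : Prop :=
  u ∈ H ∧ v ∈ H ∧ (Conn G B u v ∧ p u v ∨ ¬ Conn G B u v ∧ Below G B u v)

/-- The orientation on a union of components obtained from orientations of the components. -/
def nestAdj (G : SimpleGraph V) (B H : Set V) (a : V → V → Prop) (u v : V) : Prop :=
  u ∈ H ∧ v ∈ H ∧ Conn G B u v ∧ a u v

/-- The part of a component above another one is the trace of any neighbour of the lower one, hence
an upward closed chain. Two components above a third share a neighbour and so are nested by
`below_or_below`. Edges stay inside components, and a vertex outside `H` that sees `H` lies in `B`,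
so the same argument compares its traces. -/
theorem isRep_nest [Finite V] {H : Set V} {p a : V → V → Prop} (hB : ∀ u ∈ H, u ∉ B)
    (hH : ∀ u ∈ H, ∀ v, Conn G B u v → v ∈ H)
    (hrep : ∀ u ∈ H, IsRep G (comp G B u) (restr (comp G B u) p) (restr (comp G B u) a))
    (hc : ∀ u ∈ H, ∀ v ∈ H, ¬ Conn G B u v → Cst G B u v ∨ Cst G B v u) :
    IsRep G H (nestPrec G B H p) (nestAdj G B H a) := by
  have hr : ∀ {u}, u ∈ H → u ∈ comp G B u := fun hu => Conn.refl (hB _ hu)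
  have hwH : ∀ {w u}, u ∈ H → w ∉ H → G.Adj w u → w ∈ B := fun {w u} hu hw h => by
    by_contra hwB
    exact hw (hH u hu w (.adj h.symm (hB u hu) hwB))
  have hP : ∀ {u v}, u ∈ H → Conn G B u v → p u v → restr (comp G B u) p u v :=
    fun hu h h' => ⟨hr hu, h, h'⟩
  have hup : ∀ {u v w}, u ∈ H → Conn G B u v → p u v → w ∈ B → G.Adj w u → G.Adj w v :=
    fun hu h h' hw hwu => (hrep _ hu).probe_up (fun h'' => h''.right hw) hwu (hP hu h h')
  constructor
  · exact fun h => ⟨h.1, h.2.1⟩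
  · exact fun h => ⟨h.1, h.2.1⟩
  · rintro u ⟨hu, -, ⟨h, h'⟩ | ⟨h, h'⟩⟩
    · exact (hrep u hu).irrefl u (hP hu h h')
    · exact h (hr hu)
  · rintro u v q ⟨hu, hv, h1⟩ ⟨-, hq, h2⟩
    refine ⟨hu, hq, ?_⟩
    rcases h1 with ⟨h1, h1'⟩ | ⟨h1, h1'⟩ <;> rcases h2 with ⟨h2, h2'⟩ | ⟨h2, h2'⟩
    · exact Or.inl ⟨h1.trans h2, ((hrep u hu).trans (hP hu h1 h1') ⟨h1, h1.trans h2, h2'⟩).2.2⟩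
    · exact Or.inr ⟨fun h => h2 (h1.symm.trans h), h2'.congr_left h1.symm (hB q hq)⟩
    · exact Or.inr ⟨fun h => h1 (h.trans h2.symm),
        h1'.congr_right (hB u hu) h2 fun w hw => hup hv h2 h2' hw⟩
    -- Two components each below the other would both win the tie-break by smallest vertices.
    · refine Or.inr ⟨fun h => ?_, h1'.trans (hB v hv) (hB q hq) h2'⟩
      have m1 := h1'.2.1.resolve_left (not_not.2 (h2'.1.congr (hr hv) h.symm))
      have m2 := h2'.2.1.resolve_left (not_not.2 (h1'.1.congr h (hr hv)))
      exact m1.asymm (m2.congr (hr hv) h.symm)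
  · refine ⟨fun u => ?_⟩
    by_cases hu : u ∈ H
    · have := (hrep u hu).wf.apply u
      have key : ∀ v, Acc (fun y x => restr (comp G B u) a x y) v → Conn G B u v →
          Acc (fun y x => nestAdj G B H a x y) v := by
        intro v hv
        induction hv with
        | intro v _ ih =>
          refine fun huv => ⟨v, fun q hq => ?_⟩
          have huq := huv.trans hq.2.2.1
          exact ih q ⟨huv, huq, hq.2.2.2⟩ huq
      exact key u this (hr hu)
    · exact ⟨u, fun q hq => absurd hq.1 hu⟩
  · rintro u v q ⟨hu, hv, h1⟩ ⟨-, hq, h2⟩ hne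
    by_cases hvq : Conn G B v q
    · rcases h1 with ⟨h1, h1'⟩ | ⟨h1, h1'⟩ <;> rcases h2 with ⟨h2, h2'⟩ | ⟨h2, h2'⟩
      · refine ((hrep u hu).ax1 (hP hu h1 h1') (hP hu h2 h2') hne).imp (fun h => ?_) (fun h => ?_)
        · exact ⟨hv, hq, Or.inl ⟨hvq, h.2.2⟩⟩
        · exact ⟨hq, hv, Or.inl ⟨hvq.symm, h.2.2⟩⟩
      · exact absurd (h1.trans hvq) h2
      · exact absurd (h2.trans hvq.symm) h1
      · obtain ⟨w, hw⟩ := h1'.2.2.1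
        refine ((hrep v hv).probe_chain (w := w) (fun h => h.right hw.1) (hr hv) hvq
          (h1'.2.2.2 w hw) (h2'.2.2.2 w hw) hne).imp (fun h => ?_) (fun h => ?_)
        · exact ⟨hv, hq, Or.inl ⟨hvq, h.2.2⟩⟩
        · exact ⟨hq, hv, Or.inl ⟨hvq.symm, h.2.2⟩⟩
    · have hqv : ¬ Conn G B q v := fun h => hvq h.symm
      rcases h1 with ⟨h1, h1'⟩ | ⟨h1, h1'⟩ <;> rcases h2 with ⟨h2, h2'⟩ | ⟨h2, h2'⟩
      · exact absurd (h1.symm.trans h2) hvq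
      · exact Or.inl ⟨hv, hq, Or.inr ⟨hvq, h2'.congr_left h1 (hB q hq)⟩⟩
      · exact Or.inr ⟨hq, hv, Or.inr ⟨hqv, h1'.congr_left h2 (hB v hv)⟩⟩
      · obtain ⟨w, hw⟩ := h1'.2.2.1
        refine (below_or_below (hB v hv) (hB q hq) hvq (hc v hv q hq hvq) hw.1 (h1'.2.2.2 w hw)
          (h2'.2.2.2 w hw)).imp (fun h => ?_) (fun h => ?_)
        · exact ⟨hv, hq, Or.inr ⟨hvq, h⟩⟩
        · exact ⟨hq, hv, Or.inr ⟨hqv, h⟩⟩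
  · rintro u v q ⟨hu, hv, h1, h1'⟩ ⟨-, hq, h2, h2'⟩ hne
    refine ((hrep u hu).ax2 ⟨hr hu, h1, h1'⟩ ⟨hr hu, h2, h2'⟩ hne).imp (fun h => ?_) (fun h => ?_)
    · exact ⟨hv, hq, Or.inl ⟨h1.symm.trans h2, h.2.2⟩⟩
    · exact ⟨hq, hv, Or.inl ⟨h2.symm.trans h1, h.2.2⟩⟩
  · rintro u v q ⟨hu, hv, h1, h1'⟩ ⟨-, hq, ⟨h2, h2'⟩ | ⟨h2, h2'⟩⟩
    · exact ⟨hv, hq, Or.inl ⟨h1.symm.trans h2,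
        ((hrep u hu).ax3 ⟨hr hu, h1, h1'⟩ (hP hu h2 h2')).2.2⟩⟩
    · exact ⟨hv, hq, Or.inr ⟨fun h => h2 (h1.trans h), h2'.congr_left h1 (hB q hq)⟩⟩
  · rintro u v q ⟨hu, hv, h1, h1'⟩ ⟨-, hq, ⟨h2, h2'⟩ | ⟨h2, h2'⟩⟩
    · have h3 := h1.trans h2
      refine ((hrep u hu).ax4 ⟨hr hu, h1, h1'⟩ ⟨h1, h3, h2'⟩).imp (fun h => ?_) (fun h => ?_)
      · exact ⟨hu, hq, h3, h.2.2⟩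
      · exact ⟨hu, hq, Or.inl ⟨h3, h.2.2⟩⟩
    · exact Or.inr ⟨hu, hq, Or.inr ⟨fun h => h2 (h1.symm.trans h),
        h2'.congr_left h1.symm (hB q hq)⟩⟩
  · intro u v hu hv
    constructor
    · intro h
      have h1 : Conn G B u v := .adj h (hB u hu) (hB v hv)
      refine (((hrep u hu).graph (hr hu) h1).1 h).imp (fun h => ?_) (fun h => ?_)
      · exact ⟨hu, hv, h1, h.2.2⟩
      · exact ⟨hv, hu, h1.symm, h.2.2⟩
    · rintro (⟨-, -, h1, h2⟩ | ⟨-, -, h1, h2⟩)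
      · exact ((hrep u hu).graph (hr hu) h1).2 (Or.inl ⟨hr hu, h1, h2⟩)
      · exact (((hrep v hv).graph (hr hv) h1).2 (Or.inl ⟨hr hv, h1, h2⟩)).symm
  · intro w u v hw hu hv hwu hwv hne
    have hwB := hwH hu hw hwu
    by_cases huv : Conn G B u v
    · refine ((hrep u hu).probe_chain (fun h => h.right hwB) (hr hu) huv hwu hwv hne).imp
        (fun h => ?_) (fun h => ?_)
      · exact ⟨hu, hv, Or.inl ⟨huv, h.2.2⟩⟩
      · exact ⟨hv, hu, Or.inl ⟨huv.symm, h.2.2⟩⟩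
    · refine (below_or_below (hB u hu) (hB v hv) huv (hc u hu v hv huv) hwB hwu hwv).imp
        (fun h => ?_) (fun h => ?_)
      · exact ⟨hu, hv, Or.inr ⟨huv, h⟩⟩
      · exact ⟨hv, hu, Or.inr ⟨fun h => huv h.symm, h⟩⟩
  · rintro w u v hw hwu ⟨hu, hv, ⟨h, h'⟩ | ⟨h, h'⟩⟩
    · exact hup hu h h' (hwH hu hw hwu) hwu
    · exact h'.2.2.2 w ⟨hwH hu hw hwu, u, hr hu, hwu⟩

end Nest
end Recognition

namespace Recognition

/-! ### Trees of maximal elements -/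

section Tree

variable {V : Type*} (G : SimpleGraph V)

/-- The closed neighbourhood of `x`. -/
def nb (x : V) : Set V := {v | v = x ∨ G.Adj x v}

/-- The pairs (parent, child) in the tree of maximal elements that is grown from `r`: a neighbour
of a child is a new child unless it can be put below the parent, as decided by `T`. -/
inductive Mk (C : Set V) (r : V) (T : V → V → Prop) : V → V → Prop
  | base {z : V} (hz : z ∈ C) (h : G.Adj r z) : Mk C r T r z
  | step {x y z : V} (hxy : Mk C r T x y) (hz : z ∈ C) (h : G.Adj y z) (hzx : z ≠ x)
      (hT : ¬ T x z) : Mk C r T y z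

/-- The vertices of the tree grown from `r`. -/
def Rt (C : Set V) (r : V) (T : V → V → Prop) (y : V) : Prop := y = r ∨ ∃ x, Mk G C r T x y

/-- `u` is put below `x`. -/
def Cap (C : Set V) (r : V) (T : V → V → Prop) (x u : V) : Prop :=
  T x u ∧ ∃ y k, Mk G C r T x y ∧ Conn G (nb G x) u k ∧ G.Adj y k

/-- The tree grown from `r` gives rise to a representation. -/
structure Valid (C : Set V) (r : V) (T : V → V → Prop) : Prop where
  parent_unique : ∀ x x' y, Mk G C r T x y → Mk G C r T x' y → x = x'
  no_parent : ∀ x, ¬ Mk G C r T x r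
  edge : ∀ y y', Rt G C r T y → Rt G C r T y' → G.Adj y y' → Mk G C r T y y' ∨ Mk G C r T y' y
  cap_not_rt : ∀ x u, Cap G C r T x u → ¬ Rt G C r T u
  attach : ∀ x u y, Cap G C r T x u → Rt G C r T y → G.Adj y u → Mk G C r T x y
  closed : ∀ x u w, Cap G C r T x u → w ∈ C → ¬ Rt G C r T w → G.Adj w u → w ∉ nb G x
  probe : ∀ w x x', w ∉ C → Rt G C r T x → Rt G C r T x' → G.Adj w x → G.Adj w x' → x = x'
  cst : ∀ x u v, Cap G C r T x u → Cap G C r T x v → ¬ Conn G (nb G x) u v →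
    Cst G (nb G x) u v ∨ Cst G (nb G x) v u

/-- The order obtained from a tree and orders of the components that are put below its vertices. -/
def treePrec [LinearOrder V] (C : Set V) (r : V) (T : V → V → Prop) (p : V → V → V → Prop)
    (u v : V) : Prop :=
  Cap G C r T v u ∨ ∃ x, nestPrec G (nb G x) {z | Cap G C r T x z} (p x) u v

/-- The orientation obtained from a tree and orientations of the components that are put below its
vertices. -/
def treeAdj (C : Set V) (r : V) (T : V → V → Prop) (a : V → V → V → Prop) (u v : V) : Prop :=
  G.Adj u v ∧ (Mk G C r T v u ∨ (Rt G C r T u ∧ v ∈ C ∧ ¬ Rt G C r T v) ∨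
    ∃ x, nestAdj G (nb G x) {z | Cap G C r T x z} (a x) u v)

variable {G} {C : Set V} {r : V} {T : V → V → Prop}

theorem self_mem_nb (x : V) : x ∈ nb G x := Or.inl rfl

theorem adj_of_mem_nb {x w u : V} (hw : w ∈ nb G x) (hu : u ∉ nb G x) (h : G.Adj w u) :
    G.Adj w x := by
  rcases hw with rfl | hw
  · exact absurd (Or.inr h) hu
  · exact hw.symm

theorem Mk.left {x y : V} (h : Mk G C r T x y) : Rt G C r T x := by
  cases h with
  | base _ _ => exact Or.inl rfl
  | step h _ _ _ _ => exact Or.inr ⟨_, h⟩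

theorem Mk.right {x y : V} (h : Mk G C r T x y) : Rt G C r T y := Or.inr ⟨_, h⟩

theorem Mk.mem {x y : V} (h : Mk G C r T x y) : y ∈ C := by
  cases h <;> assumption

theorem Mk.adj {x y : V} (h : Mk G C r T x y) : G.Adj x y := by
  cases h <;> assumption

theorem Rt.mem (hr : r ∈ C) {y : V} (h : Rt G C r T y) : y ∈ C := by
  rcases h with rfl | ⟨x, h⟩
  · exact hr
  · exact h.mem

theorem Cap.congr (hT : ∀ x u v, Conn G (nb G x) u v → T x u → T x v) {x u v : V}
    (h : Cap G C r T x u) (huv : Conn G (nb G x) u v) : Cap G C r T x v := by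
  obtain ⟨h1, y, k, h2, h3, h4⟩ := h
  exact ⟨hT x u v huv h1, y, k, h2, huv.symm.trans h3, h4⟩

/-- Being put below `x` is a property of whole components of `G - N[x]`, which can only be left
through neighbours of `x`. -/
theorem Cap.adj_of_not_cap (hT : ∀ x u v, Conn G (nb G x) u v → T x u → T x v)
    (hTn : ∀ x u, T x u → u ∉ nb G x) {x u w : V} (h : Cap G C r T x u) (hwu : G.Adj w u)
    (hw : ¬ Cap G C r T x w) : G.Adj w x := by
  have hu := hTn x u h.1
  by_cases hwx : w ∈ nb G x
  · exact adj_of_mem_nb hwx hu hwu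
  · exact absurd (h.congr hT (.adj hwu.symm hu hwx)) hw

/-- Every vertex of `C` is in the tree or is put below a vertex of the tree. -/
theorem rt_or_cap (hT : ∀ x u v, Conn G (nb G x) u v → T x u → T x v)
    (hTn : ∀ x u, T x u → u ∉ nb G x) (hr : r ∈ C)
    (hconn : ∀ p : V → Prop, p r → (∀ a ∈ C, ∀ b ∈ C, p a → G.Adj a b → p b) → ∀ u ∈ C, p u) :
    ∀ u ∈ C, Rt G C r T u ∨ ∃ x, Cap G C r T x u := by
  have key : ∀ y, Rt G C r T y → ∀ v ∈ C, G.Adj y v → Rt G C r T v ∨ ∃ x, Cap G C r T x v := by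
    rintro y (rfl | ⟨x, hxy⟩) v hv hyv
    · exact Or.inl (Mk.base hv hyv).right
    · by_cases hvx : v = x
      · exact Or.inl (hvx ▸ hxy.left)
      · by_cases hTv : T x v
        · exact Or.inr ⟨x, hTv, y, v, hxy, .refl (hTn x v hTv), hyv⟩
        · exact Or.inl (Mk.step hxy hv hyv hvx hTv).right
  refine hconn _ (Or.inl (Or.inl rfl)) ?_
  rintro a ha b hb (h | ⟨x, h⟩) hab
  · exact key a h b hb hab
  · by_cases hbx : Cap G C r T x b
    · exact Or.inr ⟨x, hbx⟩
    · obtain ⟨-, y, k, hxy, -, -⟩ := id h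
      exact key x hxy.left b hb (h.adj_of_not_cap hT hTn hab.symm hbx).symm

/-- By `closed`, a walk inside the component in `G - N[x]` also avoids `N[x']`. Its end is adjacent
to a child of `x`, which by `attach` is also a child of `x'`. -/
theorem Valid.cap_unique (hV : Valid G C r T)
    (hT : ∀ x u v, Conn G (nb G x) u v → T x u → T x v)
    (hTC : ∀ x u, T x u → comp G (nb G x) u ⊆ C) (hTn : ∀ x u, T x u → u ∉ nb G x) {x x' u : V}
    (h : Cap G C r T x u) (h' : Cap G C r T x' u) : x = x' := by
  obtain ⟨hTu, y, k, hxy, huk, hyk⟩ := id h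
  have h1 : Conn G (nb G x') u k := by
    refine huk.induct (p := fun a => Conn G (nb G x') u a) (.refl (hTn x' u h'.1)) ?_
    intro a b ha hb ha' hab
    exact ha'.tail hab (hV.closed x' a b (h'.congr hT ha') (hTC x u hTu hb)
      (hV.cap_not_rt x b (h.congr hT hb)) hab.symm)
  exact hV.parent_unique x x' y hxy (hV.attach x' k y (h'.congr hT h1) hxy.right hyk)

/-- A valid tree gives rise to a representation. -/
theorem Valid.isRep [Finite V] [LinearOrder V] (hV : Valid G C r T) (hr : r ∈ C)
    (hconn : ∀ p : V → Prop, p r → (∀ a ∈ C, ∀ b ∈ C, p a → G.Adj a b → p b) → ∀ u ∈ C, p u)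
    (hT : ∀ x u v, Conn G (nb G x) u v → T x u → T x v)
    (hTC : ∀ x u, T x u → comp G (nb G x) u ⊆ C) (hTn : ∀ x u, T x u → u ∉ nb G x)
    {p a : V → V → V → Prop}
    (hrep : ∀ x u, T x u → IsRep G (comp G (nb G x) u) (restr (comp G (nb G x) u) (p x))
      (restr (comp G (nb G x) u) (a x))) :
    IsRep G C (treePrec G C r T p) (treeAdj G C r T a) := by
  have hN : ∀ x, IsRep G {z | Cap G C r T x z} (nestPrec G (nb G x) {z | Cap G C r T x z} (p x))
      (nestAdj G (nb G x) {z | Cap G C r T x z} (a x)) := fun x =>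
    isRep_nest (fun u hu => hTn x u hu.1) (fun u hu v huv => Cap.congr hT hu huv)
      (fun u hu => hrep x u hu.1) (fun u hu v hv => hV.cst x u v hu hv)
  have hcap : ∀ {x u}, Cap G C r T x u → u ∈ C := fun {x u} h =>
    hTC x u h.1 (.refl (hTn x u h.1))
  have hcr : ∀ {x u}, Cap G C r T x u → ¬ Rt G C r T u := fun {x u} h => hV.cap_not_rt x u h
  have huniq : ∀ {x x' u}, Cap G C r T x u → Cap G C r T x' u → x = x' := fun h h' =>
    hV.cap_unique hT hTC hTn h h'
  have hcov := rt_or_cap hT hTn hr hconn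
  have hcl : ∀ {x}, (∃ u, Cap G C r T x u) → Rt G C r T x := by
    rintro x ⟨u, -, y, k, h, -⟩
    exact h.left
  have hprec : ∀ {u v}, treePrec G C r T p u v → ∃ x, Cap G C r T x u ∧
      (v = x ∨ (Cap G C r T x v ∧ nestPrec G (nb G x) {z | Cap G C r T x z} (p x) u v)) := by
    rintro u v (h | ⟨x, h⟩)
    · exact ⟨v, h, Or.inl rfl⟩
    · exact ⟨x, h.1, Or.inr ⟨h.2.1, h⟩⟩
  have hadj : ∀ {u v}, treeAdj G C r T a u v → Mk G C r T v u ∨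
      (Rt G C r T u ∧ ∃ x, Cap G C r T x v ∧ Mk G C r T x u ∧ G.Adj u v) ∨
      (∃ x, Cap G C r T x u ∧ Cap G C r T x v ∧
        nestAdj G (nb G x) {z | Cap G C r T x z} (a x) u v) := by
    rintro u v ⟨huv, h | ⟨h1, h2, h3⟩ | ⟨x, h⟩⟩
    · exact Or.inl h
    -- By `attach`, a tree vertex that sees something put below `x` is a child of `x`.
    · obtain ⟨x, hx⟩ := (hcov v h2).resolve_left h3
      exact Or.inr (Or.inl ⟨h1, x, hx, hV.attach x v u hx h1 huv, huv⟩)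
    · exact Or.inr (Or.inr ⟨x, h.1, h.2.1, h⟩)
  have hout : ∀ {x u w}, Cap G C r T x u → G.Adj w u → ¬ Cap G C r T x w → G.Adj w x :=
    fun h1 h2 h3 => h1.adj_of_not_cap hT hTn h2 h3
  have hsame : ∀ {u v}, u ∈ C → v ∈ C → ¬ Rt G C r T u → ¬ Rt G C r T v → G.Adj u v →
      ∃ x, Cap G C r T x u ∧ Cap G C r T x v := by
    intro u v hu hv hu' hv' huv
    obtain ⟨x, hx⟩ := (hcov u hu).resolve_left hu'
    exact ⟨x, hx, hx.congr hT (.adj huv (hTn x u hx.1)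
      (hV.closed x u v hx hv hv' huv.symm))⟩
  constructor
  · rintro u v (h | ⟨x, h⟩)
    · exact ⟨hcap h, (hcl ⟨u, h⟩).mem hr⟩
    · exact ⟨hcap h.1, hcap h.2.1⟩
  · intro u v h
    rcases hadj h with h | ⟨h1, x, h2, h3, -⟩ | ⟨x, h1, h2, -⟩
    · exact ⟨h.mem, h.left.mem hr⟩
    · exact ⟨h3.mem, hcap h2⟩
    · exact ⟨hcap h1, hcap h2⟩
  · intro u h
    obtain ⟨x, h1, rfl | ⟨-, h2⟩⟩ := hprec h
    · exact hcr h1 (hcl ⟨_, h1⟩)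
    · exact (hN x).irrefl u h2
  · intro u v q h h'
    obtain ⟨x, h1, h2⟩ := hprec h
    obtain ⟨x', h3, h4⟩ := hprec h'
    rcases h2 with rfl | ⟨h2, h5⟩
    · exact absurd (hcl ⟨_, h1⟩) (hcr h3)
    · obtain rfl := huniq h2 h3
      rcases h4 with rfl | ⟨-, h4⟩
      · exact Or.inl h1
      · exact Or.inr ⟨x, (hN x).trans h5 h4⟩
  -- Outside the tree a path stays below a single `x`, where the orientation is well-founded. A tree
  -- vertex points only to its parent and out of the tree, so accessibility propagates from the root
  -- along the growth.
  · have hacc : ∀ v, ¬ Rt G C r T v → Acc (fun y x => treeAdj G C r T a x y) v := by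
      intro v hv
      by_cases hvx : ∃ x, Cap G C r T x v
      · obtain ⟨x, hx⟩ := hvx
        have := (hN x).wf.apply v
        induction this with
        | intro v _ ih =>
          refine ⟨v, fun q hq => ?_⟩
          rcases hadj hq with h | ⟨h1, -⟩ | ⟨x', h1, h2, h3⟩
          · exact absurd h.right hv
          · exact absurd h1 hv
          · obtain rfl := huniq hx h1
            exact ih q h3 (hcr h2) h2
      · refine ⟨v, fun q hq => ?_⟩
        rcases hadj hq with h | ⟨h1, -⟩ | ⟨x', h1, h2, h3⟩
        · exact absurd h.right hv
        · exact absurd h1 hv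
        · exact absurd ⟨x', h1⟩ hvx
    have hstep : ∀ v, Rt G C r T v → (∀ x, Mk G C r T x v →
        Acc (fun y x => treeAdj G C r T a x y) x) →
        Acc (fun y x => treeAdj G C r T a x y) v := by
      intro v hv hx
      refine ⟨v, fun q hq => ?_⟩
      rcases hadj hq with h | ⟨-, x', h2, -⟩ | ⟨x', h1, h2, h3⟩
      · exact hx q h
      · exact hacc q (hcr h2)
      · exact hacc q (hcr h2)
    have hroot : Acc (fun y x => treeAdj G C r T a x y) r :=
      hstep r (Or.inl rfl) fun x hx => absurd hx (hV.no_parent x)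
    have hmk : ∀ x y, Mk G C r T x y → Acc (fun y x => treeAdj G C r T a x y) y := by
      intro x y h
      induction h with
      | base hz h =>
        refine hstep _ (Mk.base hz h).right fun x' hx' => ?_
        rwa [hV.parent_unique _ _ _ hx' (Mk.base hz h)]
      | step hxy hz h hzx hTz ih =>
        have h1 := Mk.step hxy hz h hzx hTz
        refine hstep _ h1.right fun x' hx' => ?_
        rwa [hV.parent_unique _ _ _ hx' h1]
    refine ⟨fun v => ?_⟩
    by_cases hv : Rt G C r T v
    · rcases hv with rfl | ⟨x, hx⟩
      · exact hroot
      · exact hmk x v hx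
    · exact hacc v hv
  · intro u v q h h' hne
    obtain ⟨x, h1, h2⟩ := hprec h
    obtain ⟨x', h3, h4⟩ := hprec h'
    obtain rfl := huniq h1 h3
    rcases h2 with rfl | ⟨h2, h5⟩ <;> rcases h4 with rfl | ⟨h4, h6⟩
    · exact absurd rfl hne
    · exact Or.inr (Or.inl h4)
    · exact Or.inl (Or.inl h2)
    · exact ((hN x).ax1 h5 h6 hne).imp (fun h => Or.inr ⟨x, h⟩) (fun h => Or.inr ⟨x, h⟩)
  · intro u v q h h' hne
    rcases hadj h with h1 | ⟨h1, x, h2, h3, h4⟩ | ⟨x, h1, h2, h3⟩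
    · rcases hadj h' with k1 | ⟨k1, x', k2, k3, k4⟩ | ⟨x', k1, k2, k3⟩
      · exact absurd (hV.parent_unique _ _ _ h1 k1) hne
      · obtain rfl := hV.parent_unique _ _ _ h1 k3
        exact Or.inr (Or.inl k2)
      · exact absurd h1.right (hcr k1)
    · rcases hadj h' with k1 | ⟨k1, x', k2, k3, k4⟩ | ⟨x', k1, k2, k3⟩
      · obtain rfl := hV.parent_unique _ _ _ h3 k1
        exact Or.inl (Or.inl h2)
      · obtain rfl := hV.parent_unique _ _ _ h3 k3
        -- The child `u` of `x` is not itself below `x`, so it acts as an outside vertex and sees a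
        -- chain there.
        exact ((hN x).probe_chain (fun h => hcr h h1) h2 k2 h4 k4 hne).imp
          (fun h => Or.inr ⟨x, h⟩) (fun h => Or.inr ⟨x, h⟩)
      · exact absurd h1 (hcr k1)
    · rcases hadj h' with k1 | ⟨k1, x', k2, k3, k4⟩ | ⟨x', k1, k2, k3⟩
      · exact absurd k1.right (hcr h1)
      · exact absurd k1 (hcr h1)
      · obtain rfl := huniq h1 k1
        exact ((hN x).ax2 h3 k3 hne).imp (fun h => Or.inr ⟨x, h⟩) (fun h => Or.inr ⟨x, h⟩)
  · intro u v q h h'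
    obtain ⟨x', k1, k2⟩ := hprec h'
    rcases hadj h with h1 | ⟨h1, x, h2, h3, h4⟩ | ⟨x, h1, h2, h3⟩
    · exact absurd h1.right (hcr k1)
    · exact absurd h1 (hcr k1)
    · obtain rfl := huniq h1 k1
      rcases k2 with rfl | ⟨-, k2⟩
      · exact Or.inl h2
      · exact Or.inr ⟨x, (hN x).ax3 h3 k2⟩
  · intro u v q h h'
    obtain ⟨x', k1, k2⟩ := hprec h'
    rcases hadj h with h1 | ⟨h1, x, h2, h3, h4⟩ | ⟨x, h1, h2, h3⟩
    · exact absurd h1.left (hcr k1)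
    · obtain rfl := huniq h2 k1
      left
      rcases k2 with rfl | ⟨k2, k3⟩
      · exact ⟨h3.adj.symm, Or.inl h3⟩
      · exact ⟨(hN x).probe_up (fun h => hcr h h1) h4 k3, Or.inr (Or.inl ⟨h1, hcap k2, hcr k2⟩)⟩
    · obtain rfl := huniq h2 k1
      rcases k2 with rfl | ⟨-, k2⟩
      · exact Or.inr (Or.inl h1)
      · refine ((hN x).ax4 h3 k2).imp (fun h => ?_) (fun h => Or.inr ⟨x, h⟩)
        exact ⟨((hN x).graph h.1 h.2.1).2 (Or.inl h), Or.inr (Or.inr ⟨x, h⟩)⟩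
  · intro u v hu hv
    refine ⟨fun h => ?_, fun h => h.elim (fun h => h.1) (fun h => h.1.symm)⟩
    by_cases hu' : Rt G C r T u <;> by_cases hv' : Rt G C r T v
    · rcases hV.edge u v hu' hv' h with h1 | h1
      · exact Or.inr ⟨h.symm, Or.inl h1⟩
      · exact Or.inl ⟨h, Or.inl h1⟩
    · exact Or.inl ⟨h, Or.inr (Or.inl ⟨hu', hv, hv'⟩)⟩
    · exact Or.inr ⟨h.symm, Or.inr (Or.inl ⟨hv', hu, hu'⟩)⟩
    · obtain ⟨x, hxu, hxv⟩ := hsame hu hv hu' hv' h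
      refine (((hN x).graph hxu hxv).1 h).imp (fun h1 => ?_) (fun h1 => ?_)
      · exact ⟨h, Or.inr (Or.inr ⟨x, h1⟩)⟩
      · exact ⟨h.symm, Or.inr (Or.inr ⟨x, h1⟩)⟩
  · intro w u v hw hu hv hwu hwv hne
    have hwx : ∀ x, ¬ Cap G C r T x w := fun x h => hw (hcap h)
    -- An outside vertex that sees something below `x` also sees `x`, and it sees at most one tree
    -- vertex. So all its neighbours in `C` are at or below the same `x`.
    rcases hcov u hu with hu' | ⟨x, hx⟩ <;> rcases hcov v hv with hv' | ⟨x', hx'⟩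
    · exact absurd (hV.probe w u v hw hu' hv' hwu hwv) hne
    · obtain rfl := hV.probe w u x' hw hu' (hcl ⟨v, hx'⟩) hwu (hout hx' hwv (hwx x'))
      exact Or.inr (Or.inl hx')
    · obtain rfl := hV.probe w x v hw (hcl ⟨u, hx⟩) hv' (hout hx hwu (hwx x)) hwv
      exact Or.inl (Or.inl hx)
    · obtain rfl := hV.probe w x x' hw (hcl ⟨u, hx⟩) (hcl ⟨v, hx'⟩) (hout hx hwu (hwx x))
        (hout hx' hwv (hwx x'))
      exact ((hN x).probe_chain (hwx x) hx hx' hwu hwv hne).imp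
        (fun h => Or.inr ⟨x, h⟩) (fun h => Or.inr ⟨x, h⟩)
  · intro w u v hw hwu h
    have hwx : ∀ x, ¬ Cap G C r T x w := fun x h => hw (hcap h)
    obtain ⟨x, h1, rfl | ⟨-, h2⟩⟩ := hprec h
    · exact hout h1 hwu (hwx _)
    · exact (hN x).probe_up (hwx x) hwu h2

end Tree
end Recognition

namespace Recognition

/-! ### Trees of maximal elements of a representation -/

variable {V : Type*} {G : SimpleGraph V} {C : Set V} {prec adj : V → V → Prop}

namespace IsRep

theorem restrict (h : IsRep G C prec adj) {K : Set V} (hK : K ⊆ C)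
    (hc : ∀ w x y, w ∉ K → x ∈ K → y ∈ K → G.Adj w x → G.Adj w y → x ≠ y → prec x y ∨ prec y x)
    (hu : ∀ w x y, w ∉ K → x ∈ K → y ∈ K → G.Adj w x → prec x y → G.Adj w y) :
    IsRep G K (restr K prec) (restr K adj) where
  prec_mem h := ⟨h.1, h.2.1⟩
  adj_mem h := ⟨h.1, h.2.1⟩
  irrefl _ h' := h.irrefl _ h'.2.2
  trans h1 h2 := ⟨h1.1, h2.2.1, h.trans h1.2.2 h2.2.2⟩
  wf := Subrelation.wf (fun h' => h'.2.2) h.wf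
  ax1 h1 h2 hne := (h.ax1 h1.2.2 h2.2.2 hne).imp (fun h' => ⟨h1.2.1, h2.2.1, h'⟩)
    (fun h' => ⟨h2.2.1, h1.2.1, h'⟩)
  ax2 h1 h2 hne := (h.ax2 h1.2.2 h2.2.2 hne).imp (fun h' => ⟨h1.2.1, h2.2.1, h'⟩)
    (fun h' => ⟨h2.2.1, h1.2.1, h'⟩)
  ax3 h1 h2 := ⟨h1.2.1, h2.2.1, h.ax3 h1.2.2 h2.2.2⟩
  ax4 h1 h2 := (h.ax4 h1.2.2 h2.2.2).imp (fun h' => ⟨h1.1, h2.2.1, h'⟩)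
    (fun h' => ⟨h1.1, h2.2.1, h'⟩)
  graph hx hy := (h.graph (hK hx) (hK hy)).trans
    (or_congr ⟨fun h' => ⟨hx, hy, h'⟩, fun h' => h'.2.2⟩
      ⟨fun h' => ⟨hy, hx, h'⟩, fun h' => h'.2.2⟩)
  probe_chain hw hx hy h1 h2 hne := (hc _ _ _ hw hx hy h1 h2 hne).imp
    (fun h' => ⟨hx, hy, h'⟩) (fun h' => ⟨hy, hx, h'⟩)
  probe_up hw h1 h2 := hu _ _ _ hw h2.1 h2.2.1 h1 h2.2.2

theorem not_transGen (h : IsRep G C prec adj) (x : V) : ¬ Relation.TransGen adj x x := by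
  have key : ∀ y, Relation.TransGen adj x y → Relation.TransGen (fun y x => adj x y) y x := by
    intro y hy
    exact Relation.transGen_swap.2 hy
  intro hx
  exact h.wf.transGen.irrefl.irrefl x (key x hx)

theorem adj_irrefl (h : IsRep G C prec adj) (x : V) : ¬ adj x x :=
  fun h' => h.not_transGen x (.single h')

theorem adj_asymm (h : IsRep G C prec adj) {x y : V} (h1 : adj x y) (h2 : adj y x) : False :=
  h.not_transGen x (.tail (.single h1) h2)

theorem adj_of_adj (h : IsRep G C prec adj) {x y : V} (h' : adj x y) : G.Adj x y :=
  (h.graph (h.adj_mem h').1 (h.adj_mem h').2).2 (Or.inl h')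

/-- An edge from the smaller to the larger element gives `prec y y` by axiom 3; the reverse edge
gives a loop of either relation by axiom 4. -/
theorem not_adj_of_prec (h : IsRep G C prec adj) {x y : V} (h' : prec x y) : ¬ G.Adj x y := by
  rw [h.graph (h.prec_mem h').1 (h.prec_mem h').2]
  rintro (h1 | h1)
  · exact h.irrefl _ (h.ax3 h1 h')
  · exact (h.ax4 h1 h').elim (h.adj_irrefl _) (h.irrefl _)

theorem not_mem_nb (h : IsRep G C prec adj) {x z : V} (h' : prec z x) : z ∉ nb G x := by
  rintro (rfl | h1)
  · exact h.irrefl _ h'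
  · exact h.not_adj_of_prec h' h1.symm

/-- Axiom 3 handles edges out of `u`, axiom 4 edges into `u`, and `probe_up` neighbours outside `C`:
in the last two cases the only alternative is adjacency to `x`. -/
theorem prec_of_adj (h : IsRep G C prec adj) {x u v : V} (h' : prec u x) (huv : G.Adj u v)
    (hv : v ∉ nb G x) : prec v x := by
  by_cases hvC : v ∈ C
  · rcases (h.graph (h.prec_mem h').1 hvC).1 huv with h1 | h1
    · exact h.ax3 h1 h'
    · exact (h.ax4 h1 h').resolve_left fun h2 => hv (Or.inr (h.adj_of_adj h2).symm)
  · exact absurd (Or.inr (h.probe_up hvC huv.symm h').symm) hv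

theorem prec_of_conn (h : IsRep G C prec adj) {x u v : V} (h' : prec u x)
    (huv : Conn G (nb G x) u v) : prec v x :=
  huv.induct (p := fun a => prec a x) h' fun _ _ _ hb ha hab => h.prec_of_adj ha hab hb.right

/-- The reverse orientation would put `w` below `x` by axiom 3, but nothing below `x` is in `N[x]`.
Hence vertices of `N[x]` see upward closed chains below `x`, just as outside vertices do. -/
theorem low_adj (h : IsRep G C prec adj) {x u w : V} (hw : w ∈ nb G x) (h' : prec u x)
    (hwu : G.Adj w u) (hwC : w ∈ C) : adj w u :=
  ((h.graph hwC (h.prec_mem h').1).1 hwu).resolve_right fun h1 => h.not_mem_nb (h.ax3 h1 h') hw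

theorem low_chain (h : IsRep G C prec adj) {x u v w : V} (hw : w ∈ nb G x) (hu : prec u x)
    (hv : prec v x) (hwu : G.Adj w u) (hwv : G.Adj w v) (hne : u ≠ v) : prec u v ∨ prec v u := by
  by_cases hwC : w ∈ C
  · exact h.ax2 (h.low_adj hw hu hwu hwC) (h.low_adj hw hv hwv hwC) hne
  · exact h.probe_chain hwC (h.prec_mem hu).1 (h.prec_mem hv).1 hwu hwv hne

theorem low_up (h : IsRep G C prec adj) {x u v w : V} (hw : w ∈ nb G x) (hu : prec u x)
    (hv : prec v x) (hwu : G.Adj w u) (huv : prec u v) : G.Adj w v := by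
  by_cases hwC : w ∈ C
  · exact h.adj_of_adj ((h.ax4 (h.low_adj hw hu hwu hwC) huv).resolve_right fun h1 =>
      h.not_mem_nb (h.trans h1 hv) hw)
  · exact h.probe_up hwC hwu huv

/-- A component of `G` minus the closed neighbourhood of `x` that lies below `x`. -/
theorem isRep_comp (h : IsRep G C prec adj) {x z : V} (hz : prec z x) :
    IsRep G (comp G (nb G x) z) (restr (comp G (nb G x) z) prec)
      (restr (comp G (nb G x) z) adj) := by
  have hlow : ∀ v ∈ comp G (nb G x) z, prec v x := fun v hv => h.prec_of_conn hz hv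
  have hnb : ∀ w v, w ∉ comp G (nb G x) z → v ∈ comp G (nb G x) z → G.Adj w v → w ∈ nb G x := by
    intro w v hw hv hwv
    by_contra hwx
    exact hw (hv.tail hwv.symm hwx)
  refine h.restrict (fun v hv => (h.prec_mem (hlow v hv)).1) ?_ ?_
  · intro w u v hw hu hv hwu hwv hne
    exact h.low_chain (hnb w u hw hu hwu) (hlow u hu) (hlow v hv) hwu hwv hne
  · intro w u v hw hu hv hwu huv
    exact h.low_up (hnb w u hw hu hwu) (hlow u hu) (hlow v hv) hwu huv

end IsRep

/-- `u` is a maximal element of `C`. -/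
def Root (C : Set V) (prec : V → V → Prop) (u : V) : Prop := u ∈ C ∧ ∀ v, ¬ prec u v

/-- `u` lies below or at a maximal element from which `y` can be reached along maximal elements. -/
def Reach (C : Set V) (prec adj : V → V → Prop) (y u : V) : Prop :=
  ∃ q, Root C prec q ∧ (u = q ∨ prec u q) ∧
    Relation.ReflTransGen (fun a b => Root C prec b ∧ adj a b) q y

namespace IsRep

variable {x y z u v w r : V}

theorem root_of_adj (h : IsRep G C prec adj) (hzy : adj z y) (hy : Root C prec y) :
    Root C prec z :=
  ⟨(h.adj_mem hzy).1, fun q hq => hy.2 q (h.ax3 hzy hq)⟩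

theorem root_unique (h : IsRep G C prec adj) (hv : Root C prec v) (hw : Root C prec w)
    (huv : u = v ∨ prec u v) (huw : u = w ∨ prec u w) : v = w := by
  rcases huv with rfl | huv <;> rcases huw with rfl | huw
  · rfl
  · exact absurd huw (hv.2 _)
  · exact absurd huv (hw.2 _)
  · by_contra hne
    exact (h.ax1 huv huw hne).elim (hv.2 _) (hw.2 _)

/-- Out-neighbours form a chain, and a chain has only one maximal element: this makes parents
unique. -/
theorem out_unique (h : IsRep G C prec adj) (hv : Root C prec v) (hw : Root C prec w)
    (huv : adj u v) (huw : adj u w) : v = w := by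
  by_contra hne
  exact (h.ax2 huv huw hne).elim (hv.2 _) (hw.2 _)

/-- A maximal element with no maximal out-neighbour has no out-neighbour at all: by axiom 4, an
out-neighbour could be replaced by a maximal element above it. -/
theorem exists_sink [Finite V] (h : IsRep G C prec adj) (hC : C.Nonempty) :
    ∃ r, Root C prec r ∧ ∀ v, ¬ adj r v := by
  have w1 : WellFounded fun a b => prec b a := by
    have : IsTrans V fun a b => prec b a := ⟨fun a b c h1 h2 => h.trans h2 h1⟩
    have : Std.Irrefl fun a b => prec b a := ⟨h.irrefl⟩
    exact Finite.wellFounded_of_trans_of_irrefl _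
  have hroot : ∀ u ∈ C, ∃ v, Root C prec v ∧ (u = v ∨ prec u v) := by
    intro u hu
    obtain ⟨v, hv, hv'⟩ := w1.has_min {v | v ∈ C ∧ (u = v ∨ prec u v)} ⟨u, hu, Or.inl rfl⟩
    refine ⟨v, ⟨hv.1, fun q hq => hv' q ⟨(h.prec_mem hq).2, Or.inr ?_⟩ hq⟩, hv.2⟩
    rcases hv.2 with rfl | hv2
    · exact hq
    · exact h.trans hv2 hq
  obtain ⟨u, hu⟩ := hC
  obtain ⟨v, hv, -⟩ := hroot u hu
  obtain ⟨r, hr, hr'⟩ := h.wf.has_min {v | Root C prec v} ⟨v, hv⟩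
  refine ⟨r, hr, fun v hrv => ?_⟩
  obtain ⟨q, hq, hvq⟩ := hroot v (h.adj_mem hrv).2
  rcases hvq with rfl | hvq
  · exact hr' v hq hrv
  · exact (h.ax4 hrv hvq).elim (hr' q hq) (hr.2 q)

theorem no_cycle (h : IsRep G C prec adj)
    (hxy : Relation.ReflTransGen (fun a b => Root C prec b ∧ adj a b) x y) (hyx : adj y x) :
    False :=
  h.not_transGen x (Relation.TransGen.tail' (Relation.ReflTransGen.mono (fun _ _ h => h.2) _ _ hxy) hyx)

/-- The part of `C` at and below the subtree of `y` can only be left through `y`. The out-neighbours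
of another maximal element are its parent or lie below it, its in-neighbours are maximal, and axioms
3 and 4 handle the edges at elements that are not maximal. -/
theorem reach_step (h : IsRep G C prec adj) (hu : Reach C prec adj y u) (huy : u ≠ y)
    (hv : v ∈ C) (huv : G.Adj u v) : Reach C prec adj y v := by
  obtain ⟨q, hq, rfl | huq, hqy⟩ := hu
  · rcases (h.graph hq.1 hv).1 huv with h1 | h1
    · rcases hqy.cases_head with rfl | ⟨q1, ⟨h2, h3⟩, h4⟩
      · exact absurd rfl huy
      · refine ⟨q1, h2, ?_, h4⟩
        by_contra hne
        push Not at hne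
        exact (h.ax2 h1 h3 hne.1).elim hne.2 (h2.2 _)
    · exact ⟨v, h.root_of_adj h1 hq, Or.inl rfl, hqy.head ⟨hq, h1⟩⟩
  · rcases (h.graph (h.prec_mem huq).1 hv).1 huv with h1 | h1
    · exact ⟨q, hq, Or.inr (h.ax3 h1 huq), hqy⟩
    · rcases h.ax4 h1 huq with h2 | h2
      · exact ⟨v, h.root_of_adj h2 hq, Or.inl rfl, hqy.head ⟨hq, h2⟩⟩
      · exact ⟨q, hq, Or.inr h2, hqy⟩

theorem not_reach (h : IsRep G C prec adj) (hx : Root C prec x) (hyx : adj y x)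
    (hux : u = x ∨ prec u x) : ¬ Reach C prec adj y u := by
  rintro ⟨q, hq, huq, hqy⟩
  obtain rfl := h.root_unique hx hq hux huq
  exact h.no_cycle hqy hyx

/-- A further contact with `x` would, by `reach_step`, place the parent `x` in the subtree of its
own child. -/
theorem not_mem_nb_of_reach (h : IsRep G C prec adj) (hx : Root C prec x) (hyx : adj y x)
    (hu : Reach C prec adj y u) (huy : u ≠ y) : u ∉ nb G x := by
  rintro (rfl | hux)
  · exact h.not_reach hx hyx (Or.inl rfl) hu
  · exact h.not_reach hx hyx (Or.inl rfl) (h.reach_step hu huy hx.1 hux.symm)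

section Grow

variable {T : V → V → Prop}

/-- The growth only finds genuine children: an out-neighbour of `y` other than its parent `x` lies
below `x`, and so is caught by `T`. Genuine children may be missing, namely those that `T` also
accepts. -/
theorem mk_root (h : IsRep G C prec adj) (hr : Root C prec r) (hrs : ∀ v, ¬ adj r v)
    (hT : ∀ x z, prec z x → T x z) (hxy : Mk G C r T x y) :
    Root C prec x ∧ Root C prec y ∧ adj y x := by
  induction hxy with
  | @base z hz hrz =>
    have h1 := ((h.graph hr.1 hz).1 hrz).resolve_left (hrs z)
    exact ⟨hr, h.root_of_adj h1 hr, h1⟩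
  | @step x y z hxy hz hyz hzx hTz ih =>
    obtain ⟨h1, h2, h3⟩ := ih
    rcases (h.graph h2.1 hz).1 hyz with h4 | h4
    · exact absurd (hT x z ((h.ax2 h4 h3 hzx).resolve_right (h1.2 z))) hTz
    · exact ⟨h2, h.root_of_adj h4 h2, h4⟩

/-- For a maximal element `r` without out-neighbours, the tree grown from `r` is valid. -/
theorem valid (h : IsRep G C prec adj) (hr : Root C prec r) (hrs : ∀ v, ¬ adj r v)
    (hT : ∀ x z, prec z x → T x z)
    (hTc : ∀ x u v, Conn G (nb G x) u v → T x u → T x v)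
    (hTC : ∀ x u, T x u → comp G (nb G x) u ⊆ C) (hTn : ∀ x u, T x u → u ∉ nb G x) :
    Valid G C r T := by
  have hmk : ∀ {x y}, Mk G C r T x y → Root C prec x ∧ Root C prec y ∧ adj y x :=
    fun h' => h.mk_root hr hrs hT h'
  have hrt : ∀ {y}, Rt G C r T y → Root C prec y := by
    rintro y (rfl | ⟨x, hxy⟩)
    · exact hr
    · exact (hmk hxy).2.1
  have hpu : ∀ x x' y, Mk G C r T x y → Mk G C r T x' y → x = x' := fun x x' y h1 h2 =>
    h.out_unique (hmk h1).1 (hmk h2).1 (hmk h1).2.2 (hmk h2).2.2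
  have hnp : ∀ x, ¬ Mk G C r T x r := fun x h1 => hrs x (hmk h1).2.2
  have hedge : ∀ y y', Rt G C r T y → Rt G C r T y' → adj y y' → Mk G C r T y' y := by
    rintro y y' (rfl | ⟨x, hxy⟩) hy' hyy'
    · exact absurd hyy' (hrs y')
    · rwa [h.out_unique (hrt hy') (hmk hxy).1 hyy' (hmk hxy).2.2]
  -- A component put below `x` either truly lies there, or is a misplaced part of the subtree of one
  -- child `y` of `x`. The orientation of its edge to `y` tells which.
  have hcases : ∀ {x u}, Cap G C r T x u → (∀ v, Conn G (nb G x) u v → prec v x) ∨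
      ∃ y, Mk G C r T x y ∧ ∀ v, Conn G (nb G x) u v → Reach C prec adj y v ∧ v ≠ y := by
    rintro x u ⟨hTu, y, k, hxy, huk, hyk⟩
    obtain ⟨h1, h2, h3⟩ := hmk hxy
    have hkC := hTC x u hTu huk
    have hy : ∀ v, Conn G (nb G x) u v → v ≠ y := fun v hv hvy =>
      hv.right (hvy ▸ Or.inr hxy.adj)
    rcases (h.graph h2.1 hkC).1 hyk with h4 | h4
    · left
      have hkx : k ≠ x := fun e => huk.right (Or.inl e)
      have h5 := (h.ax2 h4 h3 hkx).resolve_right (h1.2 k)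
      exact fun v hv => h.prec_of_conn h5 (huk.symm.trans hv)
    · right
      refine ⟨y, hxy, fun v hv => ⟨?_, hy v hv⟩⟩
      refine (huk.symm.trans hv).induct (p := Reach C prec adj y)
        ⟨k, h.root_of_adj h4 h2, Or.inl rfl, .single ⟨h2, h4⟩⟩ ?_
      intro a b ha hb ha' hab
      exact h.reach_step ha' (hy a (huk.trans ha)) (hTC x u hTu (huk.trans hb)) hab
  have hrr : ∀ y, Reach C prec adj y r → r = y := by
    rintro y ⟨q, hq, hrq, hqy⟩
    obtain rfl := h.root_unique hr hq (Or.inl rfl) hrq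
    rcases hqy.cases_head with rfl | ⟨q1, ⟨-, h1⟩, -⟩
    · rfl
    · exact absurd h1 (hrs q1)
  -- Climbing from `u` along parents to just before `y` avoids `N[x]` and ends in a grown child of
  -- `y`.
  have hdesc : ∀ {p u}, Mk G C r T p u → ∀ {x y}, Mk G C r T x y → Reach C prec adj y u → u ≠ y →
      ∃ z, Mk G C r T y z ∧ Conn G (nb G x) u z := by
    intro p u hpu
    have key : ∀ p u, Mk G C r T p u → (∀ {x y}, Mk G C r T x y → Reach C prec adj y p → p ≠ y →
        ∃ z, Mk G C r T y z ∧ Conn G (nb G x) p z) → ∀ {x y}, Mk G C r T x y →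
        Reach C prec adj y u → u ≠ y → ∃ z, Mk G C r T y z ∧ Conn G (nb G x) u z := by
      intro p u hpu ih x y hxy hyu huy
      obtain ⟨h1, h2, h3⟩ := hmk hpu
      obtain ⟨k1, -, k3⟩ := hmk hxy
      have hun := h.not_mem_nb_of_reach k1 k3 hyu huy
      obtain ⟨q, hq, huq, hqy⟩ := id hyu
      obtain rfl := h.root_unique h2 hq (Or.inl rfl) huq
      rcases hqy.cases_head with rfl | ⟨q1, ⟨h4, h5⟩, h6⟩
      · exact absurd rfl huy
      · obtain rfl := h.out_unique h1 h4 h3 h5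
        by_cases hpy : p = y
        · subst hpy
          exact ⟨u, hpu, .refl hun⟩
        · have hyp : Reach C prec adj y p := ⟨p, h1, Or.inl rfl, h6⟩
          obtain ⟨z, hz, hz'⟩ := ih hxy hyp hpy
          exact ⟨z, hz, (Conn.adj hpu.adj.symm hun hz'.left).trans hz'⟩
    induction hpu with
    | base hz hrz =>
      exact key _ _ (.base hz hrz) fun {x y} _ h2 h3 => absurd (hrr y h2) h3
    | step hxy hz hyz hzx hTz ih => exact key _ _ (.step hxy hz hyz hzx hTz) ih
  have hcr : ∀ x u, Cap G C r T x u → ¬ Rt G C r T u := by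
    intro x u hc hu
    rcases hcases hc with h1 | ⟨y, hxy, h1⟩
    · exact (hrt hu).2 _ (h1 u (.refl (hTn x u hc.1)))
    · obtain ⟨h2, h3⟩ := h1 u (.refl (hTn x u hc.1))
      obtain ⟨z, hyz, huz⟩ : ∃ z, Mk G C r T y z ∧ Conn G (nb G x) u z := by
        rcases hu with rfl | ⟨p, hp⟩
        · exact absurd (hrr y h2) h3
        · exact hdesc hp hxy h2 h3
      -- The grown child `z` of `y` would lie in a component accepted by `T`, which the growth rule
      -- forbids.
      have hTz := hTc x u z huz hc.1
      cases hyz with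
      | base _ _ => exact hnp x hxy
      | step hxy' _ _ _ hT' =>
        rw [hpu _ _ _ hxy' hxy] at hT'
        exact hT' hTz
  have hatt : ∀ x u y, Cap G C r T x u → Rt G C r T y → G.Adj y u → y ∈ nb G x := by
    intro x u y hc hy hyu
    by_contra hyx
    exact hcr x y (hc.congr hTc (.adj hyu.symm (hTn x u hc.1) hyx)) hy
  refine ⟨hpu, hnp, ?_, hcr, ?_, ?_, ?_, ?_⟩
  · intro y y' hy hy' hyy'
    rcases (h.graph (hrt hy).1 (hrt hy').1).1 hyy' with h1 | h1
    · exact Or.inr (hedge y y' hy hy' h1)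
    · exact Or.inl (hedge y' y hy' hy h1)
  · intro x u y' hc hy' hyu
    have hun := hTn x u hc.1
    have hyx := hatt x u y' hc hy' hyu
    have hyx' := adj_of_mem_nb hyx hun hyu
    obtain ⟨-, y, -, hxy, -⟩ := id hc
    have hx := hrt hxy.left
    rcases (h.graph (hrt hy').1 hx.1).1 hyx' with h1 | h1
    · exact hedge y' x hy' hxy.left h1
    · exfalso
      rcases hcases hc with h2 | ⟨y, hxy, h2⟩
      · have h3 := h2 u (.refl hun)
        rcases h.ax4 (h.low_adj hyx h3 hyu (hrt hy').1) h3 with h4 | h4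
        · exact h.adj_asymm h1 h4
        · exact (hrt hy').2 _ h4
      · obtain ⟨h3, h4⟩ := h2 u (.refl hun)
        have h5 := h.reach_step h3 h4 (hrt hy').1 hyu.symm
        refine h.not_mem_nb_of_reach hx (hmk hxy).2.2 h5 ?_ hyx
        rintro rfl
        exact h.adj_asymm h1 (hmk hxy).2.2
  · intro x u w hc hw hwr hwu hwx
    have hun := hTn x u hc.1
    have hwx' := adj_of_mem_nb hwx hun hwu
    rcases hcases hc with h1 | ⟨y, hxy, h1⟩
    · obtain ⟨-, y, k, hxy, huk, hyk⟩ := id hc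
      obtain ⟨hx, hy, hyx⟩ := hmk hxy
      have h2 := h1 u (.refl hun)
      have h3 := (h.ax4 (h.low_adj hwx h2 hwu hw) h2).resolve_right
        fun h3 => h.not_mem_nb h3 hwx
      rcases hxy.left with rfl | ⟨x0, hx0⟩
      · exact hwr (Mk.base hw hwx'.symm).right
      · obtain ⟨k1, -, k3⟩ := hmk hx0
        have hwx0 : w ≠ x0 := by rintro rfl; exact hwr hx0.left
        -- Here `w` is a genuine child of `x`. If it is missing from the tree, it was put below the
        -- parent `x0` of `x`; but its component of `G - N[x0]` reaches the tree vertex `y` through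
        -- `u` and `k`, contradicting `hcr`.
        by_cases hTw : T x0 w
        · have hwn := hTn x0 w hTw
          have hcw : Cap G C r T x0 w := ⟨hTw, x, w, hx0, .refl hwn, hwx'.symm⟩
          have hlow : ∀ v, prec v x → v ∉ nb G x0 := by
            rintro v hv (rfl | hv')
            · exact k1.2 _ hv
            · rcases (h.graph k1.1 (h.prec_mem hv).1).1 hv' with h4 | h4
              · rcases h.ax4 h4 hv with h5 | h5
                · exact h.adj_asymm k3 h5
                · exact k1.2 _ h5
              · exact k1.2 _ (h.ax3 h4 hv)
          have hyn : y ∉ nb G x0 := by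
            rintro (rfl | hv')
            · exact h.adj_asymm k3 hyx
            · rcases (h.graph k1.1 hy.1).1 hv' with h4 | h4
              · exact h.not_transGen x0 (.tail (.tail (.single h4) hyx) k3)
              · obtain rfl := h.out_unique hx k1 hyx h4
                exact h.adj_irrefl _ k3
          have c1 : Conn G (nb G x0) w u := .adj hwu hwn (hlow u h2)
          have c2 : Conn G (nb G x0) u k := huk.induct (p := fun a => Conn G (nb G x0) u a)
            (.refl (hlow u h2)) fun a b _ hb ha hab => ha.tail hab (hlow b (h1 b hb))
          exact hcr x0 y (hcw.congr hTc ((c1.trans c2).tail hyk.symm hyn)) hxy.right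
        · exact hwr (Mk.step hx0 hw hwx'.symm hwx0 hTw).right
    · obtain ⟨h2, h3⟩ := h1 u (.refl hun)
      refine h.not_mem_nb_of_reach (hmk hxy).1 (hmk hxy).2.2 (h.reach_step h2 h3 hw hwu.symm) ?_ hwx
      rintro rfl
      exact hwr hxy.right
  · intro w x x' hw hx hx' hwx hwx'
    by_contra hne
    exact (h.probe_chain hw (hrt hx).1 (hrt hx').1 hwx hwx' hne).elim ((hrt hx).2 _) ((hrt hx').2 _)
  · intro x u v hu hv huv
    -- A misplaced part of the subtree of `y` has `y` as its only neighbour, so there is just one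
    -- trace to compare.
    have single : ∀ {u v}, Cap G C r T x u → (∃ y, Mk G C r T x y ∧
        ∀ v, Conn G (nb G x) u v → Reach C prec adj y v ∧ v ≠ y) → Cst G (nb G x) u v := by
      rintro u v hu ⟨y, hxy, h1⟩
      have key : ∀ w, Nbr G (nb G x) u w → w = y := by
        rintro w ⟨hw, k, huk, hwk⟩
        have hwx := adj_of_mem_nb hw huk.right hwk
        obtain ⟨h2, h3⟩ := h1 k huk
        obtain ⟨k1, k2, k3⟩ := hmk hxy
        by_cases hwC : w ∈ C
        · by_contra hwy
          exact h.not_mem_nb_of_reach k1 k3 (h.reach_step h2 h3 hwC hwk.symm) hwy hw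
        · have hkx : k ≠ x := fun e => huk.right (Or.inl e)
          have h4 := (h.probe_chain hwC (hTC x u hu.1 huk) k1.1 hwk hwx hkx).resolve_right (k1.2 k)
          exact absurd h2 (h.not_reach k1 k3 (Or.inr h4))
      intro w w' k hw hw' _ hwk
      rwa [key w' hw', ← key w hw]
    rcases hcases hu with h1 | h1
    · rcases hcases hv with h2 | h2
      -- If one vertex of a component is below `b` in another component, the whole component is, as
      -- `b` has no neighbour in it.
      · have nest : ∀ {u v}, ¬ Conn G (nb G x) u v → ∀ {a b}, Conn G (nb G x) u a →
            Conn G (nb G x) v b → prec a b → ∀ k, Conn G (nb G x) u k → prec k b := by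
          intro u v huv a b ha hb hab k hk
          refine (ha.symm.trans hk).induct (p := fun c => prec c b) hab ?_
          intro c d hc hd hcb hcd
          refine h.prec_of_adj hcb hcd ?_
          rintro (rfl | hdb)
          · exact huv ((ha.trans hd).trans hb.symm)
          · exact huv (((ha.trans hd).tail hdb.symm hb.right).trans hb.symm)
        have hc : ∀ {u v}, ¬ Conn G (nb G x) u v → (∀ v, Conn G (nb G x) u v → prec v x) →
            (∀ k, Conn G (nb G x) v k → prec k x) →
            (∃ a b, Conn G (nb G x) u a ∧ Conn G (nb G x) v b ∧ prec a b) →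
            Cst G (nb G x) u v := by
          rintro u v huv h1 h2 ⟨a, b, ha, hb, hab⟩ w w' k ⟨hw, c, hc, hwc⟩ ⟨hw', c', hc', hwc'⟩ hk hwk
          have hck : c ≠ k := by rintro rfl; exact huv (hc.trans hk.symm)
          rcases h.low_chain hw (h1 c hc) (h2 k hk) hwc hwk hck with h3 | h3
          · exact h.low_up hw' (h1 c' hc') (h2 k hk) hwc' (nest huv hc hk h3 c' hc')
          · have h4 := nest (fun h => huv h.symm) hk hc h3 b hb
            exact absurd (h.trans h4 (nest huv ha hb hab c hc)) (h.irrefl b)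
        by_cases e1 : ∃ a b, Conn G (nb G x) u a ∧ Conn G (nb G x) v b ∧ prec a b
        · exact Or.inl (hc huv h1 h2 e1)
        · by_cases e2 : ∃ a b, Conn G (nb G x) v a ∧ Conn G (nb G x) u b ∧ prec a b
          · exact Or.inr (hc (fun h => huv h.symm) h2 h1 e2)
          -- With no comparable pair between the two components, no vertex of `N[x]` sees both, so
          -- constancy is vacuous.
          · left
            rintro w w' k ⟨hw, c, hc, hwc⟩ - hk hwk
            have hck : c ≠ k := by rintro rfl; exact huv (hc.trans hk.symm)
            rcases h.low_chain hw (h1 c hc) (h2 k hk) hwc hwk hck with h3 | h3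
            · exact absurd ⟨c, k, hc, hk, h3⟩ e1
            · exact absurd ⟨k, c, hk, hc, h3⟩ e2
      · exact Or.inr (single hv h2)
    · exact Or.inl (single hu h1)

end Grow

end IsRep
end Recognition

namespace Recognition

/-! ### Tables of representations -/

variable {V : Type*} (G : SimpleGraph V)

/-- The deleted set with the code `(a, b)`: the closed neighbourhood of `a` if `a = b`, and the
empty set otherwise. -/
def blk (a b : V) : Set V := {v | a = b ∧ v ∈ nb G a}

theorem blk_self (a : V) : blk G a a = nb G a := by
  ext v
  exact ⟨fun h => h.2, fun h => ⟨rfl, h⟩⟩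

theorem blk_of_ne {a b : V} (h : a ≠ b) : blk G a b = ∅ := by
  ext v
  exact ⟨fun h' => h h'.1, fun h' => h'.elim⟩

/-- The tables decide whether the components of at most `k` vertices have representations, and
contain representations of them. -/
def Correct (k : ℕ) (P : V → V → V → Prop) (p q : V → V → V → V → V → Prop) : Prop :=
  ∀ a b v, v ∉ blk G a b → (comp G (blk G a b) v).ncard ≤ k →
    (P a b v → IsRep G (comp G (blk G a b) v) (p a b v) (q a b v)) ∧
    ∀ p' q', IsRep G (comp G (blk G a b) v) p' q' → P a b v

/-- The component of `z` in `G` minus the closed neighbourhood of `x` lies in `C` and has a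
representation according to the table. -/
def Fits (P : V → V → V → Prop) (C : Set V) (x z : V) : Prop :=
  x ∈ C ∧ z ∉ nb G x ∧ comp G (nb G x) z ⊆ C ∧ P x x z

variable [LinearOrder V]

/-- `m` is the smallest vertex of the component of `u`. -/
def IsMin (B : Set V) (m u : V) : Prop := Conn G B m u ∧ ∀ m', Conn G B m' u → ¬ m' < m

/-- The relation that the table provides for the components of `G - blk a b`. -/
def pick (p : V → V → V → V → V → Prop) (a b u w : V) : Prop :=
  ∃ m, IsMin G (blk G a b) m u ∧ p a b m u w

/-- `r` is an admissible root for the component of `v`. -/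
def Good (P : V → V → V → Prop) (a b v r : V) : Prop :=
  Conn G (blk G a b) v r ∧ Valid G (comp G (blk G a b) v) r
    (Fits G P (comp G (blk G a b) v))

/-- `r` is the smallest admissible root. -/
def Best (P : V → V → V → Prop) (a b v r : V) : Prop :=
  Good G P a b v r ∧ ∀ r', Good G P a b v r' → ¬ r' < r

/-- The improved table of decisions. -/
def nextP (P : V → V → V → Prop) (a b v : V) : Prop := ∃ r, Good G P a b v r

/-- The improved table of orders. -/
def nextPrec (P : V → V → V → Prop) (p : V → V → V → V → V → Prop) (a b v x y : V) : Prop :=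
  ∃ r, Best G P a b v r ∧ treePrec G (comp G (blk G a b) v) r
    (Fits G P (comp G (blk G a b) v)) (fun x => pick G p x x) x y

/-- The improved table of orientations. -/
def nextAdj (P : V → V → V → Prop) (q : V → V → V → V → V → Prop) (a b v x y : V) : Prop :=
  ∃ r, Best G P a b v r ∧ treeAdj G (comp G (blk G a b) v) r
    (Fits G P (comp G (blk G a b) v)) (fun x => pick G q x x) x y

variable {G} [Finite V]

omit [Finite V] in
theorem IsMin.unique {B : Set V} {m m' u u' : V} (h : IsMin G B m u) (h' : IsMin G B m' u')
    (hu : Conn G B u u') : m = m' := by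
  have h1 := h.2 m' (h'.1.trans hu.symm)
  have h2 := h'.2 m (h.1.trans hu)
  exact le_antisymm (not_lt.1 h1) (not_lt.1 h2)

theorem exists_isMin {B : Set V} {u : V} (hu : u ∉ B) : ∃ m, IsMin G B m u := by
  obtain ⟨m, hm, hm'⟩ := Set.exists_min_image {m | Conn G B m u} id (Set.toFinite _) ⟨u, .refl hu⟩
  exact ⟨m, hm, fun m' h => not_lt.2 (hm' m' h)⟩

/-- Tables may hold different representations for different vertices of one component. Consulting
the smallest vertex makes the choice uniform. -/
theorem Correct.isRep_pick {k : ℕ} {P : V → V → V → Prop} {p q : V → V → V → V → V → Prop}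
    (h : Correct G k P p q) {a b u : V} (hu : u ∉ blk G a b)
    (hk : (comp G (blk G a b) u).ncard ≤ k) (hP : P a b u) :
    IsRep G (comp G (blk G a b) u) (restr (comp G (blk G a b) u) (pick G p a b))
      (restr (comp G (blk G a b) u) (pick G q a b)) := by
  obtain ⟨m, hm⟩ := exists_isMin (G := G) hu
  have hc := comp_eq hm.1
  have hrep : IsRep G (comp G (blk G a b) u) (p a b m) (q a b m) := by
    have h1 := (h a b u hu hk).1 hP
    rw [← hc] at h1 ⊢
    exact (h a b m hm.1.left (by rwa [hc])).1 ((h a b m hm.1.left (by rwa [hc])).2 _ _ h1)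
  have key : ∀ (p : V → V → V → V → V → Prop), (∀ x y, p a b m x y →
      x ∈ comp G (blk G a b) u ∧ y ∈ comp G (blk G a b) u) → ∀ x y,
      restr (comp G (blk G a b) u) (pick G p a b) x y ↔ p a b m x y := by
    intro p hp x y
    constructor
    · rintro ⟨hx, -, m', hm', h'⟩
      rwa [hm.unique hm' hx]
    · intro h'
      obtain ⟨hx, hy⟩ := hp x y h'
      exact ⟨hx, hy, m, ⟨hm.1.trans hx, fun m' h => hm.2 m' (h.trans hx.symm)⟩, h'⟩
  exact hrep.congr (key p fun x y h => hrep.prec_mem h) (key q fun x y h => hrep.adj_mem h)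

/-- Soundness is `Valid.isRep` for the best root; completeness is `IsRep.valid` for a maximal sink
of the given representation. -/
theorem Correct.succ {k : ℕ} {P : V → V → V → Prop} {p q : V → V → V → V → V → Prop}
    (h : Correct G k P p q) :
    Correct G (k + 1) (nextP G P) (nextPrec G P p) (nextAdj G P q) := by
  intro a b v hv hk
  set C := comp G (blk G a b) v with hC
  -- Such a component omits `x`, so it is strictly smaller than `C` and covered by the tables.
  have hsmall : ∀ {x z}, x ∈ C → z ∉ nb G x → comp G (nb G x) z ⊆ C →
      (comp G (blk G x x) z).ncard ≤ k := by
    intro x z hx hz hzC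
    rw [blk_self]
    have h1 : x ∉ comp G (nb G x) z := fun h => h.right (self_mem_nb x)
    have := Set.ncard_lt_ncard ((Set.ssubset_iff_of_subset hzC).2 ⟨x, hx, h1⟩) (Set.toFinite C)
    omega
  -- At covered sizes the entry is equivalent to the existence of a representation, hence depends
  -- only on the component.
  have hTc : ∀ x u v, Conn G (nb G x) u v → Fits G P C x u → Fits G P C x v := by
    rintro x u v huv ⟨h1, h2, h3, h4⟩
    have hc : comp G (blk G x x) u = comp G (blk G x x) v := by rw [blk_self]; exact comp_eq huv
    have hs := hsmall h1 h2 h3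
    have h5 := (h x x u (by rwa [blk_self]) hs).1 h4
    rw [hc] at h5 hs
    exact ⟨h1, huv.right, comp_eq huv ▸ h3,
      (h x x v (by rw [blk_self]; exact huv.right) hs).2 _ _ h5⟩
  have hTC : ∀ x u, Fits G P C x u → comp G (nb G x) u ⊆ C := fun x u h => h.2.2.1
  have hTn : ∀ x u, Fits G P C x u → u ∉ nb G x := fun x u h => h.2.1
  constructor
  · rintro ⟨r0, hr0⟩
    obtain ⟨r, hr, hr'⟩ := Set.exists_min_image {r | Good G P a b v r} id (Set.toFinite _) ⟨r0, hr0⟩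
    -- Fixing the smallest root ensures that order and orientation come from the same tree.
    have hbest : Best G P a b v r := ⟨hr, fun r' h => not_lt.2 (hr' r' h)⟩
    have huniq : ∀ r', Best G P a b v r' → r' = r := fun r' h' =>
      le_antisymm (not_lt.1 (h'.2 r hr)) (not_lt.1 (hbest.2 r' h'.1))
    have hrC : r ∈ C := hr.1
    have hconn : ∀ p : V → Prop, p r → (∀ a ∈ C, ∀ b ∈ C, p a → G.Adj a b → p b) →
        ∀ u ∈ C, p u := by
      intro p hp hs u hu
      refine (hrC.symm.trans hu).induct hp ?_
      intro c d hc hd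
      exact hs c (hrC.trans hc) d (hrC.trans hd)
    have hrep : IsRep G C (treePrec G C r (Fits G P C) fun x => pick G p x x)
        (treeAdj G C r (Fits G P C) fun x => pick G q x x) := by
      refine Valid.isRep hr.2 hrC hconn hTc hTC hTn ?_
      intro x u hT
      have h1 := h.isRep_pick (a := x) (b := x) (u := u) (by rw [blk_self]; exact hT.2.1)
        (hsmall hT.1 hT.2.1 hT.2.2.1) hT.2.2.2
      rwa [blk_self] at h1
    refine hrep.congr (fun x y => ⟨?_, fun h' => ⟨r, hbest, h'⟩⟩)
      (fun x y => ⟨?_, fun h' => ⟨r, hbest, h'⟩⟩)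
    · rintro ⟨r', h1, h2⟩
      rwa [huniq r' h1] at h2
    · rintro ⟨r', h1, h2⟩
      rwa [huniq r' h1] at h2
  · intro p' q' hrep
    obtain ⟨r, hr, hrs⟩ := hrep.exists_sink ⟨v, Conn.refl hv⟩
    refine ⟨r, hr.1, hrep.valid hr hrs ?_ hTc hTC hTn⟩
    intro x z hzx
    have h1 := hrep.not_mem_nb hzx
    have h2 : comp G (nb G x) z ⊆ C := fun u hu => (hrep.prec_mem (hrep.prec_of_conn hzx hu)).1
    have hx := (hrep.prec_mem hzx).2
    refine ⟨hx, h1, h2, (h x x z (by rwa [blk_self]) (hsmall hx h1 h2)).2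
      (restr (comp G (nb G x) z) p') (restr (comp G (nb G x) z) q') ?_⟩
    rw [blk_self]
    exact hrep.isRep_comp hzx

omit [LinearOrder V] in
-- Components are non-empty, so the tables need no initialization.
theorem correct_zero (P : V → V → V → Prop) (p q : V → V → V → V → V → Prop) :
    Correct G 0 P p q := by
  intro a b v hv hk
  have h1 := (Set.ncard_eq_zero (Set.toFinite (comp G (blk G a b) v))).1 (Nat.le_zero.1 hk)
  have h2 : v ∈ comp G (blk G a b) v := .refl hv
  rw [h1] at h2
  exact h2.elim

/-! ### The whole graph -/

variable (G) in
/-- The relation that the table provides for the components of `G`. -/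
def final (p : V → V → V → V → V → Prop) (u v : V) : Prop :=
  ∃ a b, a ≠ b ∧ (∀ c, ¬ c < a) ∧ (∀ c, ¬ b < c) ∧ Conn G (blk G a b) u v ∧ pick G p a b u v

omit [LinearOrder V] in
theorem isBurlingSet_of_isRep [Nonempty V] {prec adj : V → V → Prop}
    (h : IsRep G Set.univ prec adj) : IsBurlingSet prec adj ∧ G = SimpleGraph.fromRel adj := by
  constructor
  · exact
      { finite := inferInstance
        nonempty := inferInstance
        prec_irrefl := h.irrefl
        prec_trans := fun _ _ _ => h.trans
        adj_acyclic := h.not_transGen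
        axiom1 := fun _ _ _ => h.ax1
        axiom2 := fun _ _ _ => h.ax2
        axiom3 := fun _ _ _ => h.ax3
        axiom4 := fun _ _ _ => h.ax4 }
  · ext u v
    rw [SimpleGraph.fromRel_adj, h.graph (Set.mem_univ u) (Set.mem_univ v)]
    refine ⟨fun h' => ⟨?_, h'⟩, fun h' => h'.2⟩
    rintro rfl
    exact h.adj_irrefl u (by tauto)

omit [LinearOrder V] in
theorem isRep_of_isBurlingSet {prec adj : V → V → Prop} (h : IsBurlingSet prec adj) :
    IsRep (SimpleGraph.fromRel adj) Set.univ prec adj where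
  prec_mem _ := ⟨Set.mem_univ _, Set.mem_univ _⟩
  adj_mem _ := ⟨Set.mem_univ _, Set.mem_univ _⟩
  irrefl := h.prec_irrefl
  trans := h.prec_trans _ _ _
  wf := by
    have : Std.Irrefl (Relation.TransGen fun y x => adj x y) :=
      ⟨fun x hx => h.adj_acyclic x (Relation.transGen_swap.1 hx)⟩
    have w := Finite.wellFounded_of_trans_of_irrefl (Relation.TransGen fun y x => adj x y)
    exact Subrelation.wf (r := Relation.TransGen fun y x => adj x y)
      (fun h => Relation.TransGen.single h) w
  ax1 := h.axiom1 _ _ _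
  ax2 := h.axiom2 _ _ _
  ax3 := h.axiom3 _ _ _
  ax4 := h.axiom4 _ _ _
  graph {x y} _ _ := by
    rw [SimpleGraph.fromRel_adj]
    refine ⟨fun h' => h'.2, fun h' => ⟨?_, h'⟩⟩
    rintro rfl
    exact h.adj_acyclic x (.single (by tauto))
  probe_chain hw := absurd (Set.mem_univ _) hw
  probe_up hw := absurd (Set.mem_univ _) hw

omit [LinearOrder V] [Finite V] in
/-- A representation of the whole graph restricts to the components. -/
theorem IsRep.component {prec adj : V → V → Prop} (h : IsRep G Set.univ prec adj) (v : V) :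
    IsRep G (comp G ∅ v) (restr (comp G ∅ v) prec) (restr (comp G ∅ v) adj) := by
  have hw : ∀ w x, w ∉ comp G ∅ v → x ∈ comp G ∅ v → ¬ G.Adj w x := fun w x hw hx hwx =>
    hw (hx.tail hwx.symm (Set.notMem_empty w))
  exact h.restrict (Set.subset_univ _) (fun w x y h1 h2 _ h4 => absurd h4 (hw w x h1 h2))
    (fun w x y h1 h2 _ h4 => absurd h4 (hw w x h1 h2))

/-- If the table has a representation for every component, then it provides a representation of
the whole graph. -/
theorem Correct.isRep_final {P : V → V → V → Prop} {p q : V → V → V → V → V → Prop}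
    (h : Correct G (Nat.card V) P p q) (hP : ∀ a b v, a ≠ b → P a b v) [Nontrivial V] :
    IsRep G Set.univ (final G p) (final G q) := by
  obtain ⟨a, -, ha⟩ := Set.exists_min_image (Set.univ : Set V) id (Set.toFinite _) Set.univ_nonempty
  obtain ⟨b, -, hb⟩ := Set.exists_max_image (Set.univ : Set V) id (Set.toFinite _) Set.univ_nonempty
  have ha' : ∀ c, a ≤ c := fun c => ha c (Set.mem_univ c)
  have hb' : ∀ c, c ≤ b := fun c => hb c (Set.mem_univ c)
  have hab : a ≠ b := by
    rintro rfl
    obtain ⟨x, y, hxy⟩ := exists_pair_ne V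
    exact hxy ((le_antisymm (hb' x) (ha' x)).trans (le_antisymm (ha' y) (hb' y)))
  have hblk : blk G a b = ∅ := blk_of_ne G hab
  have hfin : ∀ (p : V → V → V → V → V → Prop) u v,
      final G p u v ↔ Conn G ∅ u v ∧ pick G p a b u v := by
    intro p u v
    constructor
    · rintro ⟨a', b', -, h2, h3, h4, h5⟩
      obtain rfl : a = a' := le_antisymm (ha' a') (not_lt.1 (h2 a))
      obtain rfl : b = b' := le_antisymm (not_lt.1 (h3 b)) (hb' b')
      exact ⟨hblk ▸ h4, h5⟩
    · rintro ⟨h1, h2⟩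
      exact ⟨a, b, hab, fun c => not_lt.2 (ha' c), fun c => not_lt.2 (hb' c), by rwa [hblk], h2⟩
  -- With nothing deleted, components have no neighbours and are placed side by side.
  have hbel : ∀ u v, ¬ Below G ∅ u v := by
    rintro u v ⟨-, -, ⟨w, hw⟩, -⟩
    exact hw.1
  have hnbr : ∀ u w, ¬ Nbr G ∅ u w := fun u w hw => hw.1
  have hN : IsRep G Set.univ (nestPrec G ∅ Set.univ (pick G p a b))
      (nestAdj G ∅ Set.univ (pick G q a b)) := by
    refine isRep_nest (fun u _ => Set.notMem_empty u) (fun _ _ v _ => Set.mem_univ v) ?_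
      (fun u _ v _ _ => Or.inl fun w w' k hw => absurd hw (hnbr u w))
    intro u _
    have h1 := h.isRep_pick (a := a) (b := b) (u := u) (by rw [hblk]; exact Set.notMem_empty u)
      (Set.ncard_le_card _) (hP a b u hab)
    rwa [hblk] at h1
  refine hN.congr (fun u v => ?_) (fun u v => ?_)
  · rw [hfin]
    simp [nestPrec, hbel]
  · rw [hfin]
    simp [nestAdj]

omit [Finite V] in
theorem final_of_subsingleton [Subsingleton V] (p : V → V → V → V → V → Prop) (u v : V) :
    ¬ final G p u v := by
  rintro ⟨a, b, hab, -⟩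
  exact hab (Subsingleton.elim a b)

/-- The decision made by a correct table. -/
theorem Correct.decide [Nonempty V] {P : V → V → V → Prop} {p q : V → V → V → V → V → Prop}
    (h : Correct G (Nat.card V) P p q) :
    ((∀ a b v, a ≠ b → P a b v) → IsBurlingSet (final G p) (final G q) ∧
      G = SimpleGraph.fromRel (final G q)) ∧
    ((¬ ∀ a b v, a ≠ b → P a b v) → ¬ ∃ prec adj : V → V → Prop,
      IsBurlingSet prec adj ∧ G = SimpleGraph.fromRel adj) := by
  constructor
  · intro hP
    -- On a single vertex no code `a ≠ b` for the empty set exists. The output relations are then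
    -- empty, which is correct.
    rcases subsingleton_or_nontrivial V with hV | hV
    · refine isBurlingSet_of_isRep ?_
      have e : ∀ p : V → V → V → V → V → Prop, final G p = fun _ _ => False := fun p => by
        funext u v; exact eq_false (final_of_subsingleton p u v)
      rw [e, e]
      exact
        { prec_mem := False.elim
          adj_mem := False.elim
          irrefl := fun _ => id
          trans := fun h' => h'.elim
          wf := ⟨fun u => ⟨u, fun v hv => hv.elim⟩⟩
          ax1 := fun h' => h'.elim
          ax2 := fun h' => h'.elim
          ax3 := fun h' => h'.elim
          ax4 := fun h' => h'.elim
          graph := fun {x y} _ _ =>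
            ⟨fun hxy => absurd (Subsingleton.elim x y) hxy.ne,
              fun h' => h'.elim False.elim False.elim⟩
          probe_chain := fun hw => absurd (Set.mem_univ _) hw
          probe_up := fun hw => absurd (Set.mem_univ _) hw }
    · exact isBurlingSet_of_isRep (h.isRep_final hP)
  · rintro hP ⟨prec, adj, hs, rfl⟩
    push Not at hP
    obtain ⟨a, b, v, hab, hP⟩ := hP
    refine hP ((h a b v (by rw [blk_of_ne _ hab]; exact Set.notMem_empty v)
      (Set.ncard_le_card _)).2 (restr (comp (SimpleGraph.fromRel adj) ∅ v) prec)
      (restr (comp (SimpleGraph.fromRel adj) ∅ v) adj) ?_)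
    rw [blk_of_ne _ hab]
    exact (isRep_of_isBurlingSet hs).component v

end Recognition

/-! ### Derived connectives, unchanged relations and stabilization of iterations. -/

namespace Query

namespace Fml

/-- Disjunction. -/
def or (φ ψ : Fml) : Fml := neg (and (neg φ) (neg ψ))

/-- Implication. -/
def imp (φ ψ : Fml) : Fml := neg (and φ (neg ψ))

/-- Universal quantification. -/
def all (x : ℕ) (φ : Fml) : Fml := neg (ex x (neg φ))

variable {n : ℕ} (σ : Store n) (e : ℕ → Fin n)

theorem eval_or (φ ψ : Fml) : (φ.or ψ).eval σ e ↔ φ.eval σ e ∨ ψ.eval σ e := by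
  simp only [or, eval]; tauto

theorem eval_imp (φ ψ : Fml) : (φ.imp ψ).eval σ e ↔ (φ.eval σ e → ψ.eval σ e) := by
  simp only [imp, eval]; tauto

theorem eval_all (x : ℕ) (φ : Fml) :
    (φ.all x).eval σ e ↔ ∀ z, φ.eval σ (Function.update e x z) := by
  simp only [all, eval, not_exists, not_not]

end Fml

namespace Prog

variable {n : ℕ} [NeZero n]

theorem sem_set_self (a : ℕ) (φ : Fml) (σ : Store n) (l : List (Fin n)) :
    (set a φ).sem σ a l ↔ φ.eval σ (env l) := by
  simp only [sem, Function.update_self]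

theorem sem_set_of_ne {a b : ℕ} (h : b ≠ a) (φ : Fml) (σ : Store n) :
    (set a φ).sem σ b = σ b := by
  simp only [sem, Function.update_of_ne h]

/-- The relation symbols that a program may redefine. -/
def writes : Prog → List ℕ
  | set a _ => [a]
  | seq p q => p.writes ++ q.writes
  | rep p => p.writes

theorem sem_of_notMem_writes (p : Prog) {b : ℕ} (h : b ∉ p.writes) (σ : Store n) :
    p.sem σ b = σ b := by
  induction p generalizing σ with
  | set a φ => exact sem_set_of_ne (by simpa [writes] using h) φ σ
  | seq p q ihp ihq =>
    simp only [writes, List.mem_append, not_or] at h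
    rw [sem, ihq h.2, ihp h.1]
  | rep p ih =>
    have key : ∀ k, (p.sem^[k] σ) b = σ b := by
      intro k
      induction k with
      | zero => rfl
      | succ k ihk => rw [Function.iterate_succ_apply', ih h, ihk]
    exact key n

/-- Enough rounds for the least fixed point of a binary relation on the domain. -/
theorem sem_rep_rep (p : Prog) (σ : Store n) : (rep (rep p)).sem σ = p.sem^[n * n] σ := by
  rw [Function.iterate_mul]
  rfl

end Prog

/-- An increasing iteration on the subsets of a finite type becomes stationary. -/
theorem iterate_stationary {α : Type*} [Finite α] (F : Set α → Set α) (hF : ∀ S, S ⊆ F S)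
    (f : ℕ → Set α) (hf : ∀ i, f (i + 1) = F (f i)) {N : ℕ} (hN : Nat.card α ≤ N) :
    F (f N) = f N := by
  by_contra hne
  -- A repetition would persist up to `N`. Without one, each step adds an element, giving more than
  -- `N` elements.
  have h1 : ∀ i ≤ N, f i ≠ f (i + 1) := by
    intro i hi h
    have h2 : ∀ j, f (i + j) = f i := by
      intro j
      induction j with
      | zero => rfl
      | succ j ih => rw [← add_assoc, hf, ih, ← hf, ← h]
    apply hne
    obtain ⟨j, rfl⟩ := Nat.exists_eq_add_of_le hi
    rw [h2, ← hf, ← h]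
  have h3 : ∀ i ≤ N + 1, i ≤ (f i).ncard := by
    intro i
    induction i with
    | zero => intro _; exact Nat.zero_le _
    | succ i ih =>
      intro hi
      have h4 : f i ⊂ f (i + 1) := lt_of_le_of_ne (hf i ▸ hF (f i)) (h1 i (by omega))
      have := Set.ncard_lt_ncard h4 (Set.toFinite _)
      have := ih (by omega)
      omega
  have := h3 (N + 1) le_rfl
  have := Set.ncard_le_card (f (N + 1))
  omega

end Query

/-! ### Connectivity as a query. -/

namespace Recognition

open Query Query.Prog

/-- The arities of the relation symbols. -/
def arity (a : ℕ) : ℕ :=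
  [2, 2, 2, 4, 4, 3, 3, 3, 3, 5, 5, 5, 4, 4, 6, 6, 5, 6, 4, 4, 3, 5, 5, 3, 4].getD a 0

/-- The variable `v` belongs to the deleted set with code `(a, b)`. -/
def blkFml (a b v : ℕ) : Fml := .and (.eq a b) (.or (.eq v a) (.rel 0 [a, v]))

/-- One step towards connectivity. -/
def connStep : Prog :=
  -- A formula may not read the relation that it redefines, so the new value is built in relation
  -- `4` and copied back.
  .seq (.set 4 (.or (.rel 3 [0, 1, 2, 3]) (.ex 4 (.and (.rel 3 [0, 1, 2, 4])
    (.and (.rel 0 [4, 3]) (.neg (blkFml 0 1 3)))))))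
  (.set 3 (.rel 4 [0, 1, 2, 3]))

/-- Connectivity in `G` minus a deleted set. -/
def connProg : Prog :=
  .seq (.set 3 (.and (.eq 2 3) (.neg (blkFml 0 1 2)))) (.rep (.rep connStep))

variable {n : ℕ} [NeZero n] {G : SimpleGraph (Fin n)} {σ : Store n}

omit [NeZero n] in
theorem eval_blkFml (h0 : ∀ x y, σ 0 [x, y] ↔ G.Adj x y) (e : ℕ → Fin n) (a b v : ℕ) :
    (blkFml a b v).eval σ e ↔ e v ∈ blk G (e a) (e b) := by
  simp only [blkFml, Fml.eval, Fml.eval_or, List.map, h0]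
  rfl

theorem connStep_sem (h0 : ∀ x y, σ 0 [x, y] ↔ G.Adj x y) (a b u v : Fin n) :
    connStep.sem σ 3 [a, b, u, v] ↔ σ 3 [a, b, u, v] ∨
      ∃ z, σ 3 [a, b, u, z] ∧ G.Adj z v ∧ v ∉ blk G a b := by
  rw [connStep, sem, sem_set_self]
  simp only [Fml.eval, List.map]
  rw [sem_set_self]
  simp [Fml.eval, Fml.eval_or, eval_blkFml h0, env, h0]

/-- For fixed `a`, `b` and `u` the iteration enlarges the set of reached vertices, so it is
stationary well within `n * n` rounds. -/
theorem connProg_sem (h0 : ∀ x y, σ 0 [x, y] ↔ G.Adj x y) (a b u v : Fin n) :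
    connProg.sem σ 3 [a, b, u, v] ↔ Conn G (blk G a b) u v := by
  rw [connProg, sem, sem_rep_rep]
  set τ := (Prog.set 3 (.and (.eq 2 3) (.neg (blkFml 0 1 2)))).sem σ with hτ
  have hτ3 : ∀ v, τ 3 [a, b, u, v] ↔ u = v ∧ u ∉ blk G a b := by
    intro v
    rw [hτ, sem_set_self]
    simp [Fml.eval, eval_blkFml h0, env]
  have hi0 : ∀ i x y, (connStep.sem^[i] τ) 0 [x, y] ↔ G.Adj x y := by
    intro i
    induction i with
    | zero => intro x y; exact h0 x y
    | succ i ih =>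
      rw [Function.iterate_succ_apply', sem_of_notMem_writes _ (by decide)]
      exact ih
  let F : Set (Fin n) → Set (Fin n) := fun S => {v | v ∈ S ∨ ∃ z ∈ S, G.Adj z v ∧ v ∉ blk G a b}
  let f : ℕ → Set (Fin n) := fun i => {v | (connStep.sem^[i] τ) 3 [a, b, u, v]}
  have hf : ∀ i, f (i + 1) = F (f i) := by
    intro i
    ext v
    change (connStep.sem^[i + 1] τ) 3 [a, b, u, v] ↔ _
    rw [Function.iterate_succ_apply', connStep_sem (hi0 i)]
    rfl
  have hfix := iterate_stationary F (fun S v hv => Or.inl hv) f hf (N := n * n)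
    (by rw [Nat.card_eq_fintype_card, Fintype.card_fin]; exact Nat.le_mul_self n)
  change v ∈ f (n * n) ↔ _
  constructor
  · have key : ∀ i v, v ∈ f i → Conn G (blk G a b) u v := by
      intro i
      induction i with
      | zero =>
        intro v hv
        obtain ⟨rfl, h⟩ := (hτ3 v).1 hv
        exact .refl h
      | succ i ih =>
        intro v hv
        rw [hf] at hv
        rcases hv with hv | ⟨z, hz, hzv, hv⟩
        · exact ih v hv
        · exact (ih z hz).tail hzv hv
    exact key _ v
  · intro huv
    refine huv.induct (p := fun v => v ∈ f (n * n)) ?_ ?_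
    · have hmono : ∀ i, f 0 ⊆ f i := by
        intro i
        induction i with
        | zero => exact subset_rfl
        | succ i ih => rw [hf]; exact fun v hv => Or.inl (ih hv)
      exact hmono _ ((hτ3 u).2 ⟨rfl, huv.left⟩)
    · intro x y _ hy hx hxy
      rw [← hfix]
      exact Or.inr ⟨x, hx, hxy, hy.right⟩

end Recognition

/-! ### Formulas for the stages of the algorithm. -/

namespace Recognition

open Query Query.Prog

variable {V : Type*} {H : SimpleGraph V}

theorem mem_comp {B : Set V} {u v : V} : v ∈ comp H B u ↔ Conn H B u v := Iff.rfl

theorem mem_nb {x v : V} : v ∈ nb H x ↔ v = x ∨ H.Adj x v := Iff.rfl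

theorem comp_subset {B C : Set V} {u : V} : comp H B u ⊆ C ↔ ∀ v, Conn H B u v → v ∈ C := Iff.rfl

/-- Unpacks the structure into the conjunction that `goodFml` spells out. -/
theorem valid_iff {C : Set V} {r : V} {T : V → V → Prop} : Valid H C r T ↔
    (∀ x x' y, Mk H C r T x y → Mk H C r T x' y → x = x') ∧
    (∀ x, ¬ Mk H C r T x r) ∧
    (∀ y y', Rt H C r T y → Rt H C r T y' → H.Adj y y' → Mk H C r T y y' ∨ Mk H C r T y' y) ∧
    (∀ x u, Cap H C r T x u → ¬ Rt H C r T u) ∧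
    (∀ x u y, Cap H C r T x u → Rt H C r T y → H.Adj y u → Mk H C r T x y) ∧
    (∀ x u w, Cap H C r T x u → w ∈ C → ¬ Rt H C r T w → H.Adj w u → w ∉ nb H x) ∧
    (∀ w x x', w ∉ C → Rt H C r T x → Rt H C r T x' → H.Adj w x → H.Adj w x' → x = x') ∧
    (∀ x u v, Cap H C r T x u → Cap H C r T x v → ¬ Conn H (nb H x) u v →
      Cst H (nb H x) u v ∨ Cst H (nb H x) v u) :=
  ⟨fun ⟨h1, h2, h3, h4, h5, h6, h7, h8⟩ => ⟨h1, h2, h3, h4, h5, h6, h7, h8⟩,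
    fun ⟨h1, h2, h3, h4, h5, h6, h7, h8⟩ => ⟨h1, h2, h3, h4, h5, h6, h7, h8⟩⟩

variable {n : ℕ} [NeZero n] {G : SimpleGraph (Fin n)} {σ τ : Store n}

/-- The relations that depend only on the graph. -/
structure Static (G : SimpleGraph (Fin n)) (σ : Store n) : Prop where
  adj : ∀ x y, σ 0 [x, y] ↔ G.Adj x y
  conn : ∀ a b u v, σ 3 [a, b, u, v] ↔ Conn G (blk G a b) u v
  nbr : ∀ x u w, σ 5 [x, u, w] ↔ Nbr G (nb G x) u w
  cst : ∀ x u v, σ 6 [x, u, v] ↔ Cst G (nb G x) u v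
  below : ∀ x u v, σ 7 [x, u, v] ↔ Below G (nb G x) u v
  isMin : ∀ a b m u, σ 24 [a, b, m, u] ↔ IsMin G (blk G a b) m u

omit [NeZero n] in
theorem Static.congr (h : Static G σ) (h' : ∀ a ∈ [0, 3, 5, 6, 7, 24], τ a = σ a) :
    Static G τ := by
  constructor
  · rw [h' 0 (by decide)]; exact h.adj
  · rw [h' 3 (by decide)]; exact h.conn
  · rw [h' 5 (by decide)]; exact h.nbr
  · rw [h' 6 (by decide)]; exact h.cst
  · rw [h' 7 (by decide)]; exact h.below
  · rw [h' 24 (by decide)]; exact h.isMin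

/-- The smallest vertex of a component. -/
def minFml : Fml :=
  .and (.rel 3 [0, 1, 2, 3]) (.all 4 (.imp (.rel 3 [0, 1, 4, 3]) (.neg (.lt 4 2))))

/-- Membership of `v` in the closed neighbourhood of `x`. -/
def nbFml (x v : ℕ) : Fml := .or (.eq v x) (.rel 0 [x, v])

/-- Neighbours of a component. -/
def nbrFml : Fml := .and (nbFml 0 2) (.ex 3 (.and (.rel 3 [0, 0, 1, 3]) (.rel 0 [2, 3])))

/-- Constancy of the traces on a component. -/
def cstFml : Fml :=
  .all 3 <| .all 4 <| .all 5 <| .imp (.rel 5 [0, 1, 3]) <| .imp (.rel 5 [0, 1, 4]) <|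
    .imp (.rel 3 [0, 0, 2, 5]) <| .imp (.rel 0 [3, 5]) (.rel 0 [4, 5])

/-- Comparison of the smallest vertices of components. -/
def minLtFml : Fml :=
  .ex 3 (.and (.rel 3 [0, 0, 1, 3]) (.all 4 (.imp (.rel 3 [0, 0, 2, 4]) (.lt 3 4))))

/-- Nesting of components. -/
def belowFml : Fml :=
  .and (.rel 6 [0, 1, 2]) <| .and (.or (.neg (.rel 6 [0, 2, 1])) (.rel 23 [0, 1, 2])) <|
    .and (.ex 3 (.rel 5 [0, 1, 3])) (.all 3 (.imp (.rel 5 [0, 1, 3]) (.rel 0 [3, 2])))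

/-- The computation of the relations that depend only on the graph. -/
def staticProg : Prog :=
  .seq connProg <| .seq (.set 24 minFml) <| .seq (.set 5 nbrFml) <| .seq (.set 6 cstFml) <|
    .seq (.set 23 minLtFml) (.set 7 belowFml)

theorem staticProg_sem (h0 : ∀ x y, σ 0 [x, y] ↔ G.Adj x y) : Static G (staticProg.sem σ) := by
  set σ1 := connProg.sem σ with e1
  set σ2 := (Prog.set 24 minFml).sem σ1 with e2
  set σ3 := (Prog.set 5 nbrFml).sem σ2 with e3
  set σ4 := (Prog.set 6 cstFml).sem σ3 with e4
  set σ5 := (Prog.set 23 minLtFml).sem σ4 with e5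
  set σ6 := (Prog.set 7 belowFml).sem σ5 with e6
  have f2 : ∀ b, b ≠ 24 → σ2 b = σ1 b := fun b hb => sem_set_of_ne hb _ _
  have f3 : ∀ b, b ≠ 5 → σ3 b = σ2 b := fun b hb => sem_set_of_ne hb _ _
  have f4 : ∀ b, b ≠ 6 → σ4 b = σ3 b := fun b hb => sem_set_of_ne hb _ _
  have f5 : ∀ b, b ≠ 23 → σ5 b = σ4 b := fun b hb => sem_set_of_ne hb _ _
  have f6 : ∀ b, b ≠ 7 → σ6 b = σ5 b := fun b hb => sem_set_of_ne hb _ _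
  have a1 : ∀ x y, σ1 0 [x, y] ↔ G.Adj x y := by
    rw [e1, sem_of_notMem_writes _ (by decide)]; exact h0
  have c1 : ∀ a b u v, σ1 3 [a, b, u, v] ↔ Conn G (blk G a b) u v := connProg_sem h0
  have m2 : ∀ a b m u, σ2 24 [a, b, m, u] ↔ IsMin G (blk G a b) m u := by
    intro a b m u
    rw [e2, sem_set_self]
    simp [minFml, Fml.eval, Fml.eval_all, Fml.eval_imp, env, c1, IsMin]
  have a2 : ∀ x y, σ2 0 [x, y] ↔ G.Adj x y := by rw [f2 0 (by decide)]; exact a1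
  have c2 : ∀ a b u v, σ2 3 [a, b, u, v] ↔ Conn G (blk G a b) u v := by
    rw [f2 3 (by decide)]; exact c1
  have n3 : ∀ x u w, σ3 5 [x, u, w] ↔ Nbr G (nb G x) u w := by
    intro x u w
    rw [e3, sem_set_self]
    simp [nbrFml, nbFml, Fml.eval, Fml.eval_or, env, c2, a2, Nbr, mem_nb, blk_self]
  have a3 : ∀ x y, σ3 0 [x, y] ↔ G.Adj x y := by rw [f3 0 (by decide)]; exact a2
  have c3 : ∀ a b u v, σ3 3 [a, b, u, v] ↔ Conn G (blk G a b) u v := by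
    rw [f3 3 (by decide)]; exact c2
  have s4 : ∀ x u v, σ4 6 [x, u, v] ↔ Cst G (nb G x) u v := by
    intro x u v
    rw [e4, sem_set_self]
    simp [cstFml, Fml.eval, Fml.eval_all, Fml.eval_imp, env, c3, a3, n3, Cst, blk_self]
  have a4 : ∀ x y, σ4 0 [x, y] ↔ G.Adj x y := by rw [f4 0 (by decide)]; exact a3
  have c4 : ∀ a b u v, σ4 3 [a, b, u, v] ↔ Conn G (blk G a b) u v := by
    rw [f4 3 (by decide)]; exact c3
  have n4 : ∀ x u w, σ4 5 [x, u, w] ↔ Nbr G (nb G x) u w := by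
    rw [f4 5 (by decide)]; exact n3
  have l5 : ∀ x u v, σ5 23 [x, u, v] ↔ MinLt G (nb G x) u v := by
    intro x u v
    rw [e5, sem_set_self]
    simp [minLtFml, Fml.eval, Fml.eval_all, Fml.eval_imp, env, c4, MinLt, blk_self]
  have a5 : ∀ x y, σ5 0 [x, y] ↔ G.Adj x y := by rw [f5 0 (by decide)]; exact a4
  have n5 : ∀ x u w, σ5 5 [x, u, w] ↔ Nbr G (nb G x) u w := by
    rw [f5 5 (by decide)]; exact n4
  have s5 : ∀ x u v, σ5 6 [x, u, v] ↔ Cst G (nb G x) u v := by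
    rw [f5 6 (by decide)]; exact s4
  change Static G σ6
  refine ⟨?_, ?_, ?_, ?_, ?_, ?_⟩
  · rw [f6 0 (by decide)]; exact a5
  · rw [f6 3 (by decide), f5 3 (by decide)]; exact c4
  · rw [f6 5 (by decide)]; exact n5
  · rw [f6 6 (by decide)]; exact s5
  · intro x u v
    rw [e6, sem_set_self]
    simp [belowFml, Fml.eval, Fml.eval_all, Fml.eval_imp, Fml.eval_or, env, a5, n5, s5, l5, Below]
  · rw [f6 24 (by decide), f5 24 (by decide), f4 24 (by decide), f3 24 (by decide)]; exact m2

/-! ### Improving the tables -/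

/-- A ternary relation as a table. -/
def tab3 (σ : Store n) (k : ℕ) (a b v : Fin n) : Prop := σ k [a, b, v]

/-- A relation of arity five as a table. -/
def tab5 (σ : Store n) (k : ℕ) (a b v x y : Fin n) : Prop := σ k [a, b, v, x, y]

/-- The component of `z` without the closed neighbourhood of `x` can be put below `x`. -/
def fitsFml : Fml :=
  .and (.rel 3 [0, 1, 2, 3]) <| .and (.neg (nbFml 3 4)) <|
    .and (.all 5 (.imp (.rel 3 [3, 3, 4, 5]) (.rel 3 [0, 1, 2, 5]))) (.rel 8 [3, 3, 4])

/-- The relation provided by the table `k`. -/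
def pickFml (k : ℕ) : Fml := .ex 4 (.and (.rel 24 [0, 1, 4, 2]) (.rel k [0, 1, 4, 2, 3]))

/-- One step of growing the tree. -/
def mkStep : Prog :=
  .seq (.set 15 (.or (.rel 14 [0, 1, 2, 3, 4, 5]) <|
    .or (.and (.eq 4 3) (.and (.rel 3 [0, 1, 2, 5]) (.rel 0 [3, 5]))) <|
      .ex 6 <| .and (.rel 14 [0, 1, 2, 3, 6, 4]) <| .and (.rel 3 [0, 1, 2, 5]) <|
        .and (.rel 0 [4, 5]) <| .and (.neg (.eq 5 6)) (.neg (.rel 11 [0, 1, 2, 6, 5]))))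
  (.set 14 (.rel 15 [0, 1, 2, 3, 4, 5]))

/-- Growing the tree. -/
def mkProg : Prog := .seq (.set 14 (.neg (.eq 0 0))) (.rep (.rep mkStep))

/-- The vertices of the tree. -/
def rtFml : Fml := .or (.eq 4 3) (.ex 5 (.rel 14 [0, 1, 2, 3, 5, 4]))

/-- The vertices below a vertex of the tree. -/
def capFml : Fml :=
  .and (.rel 11 [0, 1, 2, 4, 5]) <| .ex 6 <| .ex 7 <| .and (.rel 14 [0, 1, 2, 3, 4, 6]) <|
    .and (.rel 3 [4, 4, 5, 7]) (.rel 0 [6, 7])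

/-- Validity of the tree. -/
def goodFml : Fml :=
  .and (.rel 3 [0, 1, 2, 3]) <|
  .and (.all 4 <| .all 5 <| .all 6 <| .imp (.rel 14 [0, 1, 2, 3, 4, 6]) <|
    .imp (.rel 14 [0, 1, 2, 3, 5, 6]) (.eq 4 5)) <|
  .and (.all 4 (.neg (.rel 14 [0, 1, 2, 3, 4, 3]))) <|
  .and (.all 4 <| .all 5 <| .imp (.rel 16 [0, 1, 2, 3, 4]) <| .imp (.rel 16 [0, 1, 2, 3, 5]) <|
    .imp (.rel 0 [4, 5]) (.or (.rel 14 [0, 1, 2, 3, 4, 5]) (.rel 14 [0, 1, 2, 3, 5, 4]))) <|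
  .and (.all 4 <| .all 5 <| .imp (.rel 17 [0, 1, 2, 3, 4, 5]) (.neg (.rel 16 [0, 1, 2, 3, 5]))) <|
  .and (.all 4 <| .all 5 <| .all 6 <| .imp (.rel 17 [0, 1, 2, 3, 4, 5]) <|
    .imp (.rel 16 [0, 1, 2, 3, 6]) <| .imp (.rel 0 [6, 5]) (.rel 14 [0, 1, 2, 3, 4, 6])) <|
  .and (.all 4 <| .all 5 <| .all 6 <| .imp (.rel 17 [0, 1, 2, 3, 4, 5]) <|
    .imp (.rel 3 [0, 1, 2, 6]) <| .imp (.neg (.rel 16 [0, 1, 2, 3, 6])) <|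
    .imp (.rel 0 [6, 5]) (.neg (nbFml 4 6))) <|
  .and (.all 4 <| .all 5 <| .all 6 <| .imp (.neg (.rel 3 [0, 1, 2, 4])) <|
    .imp (.rel 16 [0, 1, 2, 3, 5]) <| .imp (.rel 16 [0, 1, 2, 3, 6]) <|
    .imp (.rel 0 [4, 5]) <| .imp (.rel 0 [4, 6]) (.eq 5 6))
  (.all 4 <| .all 5 <| .all 6 <| .imp (.rel 17 [0, 1, 2, 3, 4, 5]) <|
    .imp (.rel 17 [0, 1, 2, 3, 4, 6]) <| .imp (.neg (.rel 3 [4, 4, 5, 6])) <|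
    .or (.rel 6 [4, 5, 6]) (.rel 6 [4, 6, 5]))

/-- The smallest admissible root. -/
def bestFml : Fml :=
  .and (.rel 18 [0, 1, 2, 3]) (.all 4 (.imp (.rel 18 [0, 1, 2, 4]) (.neg (.lt 4 3))))

/-- The order of the representation obtained from the best root. -/
def precFml : Fml :=
  .ex 5 <| .and (.rel 19 [0, 1, 2, 5]) <| .or (.rel 17 [0, 1, 2, 5, 4, 3]) <| .ex 6 <|
    .and (.rel 17 [0, 1, 2, 5, 6, 3]) <| .and (.rel 17 [0, 1, 2, 5, 6, 4]) <|
      .or (.and (.rel 3 [6, 6, 3, 4]) (.rel 12 [6, 6, 3, 4]))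
        (.and (.neg (.rel 3 [6, 6, 3, 4])) (.rel 7 [6, 3, 4]))

/-- The orientation of the representation obtained from the best root. -/
def adjFml : Fml :=
  .ex 5 <| .and (.rel 19 [0, 1, 2, 5]) <| .and (.rel 0 [3, 4]) <|
    .or (.rel 14 [0, 1, 2, 5, 4, 3]) <|
    .or (.and (.rel 16 [0, 1, 2, 5, 3]) (.and (.rel 3 [0, 1, 2, 4])
      (.neg (.rel 16 [0, 1, 2, 5, 4])))) <|
    .ex 6 <| .and (.rel 17 [0, 1, 2, 5, 6, 3]) <| .and (.rel 17 [0, 1, 2, 5, 6, 4]) <|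
      .and (.rel 3 [6, 6, 3, 4]) (.rel 13 [6, 6, 3, 4])

theorem mkStep_sem (h : Static G σ) (a b v r x y : Fin n) :
    mkStep.sem σ 14 [a, b, v, r, x, y] ↔ σ 14 [a, b, v, r, x, y] ∨
      (x = r ∧ Conn G (blk G a b) v y ∧ G.Adj r y) ∨
      ∃ w, σ 14 [a, b, v, r, w, x] ∧ Conn G (blk G a b) v y ∧ G.Adj x y ∧ y ≠ w ∧
        ¬ σ 11 [a, b, v, w, y] := by
  rw [mkStep, sem, sem_set_self]
  simp only [Fml.eval, List.map]
  rw [sem_set_self]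
  simp [Fml.eval, Fml.eval_or, env, h.adj, h.conn]

/-- With the other arguments fixed, this is a least fixed point over pairs, reached within `n * n`
rounds; the relation storing `T` is untouched meanwhile. -/
theorem mkProg_sem (h : Static G σ) (a b v r : Fin n) (T : Fin n → Fin n → Prop)
    (hT : ∀ x z, σ 11 [a, b, v, x, z] ↔ T x z) (x y : Fin n) :
    mkProg.sem σ 14 [a, b, v, r, x, y] ↔ Mk G (comp G (blk G a b) v) r T x y := by
  rw [mkProg, sem, sem_rep_rep]
  set τ := (Prog.set 14 (.neg (.eq 0 0))).sem σ with hτ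
  have hτ3 : ∀ x y, ¬ τ 14 [a, b, v, r, x, y] := by
    intro x y
    rw [hτ, sem_set_self]
    simp [Fml.eval]
  have hfr : ∀ i c, c ∉ [14, 15] → (mkStep.sem^[i] τ) c = σ c := by
    intro i c hc
    induction i with
    | zero =>
      simp only [List.mem_cons, not_or] at hc
      exact sem_set_of_ne hc.1 _ _
    | succ i ih =>
      rw [Function.iterate_succ_apply', sem_of_notMem_writes _ ?_, ih]
      simpa [mkStep, writes, and_comm] using hc
  have hst : ∀ i, Static G (mkStep.sem^[i] τ) := fun i => h.congr fun c hc =>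
    hfr i c (by revert c; decide)
  let F : Set (Fin n × Fin n) → Set (Fin n × Fin n) := fun S => {p | p ∈ S ∨
    (p.1 = r ∧ Conn G (blk G a b) v p.2 ∧ G.Adj r p.2) ∨
      ∃ w, (w, p.1) ∈ S ∧ Conn G (blk G a b) v p.2 ∧ G.Adj p.1 p.2 ∧ p.2 ≠ w ∧ ¬ T w p.2}
  let f : ℕ → Set (Fin n × Fin n) := fun i =>
    {p | (mkStep.sem^[i] τ) 14 [a, b, v, r, p.1, p.2]}
  have hf : ∀ i, f (i + 1) = F (f i) := by
    intro i
    ext p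
    change (mkStep.sem^[i + 1] τ) 14 [a, b, v, r, p.1, p.2] ↔ _
    rw [Function.iterate_succ_apply', mkStep_sem (hst i), hfr i 11 (by decide)]
    simp only [hT]
    rfl
  have hfix := iterate_stationary F (fun S p hp => Or.inl hp) f hf (N := n * n)
    (by simp)
  change (x, y) ∈ f (n * n) ↔ _
  constructor
  · have key : ∀ i p, p ∈ f i → Mk G (comp G (blk G a b) v) r T p.1 p.2 := by
      intro i
      induction i with
      | zero => exact fun p hp => absurd hp (hτ3 _ _)
      | succ i ih =>
        rintro ⟨x, y⟩ hp
        rw [hf] at hp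
        rcases hp with hp | ⟨rfl, h1, h2⟩ | ⟨w, hw, h1, h2, h3, h4⟩
        · exact ih _ hp
        · exact .base h1 h2
        · exact .step (ih _ hw) h1 h2 h3 h4
    exact key _ (x, y)
  · intro hxy
    induction hxy with
    | base hz hrz => rw [← hfix]; exact Or.inr (Or.inl ⟨rfl, hz, hrz⟩)
    | step _ hz hyz hzx hTz ih =>
      rw [← hfix]; exact Or.inr (Or.inr ⟨_, ih, hz, hyz, hzx, hTz⟩)

end Recognition

/-! ### The recognition program. -/

namespace Recognition

open Query Query.Prog

variable {n : ℕ} [NeZero n] {G : SimpleGraph (Fin n)} {σ : Store n}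

/-- The admissible roots and the data of the trees that they generate. -/
structure Grown (G : SimpleGraph (Fin n)) (P : Fin n → Fin n → Fin n → Prop)
    (p q : Fin n → Fin n → Fin n → Fin n → Fin n → Prop) (σ : Store n) : Prop where
  static : Static G σ
  fits : ∀ a b v x z, σ 11 [a, b, v, x, z] ↔ Fits G P (comp G (blk G a b) v) x z
  pickPrec : ∀ a b u w, σ 12 [a, b, u, w] ↔ pick G p a b u w
  pickAdj : ∀ a b u w, σ 13 [a, b, u, w] ↔ pick G q a b u w
  tree : ∀ a b v r x y, σ 14 [a, b, v, r, x, y] ↔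
    Mk G (comp G (blk G a b) v) r (Fits G P (comp G (blk G a b) v)) x y
  rt : ∀ a b v r y, σ 16 [a, b, v, r, y] ↔
    Rt G (comp G (blk G a b) v) r (Fits G P (comp G (blk G a b) v)) y
  cap : ∀ a b v r x u, σ 17 [a, b, v, r, x, u] ↔
    Cap G (comp G (blk G a b) v) r (Fits G P (comp G (blk G a b) v)) x u

omit [NeZero n] in
theorem Grown.congr {P : Fin n → Fin n → Fin n → Prop}
    {p q : Fin n → Fin n → Fin n → Fin n → Fin n → Prop} {τ : Store n} (h : Grown G P p q σ)
    (h' : ∀ a ∈ [0, 3, 5, 6, 7, 24, 11, 12, 13, 14, 16, 17], τ a = σ a) : Grown G P p q τ := by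
  constructor
  · exact h.static.congr fun a ha => h' a (by revert a; simp)
  · rw [h' 11 (by decide)]; exact h.fits
  · rw [h' 12 (by decide)]; exact h.pickPrec
  · rw [h' 13 (by decide)]; exact h.pickAdj
  · rw [h' 14 (by decide)]; exact h.tree
  · rw [h' 16 (by decide)]; exact h.rt
  · rw [h' 17 (by decide)]; exact h.cap

/-- The first half of the improvement of the tables. -/
def growProg : Prog :=
  .seq (.set 11 fitsFml) <| .seq (.set 12 (pickFml 9)) <| .seq (.set 13 (pickFml 10)) <|
  .seq mkProg <| .seq (.set 16 rtFml) (.set 17 capFml)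

theorem growProg_sem (h : Static G σ) :
    Grown G (tab3 σ 8) (tab5 σ 9) (tab5 σ 10) (growProg.sem σ) := by
  set σ1 := (Prog.set 11 fitsFml).sem σ with e1
  set σ2 := (Prog.set 12 (pickFml 9)).sem σ1 with e2
  set σ3 := (Prog.set 13 (pickFml 10)).sem σ2 with e3
  set σ4 := mkProg.sem σ3 with e4
  set σ5 := (Prog.set 16 rtFml).sem σ4 with e5
  set σ6 := (Prog.set 17 capFml).sem σ5 with e6
  have f1 : ∀ b, b ≠ 11 → σ1 b = σ b := fun b hb => sem_set_of_ne hb _ _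
  have f2 : ∀ b, b ≠ 12 → σ2 b = σ1 b := fun b hb => sem_set_of_ne hb _ _
  have f3 : ∀ b, b ≠ 13 → σ3 b = σ2 b := fun b hb => sem_set_of_ne hb _ _
  have f4 : ∀ b, b ∉ mkProg.writes → σ4 b = σ3 b := fun b hb => sem_of_notMem_writes _ hb _
  have f5 : ∀ b, b ≠ 16 → σ5 b = σ4 b := fun b hb => sem_set_of_ne hb _ _
  have f6 : ∀ b, b ≠ 17 → σ6 b = σ5 b := fun b hb => sem_set_of_ne hb _ _
  have s1 : Static G σ1 := h.congr fun a ha => f1 a (by revert a; decide)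
  have s2 : Static G σ2 := s1.congr fun a ha => f2 a (by revert a; decide)
  have s3 : Static G σ3 := s2.congr fun a ha => f3 a (by revert a; decide)
  have s4 : Static G σ4 := s3.congr fun a ha => f4 a (by revert a; decide)
  have s5 : Static G σ5 := s4.congr fun a ha => f5 a (by revert a; decide)
  have s6 : Static G σ6 := s5.congr fun a ha => f6 a (by revert a; decide)
  have g1 : ∀ a b v x z, σ1 11 [a, b, v, x, z] ↔
      Fits G (tab3 σ 8) (comp G (blk G a b) v) x z := by
    intro a b v x z
    rw [e1, sem_set_self]
    simp [fitsFml, nbFml, Fml.eval, Fml.eval_or, Fml.eval_all, Fml.eval_imp, env, h.adj, h.conn,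
      Fits, mem_nb, mem_comp, comp_subset, blk_self, tab3]
  have p2 : ∀ a b u w, σ2 12 [a, b, u, w] ↔ pick G (tab5 σ 9) a b u w := by
    intro a b u w
    rw [e2, sem_set_self]
    simp [pickFml, Fml.eval, env, s1.isMin, f1 9 (by decide), pick, tab5]
  have q3 : ∀ a b u w, σ3 13 [a, b, u, w] ↔ pick G (tab5 σ 10) a b u w := by
    intro a b u w
    rw [e3, sem_set_self]
    simp [pickFml, Fml.eval, env, s2.isMin, f2 10 (by decide), f1 10 (by decide), pick, tab5]
  have g3 : ∀ a b v x z, σ3 11 [a, b, v, x, z] ↔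
      Fits G (tab3 σ 8) (comp G (blk G a b) v) x z := by
    rw [f3 11 (by decide), f2 11 (by decide)]; exact g1
  have m4 : ∀ a b v r x y, σ4 14 [a, b, v, r, x, y] ↔ Mk G (comp G (blk G a b) v) r
      (Fits G (tab3 σ 8) (comp G (blk G a b) v)) x y := fun a b v r x y =>
    mkProg_sem s3 a b v r _ (g3 a b v) x y
  have r5 : ∀ a b v r y, σ5 16 [a, b, v, r, y] ↔ Rt G (comp G (blk G a b) v) r
      (Fits G (tab3 σ 8) (comp G (blk G a b) v)) y := by
    intro a b v r y
    rw [e5, sem_set_self]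
    simp [rtFml, Fml.eval, Fml.eval_or, env, m4, Rt]
  have g5 : ∀ a b v x z, σ5 11 [a, b, v, x, z] ↔
      Fits G (tab3 σ 8) (comp G (blk G a b) v) x z := by
    rw [f5 11 (by decide), f4 11 (by decide)]; exact g3
  have m5 : ∀ a b v r x y, σ5 14 [a, b, v, r, x, y] ↔ Mk G (comp G (blk G a b) v) r
      (Fits G (tab3 σ 8) (comp G (blk G a b) v)) x y := by
    rw [f5 14 (by decide)]; exact m4
  change Grown G (tab3 σ 8) (tab5 σ 9) (tab5 σ 10) σ6
  refine ⟨s6, ?_, ?_, ?_, ?_, ?_, ?_⟩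
  · rw [f6 11 (by decide)]; exact g5
  · rw [f6 12 (by decide), f5 12 (by decide), f4 12 (by decide), f3 12 (by decide)]; exact p2
  · rw [f6 13 (by decide), f5 13 (by decide), f4 13 (by decide)]; exact q3
  · rw [f6 14 (by decide)]; exact m5
  · rw [f6 16 (by decide)]; exact r5
  · intro a b v r x u
    rw [e6, sem_set_self]
    simp [capFml, Fml.eval, env, g5, m5, s5.adj, s5.conn, blk_self, Cap]

/-- The second half of the improvement of the tables. -/
def chooseProg : Prog :=
  .seq (.set 18 goodFml) <| .seq (.set 19 bestFml) <| .seq (.set 8 (.ex 3 (.rel 18 [0, 1, 2, 3]))) <|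
  .seq (.set 9 precFml) (.set 10 adjFml)

/-- Relations `8`, `9` and `10` can be overwritten one after the other: none of the formulas here
reads them, the old entries having been extracted by `growProg`. -/
theorem chooseProg_sem {P : Fin n → Fin n → Fin n → Prop}
    {p q : Fin n → Fin n → Fin n → Fin n → Fin n → Prop} (h : Grown G P p q σ) :
    tab3 (chooseProg.sem σ) 8 = nextP G P ∧ tab5 (chooseProg.sem σ) 9 = nextPrec G P p ∧
      tab5 (chooseProg.sem σ) 10 = nextAdj G P q := by
  set σ1 := (Prog.set 18 goodFml).sem σ with e1
  set σ2 := (Prog.set 19 bestFml).sem σ1 with e2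
  set σ3 := (Prog.set 8 (.ex 3 (.rel 18 [0, 1, 2, 3]))).sem σ2 with e3
  set σ4 := (Prog.set 9 precFml).sem σ3 with e4
  set σ5 := (Prog.set 10 adjFml).sem σ4 with e5
  have f1 : ∀ b, b ≠ 18 → σ1 b = σ b := fun b hb => sem_set_of_ne hb _ _
  have f2 : ∀ b, b ≠ 19 → σ2 b = σ1 b := fun b hb => sem_set_of_ne hb _ _
  have f3 : ∀ b, b ≠ 8 → σ3 b = σ2 b := fun b hb => sem_set_of_ne hb _ _
  have f4 : ∀ b, b ≠ 9 → σ4 b = σ3 b := fun b hb => sem_set_of_ne hb _ _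
  have f5 : ∀ b, b ≠ 10 → σ5 b = σ4 b := fun b hb => sem_set_of_ne hb _ _
  have h1 : Grown G P p q σ1 := h.congr fun a ha => f1 a (by revert a; decide)
  have h2 : Grown G P p q σ2 := h1.congr fun a ha => f2 a (by revert a; decide)
  have h3 : Grown G P p q σ3 := h2.congr fun a ha => f3 a (by revert a; decide)
  have h4 : Grown G P p q σ4 := h3.congr fun a ha => f4 a (by revert a; decide)
  have g1 : ∀ a b v r, σ1 18 [a, b, v, r] ↔ Good G P a b v r := by
    intro a b v r
    rw [e1, sem_set_self]
    simp [goodFml, nbFml, Fml.eval, Fml.eval_or, Fml.eval_all, Fml.eval_imp, env, h.static.adj,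
      h.static.conn, h.static.cst, h.tree, h.rt, h.cap, Good, valid_iff, mem_nb, mem_comp, blk_self]
  have b2 : ∀ a b v r, σ2 19 [a, b, v, r] ↔ Best G P a b v r := by
    intro a b v r
    rw [e2, sem_set_self]
    simp [bestFml, Fml.eval, Fml.eval_all, Fml.eval_imp, env, g1, Best]
  have g2 : ∀ a b v r, σ2 18 [a, b, v, r] ↔ Good G P a b v r := by
    rw [f2 18 (by decide)]; exact g1
  have b3 : ∀ a b v r, σ3 19 [a, b, v, r] ↔ Best G P a b v r := by
    rw [f3 19 (by decide)]; exact b2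
  have b4 : ∀ a b v r, σ4 19 [a, b, v, r] ↔ Best G P a b v r := by
    rw [f4 19 (by decide)]; exact b3
  change tab3 σ5 8 = _ ∧ tab5 σ5 9 = _ ∧ tab5 σ5 10 = _
  refine ⟨?_, ?_, ?_⟩
  · funext a b v
    apply propext
    rw [tab3, f5 8 (by decide), f4 8 (by decide), e3, sem_set_self]
    simp [Fml.eval, env, g2, nextP]
  · funext a b v x y
    apply propext
    rw [tab5, f5 9 (by decide), e4, sem_set_self]
    simp [precFml, Fml.eval, Fml.eval_or, env, b3, h3.cap, h3.static.conn, h3.static.below,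
      h3.pickPrec, nextPrec, treePrec, Recognition.nestPrec, blk_self]
  · funext a b v x y
    apply propext
    rw [tab5, e5, sem_set_self]
    simp [adjFml, Fml.eval, Fml.eval_or, env, b4, h4.cap, h4.tree, h4.rt, h4.static.adj,
      h4.static.conn, h4.pickAdj, nextAdj, treeAdj, Recognition.nestAdj, blk_self, mem_comp]

/-- One improvement of the tables. -/
def stepProg : Prog := .seq growProg chooseProg

theorem stepProg_correct (h : Static G σ) {k : ℕ}
    (hc : Correct G k (tab3 σ 8) (tab5 σ 9) (tab5 σ 10)) :
    Static G (stepProg.sem σ) ∧ Correct G (k + 1) (tab3 (stepProg.sem σ) 8)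
      (tab5 (stepProg.sem σ) 9) (tab5 (stepProg.sem σ) 10) := by
  constructor
  · exact h.congr fun a ha => sem_of_notMem_writes stepProg (by revert a; decide) σ
  · obtain ⟨h1, h2, h3⟩ := chooseProg_sem (growProg_sem h)
    have := hc.succ
    rwa [← h1, ← h2, ← h3] at this

/-- No component has more than `n` vertices, so `n` improvements of arbitrary tables suffice. -/
theorem rep_stepProg_correct (h : Static G σ) :
    Static G ((rep stepProg).sem σ) ∧ Correct G n (tab3 ((rep stepProg).sem σ) 8)
      (tab5 ((rep stepProg).sem σ) 9) (tab5 ((rep stepProg).sem σ) 10) := by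
  have key : ∀ i, Static G (stepProg.sem^[i] σ) ∧ Correct G i (tab3 (stepProg.sem^[i] σ) 8)
      (tab5 (stepProg.sem^[i] σ) 9) (tab5 (stepProg.sem^[i] σ) 10) := by
    intro i
    induction i with
    | zero => exact ⟨h, correct_zero _ _ _⟩
    | succ i ih =>
      rw [Function.iterate_succ_apply']
      exact stepProg_correct ih.1 ih.2
  exact key n

/-- The relation that the table `k` provides for the components of the graph. -/
def finalFml (k : ℕ) : Fml :=
  .ex 2 <| .ex 3 <| .and (.neg (.eq 2 3)) <| .and (.all 4 (.neg (.lt 4 2))) <|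
    .and (.all 4 (.neg (.lt 3 4))) <| .and (.rel 3 [2, 3, 0, 1]) <|
      .ex 4 (.and (.rel 24 [2, 3, 4, 0]) (.rel k [2, 3, 4, 0, 1]))

theorem eval_finalFml (h : Static G σ) (k : ℕ) (u v : Fin n) :
    (finalFml k).eval σ (env [u, v]) ↔ final G (tab5 σ k) u v := by
  simp [finalFml, Fml.eval, Fml.eval_all, env, h.conn, h.isMin, final, pick, tab5]

/-- The recognition of Burling graphs. -/
def recognize : Prog :=
  .seq staticProg <| .seq (.rep stepProg) <| .seq (.set 1 (finalFml 9)) (.set 2 (finalFml 10))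

/-- Every component has a representation. -/
def acceptFml : Fml := .all 0 (.all 1 (.all 2 (.imp (.neg (.eq 0 1)) (.rel 8 [0, 1, 2]))))

theorem recognize_wf : recognize.WF arity := by
  simp [recognize, staticProg, connProg, connStep, stepProg, growProg, chooseProg, mkProg, mkStep,
    minFml, nbFml, nbrFml, cstFml, minLtFml, belowFml, fitsFml, pickFml, rtFml, capFml, goodFml,
    bestFml, precFml, adjFml, finalFml, blkFml, Prog.WF, Fml.WF, Fml.or, Fml.imp, Fml.all, arity]

theorem acceptFml_wf : acceptFml.WF arity 50 := by
  simp [acceptFml, Fml.WF, Fml.imp, Fml.all, arity]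

theorem recognize_sem (h0 : ∀ x y, σ 0 [x, y] ↔ G.Adj x y) :
    (acceptFml.eval (recognize.sem σ) (env []) →
      IsBurlingSet (fun i j => recognize.sem σ 1 [i, j]) (fun i j => recognize.sem σ 2 [i, j]) ∧
        G = SimpleGraph.fromRel (fun i j => recognize.sem σ 2 [i, j])) ∧
    (¬ acceptFml.eval (recognize.sem σ) (env []) → ¬ ∃ prec adj : Fin n → Fin n → Prop,
      IsBurlingSet prec adj ∧ G = SimpleGraph.fromRel adj) := by
  obtain ⟨hs, hc⟩ := rep_stepProg_correct (staticProg_sem h0)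
  set τ := (rep stepProg).sem (staticProg.sem σ) with hτ
  set τ1 := (Prog.set 1 (finalFml 9)).sem τ with e1
  set τ2 := (Prog.set 2 (finalFml 10)).sem τ1 with e2
  have f1 : ∀ b, b ≠ 1 → τ1 b = τ b := fun b hb => sem_set_of_ne hb _ _
  have f2 : ∀ b, b ≠ 2 → τ2 b = τ1 b := fun b hb => sem_set_of_ne hb _ _
  have hs1 : Static G τ1 := hs.congr fun a ha => f1 a (by revert a; decide)
  have h1 : (fun i j => τ2 1 [i, j]) = final G (tab5 τ 9) := by
    funext i j
    apply propext
    rw [f2 1 (by decide), e1, sem_set_self, eval_finalFml hs]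
  have h2 : (fun i j => τ2 2 [i, j]) = final G (tab5 τ 10) := by
    have h10 : tab5 τ1 10 = tab5 τ 10 := by funext; simp only [tab5, f1 10 (by decide)]
    funext i j
    apply propext
    rw [e2, sem_set_self, eval_finalFml hs1, h10]
  have h3 : acceptFml.eval τ2 (env []) ↔ ∀ a b v, a ≠ b → tab3 τ 8 a b v := by
    simp [acceptFml, Fml.eval, Fml.eval_all, Fml.eval_imp, f2 8 (by decide), f1 8 (by decide), tab3]
  change (acceptFml.eval τ2 (env []) → IsBurlingSet (fun i j => τ2 1 [i, j])
    (fun i j => τ2 2 [i, j]) ∧ G = SimpleGraph.fromRel fun i j => τ2 2 [i, j]) ∧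
      (¬ acceptFml.eval τ2 (env []) → _)
  rw [h1, h2, h3]
  have hn : Nat.card (Fin n) = n := by simp
  exact Correct.decide (hn.symm ▸ hc)

end Recognition

theorem mainTheorem3 :
    ∃ (c : RAM.Cmd) (p : Polynomial ℕ), ∀ n : ℕ, 1 ≤ n → ∀ G : SimpleGraph (Fin n),
      ∃ (s : RAM.State) (t : ℕ), RAM.Exec c (RAM.graphInput G) s t ∧ t ≤ p.eval n ∧
        ((s.reg 0 = 1 ∧ IsBurlingGraph G ∧
            IsBurlingSet (s.rel n 1) (s.rel n 2) ∧ G = SimpleGraph.fromRel (s.rel n 2)) ∨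
          (s.reg 0 = 0 ∧ ¬ IsBurlingGraph G ∧
            ¬ ∃ prec adj : Fin n → Fin n → Prop,
              IsBurlingSet prec adj ∧ G = SimpleGraph.fromRel adj)) := by
  obtain ⟨c, T, hT⟩ := Query.exists_cmd Recognition.arity rfl rfl Recognition.recognize
    Recognition.recognize_wf Recognition.acceptFml Recognition.acceptFml_wf
  refine ⟨c, T, fun n hn G => ?_⟩
  have : NeZero n := ⟨by omega⟩
  obtain ⟨s, t, hs, ht, h0, h1, h2⟩ := hT n G
  refine ⟨s, t, hs, ht, ?_⟩
  obtain ⟨hacc, hrej⟩ := Recognition.recognize_sem (Query.inputStore_adj G)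
  rw [h0, h1, h2]
  by_cases h : Recognition.acceptFml.eval (Recognition.recognize.sem (Query.inputStore G))
    (Query.env [])
  · obtain ⟨h3, h4⟩ := hacc h
    exact Or.inl ⟨if_pos h, by rw [h4]; exact h3.isBurlingGraph, h3, h4⟩
  · exact Or.inr ⟨if_neg h, fun hG => hrej h hG.exists_isBurlingSet, hrej h⟩
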